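/- **Setting.** Networks are synchronous and deterministic; all machines run the same program (one program for each $n$), are finite-state machines whose local computation is restricted only by their memory, and communicate in rounds. A machine word has $\Theta(\log n)$ bits: it is a number below $(n+1)^{\kappa}$ for a constant $\kappa$. Vertices carry arbitrary distinct identifiers below $(n+1)^{k}$, where $1\le k\le\kappa$ are constants. The arboricity of a graph is the least number of edge-disjoint forests whose union is the graph. An *unlabeled graph problem* $\Pi$ consists of a class of input graphs without labels and, for each input graph $G$, a set of legal outputs that depends only on $G$ and not on the identifiers; an output assigns to each vertex a (possibly empty) list of numbers and references to vertices (written as identifiers), of total length polynomial in $n$. An algorithm solves $\Pi$ in $T(n)$ rounds if on every $n$-vertex instance and every input representation it violates no memory, bandwidth or addressing constraint and after $T(n)$ rounds outputs a legal output. *$\mathrm{NCC}^*_0(C)$:* the nodes are the $n$ vertices of the input graph. Each node has $C$ words of local memory and sends and receives at most $C$ words per round. Initially $v$ knows only its own identifier and its ports, numbered in an arbitrary way, one for each of its $\deg(v)$ neighbours. It may send messages through its ports and to any node whose identifier it has learned from messages (of which it sees the sender), and it may evaluate, on identifiers present in its memory or in the messages just received, the function $f_v$ mapping the identifier of a neighbour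 to its port and everything else to $\bot$. Node $v$ outputs the label of $v$, using at most $C$ words. *$\mathrm{MPC}(M,S)$:* there are $M$ machines with identifiers $0,\dots,M-1$, each with $S$ words of memory, and each sends and receives at most $S$ words per round, to and from arbitrary machines. The vertices (one word each) and edges (two words each) of the input graph are initially distributed arbitrarily on the machines, at most $S$ words per machine. Each machine outputs a list of vertex identifiers with their labels, of at most $S$ words in total; together these must be the non-empty labels of a legal output. **Theorem.** Let $1\le k\le \kappa$. 1. There are constants $K$ and $\kappa'\ge\kappa$, depending only on $k$ and $\kappa$, such that the following holds. Let $\delta\in(0,1)$, and let $C(n)\ge 1$, $a(n)\ge 1$ and $S(n)$ be integers and $\beta(n)\ge 2$ real, with $$S\ \ge\ K\cdot\bigl(\beta a\,(\beta a+\log_\beta n)+C\beta a\bigr)\qquad\text{and}\qquad S\ge n^\delta .$$ Then every unlabeled graph problem on graphs of arboricity at most $a$ that is solvable in $T(n)$ rounds in $\mathrm{NCC}^*_0(C)$ with word constant $\kappa$ is solvable in $\mathrm{MPC}(n,S)$ with word constant $\kappa'$ in at most $$K\cdot\frac{\lceil\log_\beta n\rceil}{\delta}+\frac{K}{\delta}\cdot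 T(n)$$ rounds. That is, for constant $\delta$, an additive overhead of $O(\tfrac1\delta\log_\beta n)$ rounds and constant slowdown suffice with $S=O(\beta a(\beta a+\log_\beta n)+C\beta a)$ (as long as $S\ge n^\delta$). 2. There is a constant $K$, depending only on $k$ and $\kappa$, such that for every constant $\delta\in(0,\tfrac14)$ there is a constant $\kappa'\ge\kappa$, depending only on $k,\kappa,\delta$, with: every unlabeled graph problem on graphs with $n^\delta\ge 2$ and arboricity at most $n^\delta$ that is solvable in $T(n)$ rounds in $\mathrm{NCC}^*_0(\lfloor n^\delta\rfloor)$ with word constant $\kappa$ is solvable in $\mathrm{MPC}(n,\lfloor n^{4\delta}\rfloor)$ with word constant $\kappa'$ in at most $\frac{K}{\delta^2}+\frac{K}{\delta}\,T(n)$ rounds. In particular $\mathrm{NCC}^*_0(n^\delta)\le\mathrm{MPC}(n,n^{4\delta})$ on such problems, up to a constant additive overhead. -/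

import Mathlib

noncomputable section

namespace CliqueSim

/-! ## Arboricity -/

/-- The smallest `k` such that `G` is the union of `k` edge-disjoint forests. -/
def arboricity {V : Type} (G : SimpleGraph V) : ℕ :=
  sInf {k : ℕ | ∃ F : Fin k → SimpleGraph V,
    (∀ i, (F i).IsAcyclic) ∧ (Pairwise fun i j => Disjoint (F i) (F j)) ∧ ⨆ i, F i = G}

/-! ## Words, identifiers, outputs, problems -/

/-- In a network for `n`-vertex graphs a machine word with constant `κ` consists of
`κ * log₂ (n + 1)` bits, that is, it is a natural number below `(n + 1) ^ κ`. -/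
def IsWord (κ n x : ℕ) : Prop := x < (n + 1) ^ κ

/-- An assignment of pairwise distinct identifiers, from an ID space of size polynomial in `n`,
to the vertices. -/
abbrev Identifiers (k n : ℕ) : Type := Fin n ↪ Fin ((n + 1) ^ k)

/-- A solution of a graph problem: every vertex carries a finite (possibly empty) output label,
whose entries are references to vertices (`Sum.inl`) or plain numbers (`Sum.inr`). -/
abbrev Solution (n : ℕ) : Type := Fin n → List (Fin n ⊕ ℕ)

/-- The form in which a label is written by a machine: vertices are written as identifiers. -/
def encode {k n : ℕ} (ident : Identifiers k n) (l : List (Fin n ⊕ ℕ)) : List (ℕ ⊕ ℕ) :=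
  l.map (Sum.map (fun v => (ident v : ℕ)) id)

/-- The numerical value of an entry of a written label. -/
def tokenValue : ℕ ⊕ ℕ → ℕ
  | Sum.inl x => x
  | Sum.inr x => x

/-- An unlabeled graph problem. There are no input labels, and the set of legal outputs is a
function of the graph only: it does not depend on the identifiers, which are not part of the
data here. Legal outputs have polynomial size. -/
structure UnlabeledGraphProblem where
  IsInstance : ∀ {n : ℕ}, SimpleGraph (Fin n) → Prop
  IsLegal : ∀ {n : ℕ}, SimpleGraph (Fin n) → Solution n → Prop
  legal_size : ∃ c : ℕ, ∀ (n : ℕ) (G : SimpleGraph (Fin n)) (s : Solution n),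
    IsInstance G → IsLegal G s → ∑ v, (s v).length ≤ (n + 1) ^ c

/-- The messages that a machine receives in one round: each consists of the identifier of its
sender and of its payload, a list of words. -/
abbrev Inbox : Type := Multiset (ℕ × List ℕ)

/-- The total number of payload words of an inbox. -/
def Inbox.words (I : Inbox) : ℕ := (I.map fun m => m.2.length).sum

/-! ## The model `NCC*₀(C)` -/

/-- The addressee of a message: the initial neighbour behind a port, or the node with a given
identifier. -/
inductive Dest : Type
  | port (p : ℕ) : Dest
  | node (x : ℕ) : Dest

/-- The program run by all nodes. The arguments of `init` are the node's own identifier and its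
degree; `step` and `output` further get the port lookup function of the node (see
`NCCStar.lookup`), the local memory, and the messages that arrived in the last round. In a
round a node computes its new memory and the messages it sends. -/
structure NCCStarAlgorithm where
  init : ℕ → ℕ → List ℕ
  step : ℕ → ℕ → (ℕ → Option ℕ) → List ℕ → Inbox → List ℕ × List (Dest × List ℕ)
  output : ℕ → ℕ → (ℕ → Option ℕ) → List ℕ → Inbox → List (ℕ ⊕ ℕ)

namespace NCCStar

variable {n k : ℕ} {G : SimpleGraph (Fin n)}

/-- The degree of a vertex. -/
def deg (G : SimpleGraph (Fin n)) (v : Fin n) : ℕ := (G.neighborSet v).ncard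

/-- An input representation: identifiers, and for every node a numbering of its neighbours by
the ports `0, …, deg v - 1`. -/
structure Input (k : ℕ) (G : SimpleGraph (Fin n)) where
  ident : Identifiers k n
  ports : ∀ v, Fin (deg G v) ≃ G.neighborSet v

open Classical in
/-- The function `f_v`: it maps the identifier of a neighbour of `v` to the number of the
corresponding port, and everything else to `none`. -/
def Input.portOf (I : Input k G) (v : Fin n) (x : ℕ) : Option ℕ :=
  if h : ∃ p : Fin (deg G v), (I.ident (I.ports v p) : ℕ) = x then some (h.choose : ℕ) else none

open Classical in
/-- The node that a message of `v` to a given addressee reaches, if there is one. -/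
def Input.resolve (I : Input k G) (v : Fin n) : Dest → Option (Fin n)
  | Dest.port p => if h : p < deg G v then some (I.ports v ⟨p, h⟩ : Fin n) else none
  | Dest.node x => if h : ∃ u, (I.ident u : ℕ) = x then some h.choose else none

/-- A configuration between two rounds: the local memories, the messages that are about to be
received, and the sets of identifiers that the nodes have learned so far. -/
structure Config (n : ℕ) where
  mem : Fin n → List ℕ
  inbox : Fin n → Inbox
  known : Fin n → Set ℕ

open Classical in
/-- The access that `v` has to `f_v`: a node can evaluate it on the identifiers that are present
locally, in its memory or in the messages it has just received. -/
def lookup (I : Input k G) (c : Config n) (v : Fin n) (x : ℕ) : Option ℕ :=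
  if x ∈ c.mem v ∨ ∃ m ∈ c.inbox v, x = m.1 ∨ x ∈ m.2 then I.portOf v x else none

/-- What `v` does in a round: its new memory and the messages it sends. -/
def act (A : NCCStarAlgorithm) (I : Input k G) (c : Config n) (v : Fin n) :
    List ℕ × List (Dest × List ℕ) :=
  A.step (I.ident v) (deg G v) (lookup I c v) (c.mem v) (c.inbox v)

/-- The messages that `v` receives as a result of a round. -/
def delivered (A : NCCStarAlgorithm) (I : Input k G) (c : Config n) (v : Fin n) : Inbox :=
  ∑ u : Fin n, ((((act A I c u).2.filter fun m => I.resolve u m.1 = some v).map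
    fun m => ((I.ident u : ℕ), m.2) : List (ℕ × List ℕ)) : Inbox)

/-- The identifiers that `v` learns from the messages of a round: those of the senders, and all
identifiers that occur in the message and had been learned by its sender. -/
def learned (A : NCCStarAlgorithm) (I : Input k G) (c : Config n) (v : Fin n) : Set ℕ :=
  {x | ∃ u : Fin n, ∃ m ∈ (act A I c u).2, I.resolve u m.1 = some v ∧
    (x = I.ident u ∨ (x ∈ m.2 ∧ x ∈ c.known u))}

/-- The initial configuration; a node knows no identifier but its own. -/
def start (A : NCCStarAlgorithm) (I : Input k G) : Config n where
  mem v := A.init (I.ident v) (deg G v)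
  inbox _ := 0
  known v := {(I.ident v : ℕ)}

/-- One synchronous round. -/
def next (A : NCCStarAlgorithm) (I : Input k G) (c : Config n) : Config n where
  mem v := (act A I c v).1
  inbox v := delivered A I c v
  known v := c.known v ∪ learned A I c v

/-- The configuration after `t` rounds. -/
def run (A : NCCStarAlgorithm) (I : Input k G) (t : ℕ) : Config n :=
  (next A I)^[t] (start A I)

/-- All local memories consist of at most `C` words. -/
def MemoryOK (κ C : ℕ) (c : Config n) : Prop :=
  ∀ v, (c.mem v).length ≤ C ∧ ∀ x ∈ c.mem v, IsWord κ n x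

/-- The communication of a round is legal: every node sends and receives at most `C` words, the
messages are non-empty and consist of words, and they are addressed to ports of the sender or
to nodes whose identifier the sender has learned. -/
def RoundOK (A : NCCStarAlgorithm) (I : Input k G) (κ C : ℕ) (c : Config n) : Prop :=
  ∀ v, ((act A I c v).2.map fun m => m.2.length).sum ≤ C ∧
    (∀ m ∈ (act A I c v).2, m.2 ≠ [] ∧ (∀ x ∈ m.2, IsWord κ n x) ∧
      (I.resolve v m.1).isSome ∧ ∀ x, m.1 = Dest.node x → x ∈ c.known v) ∧
    (delivered A I c v).words ≤ C

/-- The output of `v` after `T` rounds. -/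
def out (A : NCCStarAlgorithm) (I : Input k G) (T : ℕ) (v : Fin n) : List (ℕ ⊕ ℕ) :=
  A.output (I.ident v) (deg G v) (lookup I (run A I T) v) ((run A I T).mem v)
    ((run A I T).inbox v)

/-- On the graph `G` and the input representation `I`, the algorithm violates no memory,
bandwidth or addressing constraint during `T` rounds and then every node outputs its label in
some legal solution, using at most `C` words. -/
def Correct (A : NCCStarAlgorithm) (κ C T : ℕ) (P : UnlabeledGraphProblem) (I : Input k G) :
    Prop :=
  (∀ t ≤ T, MemoryOK κ C (run A I t)) ∧
  (∀ t < T, RoundOK A I κ C (run A I t)) ∧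
  (∀ v, (out A I T v).length ≤ C ∧ ∀ x ∈ out A I T v, IsWord κ n (tokenValue x)) ∧
  ∃ s : Solution n, P.IsLegal G s ∧ ∀ v, out A I T v = encode I.ident (s v)

end NCCStar

/-- `P` is solved in `T n` rounds in the model `NCC*₀(C)`, with identifiers below `(n + 1) ^ k`
and words below `(n + 1) ^ κ`: for every `n` there is a program that is correct on all
`n`-vertex instances and all their input representations. -/
def NCCStarSolvable (k κ : ℕ) (C : ℕ → ℕ) (P : UnlabeledGraphProblem) (T : ℕ → ℕ) : Prop :=
  ∀ n : ℕ, ∃ A : NCCStarAlgorithm, ∀ G : SimpleGraph (Fin n), P.IsInstance G →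
    ∀ I : NCCStar.Input k G, NCCStar.Correct A κ (C n) (T n) P I

/-! ## The model `MPC(M, S)` -/

/-- The program run by all machines. The first argument is always the identifier of the machine;
`init` gets the vertices and edges (in terms of vertex identifiers) that are placed on the
machine, `step` and `output` get the local memory and the messages that arrived in the last
round. In a round a machine computes its new memory and the messages it sends; the output is a
list of vertex identifiers with labels. -/
structure MPCAlgorithm where
  init : ℕ → Finset ℕ → Finset (Sym2 ℕ) → List ℕ
  step : ℕ → List ℕ → Inbox → List ℕ × List (ℕ × List ℕ)
  output : ℕ → List ℕ → Inbox → List (ℕ × List (ℕ ⊕ ℕ))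

namespace MPC

variable {n k M : ℕ} {G : SimpleGraph (Fin n)}

/-- An input representation: identifiers of the vertices, and an arbitrary placement of the
vertices and of the edges on the machines (only the values of `edgeLoc` on edges matter). -/
structure Input (k M : ℕ) (G : SimpleGraph (Fin n)) where
  ident : Identifiers k n
  vertexLoc : Fin n → Fin M
  edgeLoc : Sym2 (Fin n) → Fin M

open Classical in
/-- The vertices placed on machine `i`. -/
def Input.vertices (I : Input k M G) (i : Fin M) : Finset ℕ :=
  (Finset.univ.filter fun v => I.vertexLoc v = i).image fun v => (I.ident v : ℕ)

open Classical in
/-- The edges placed on machine `i`. -/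
def Input.edges (I : Input k M G) (i : Fin M) : Finset (Sym2 ℕ) :=
  (Finset.univ.filter fun e => e ∈ G.edgeSet ∧ I.edgeLoc e = i).image
    (Sym2.map fun v => (I.ident v : ℕ))

/-- The placement respects the memory bound of `S` words per machine; a vertex takes one word,
an edge takes two. -/
def Input.Fits (I : Input k M G) (S : ℕ) : Prop :=
  ∀ i, (I.vertices i).card + 2 * (I.edges i).card ≤ S

/-- A configuration between two rounds: the local memories and the messages that are about to be
received. -/
structure Config (M : ℕ) where
  mem : Fin M → List ℕ
  inbox : Fin M → Inbox

/-- What machine `i` does in a round: its new memory and the messages it sends. -/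
def act (A : MPCAlgorithm) (c : Config M) (i : Fin M) : List ℕ × List (ℕ × List ℕ) :=
  A.step i (c.mem i) (c.inbox i)

/-- The messages that machine `i` receives as a result of a round. -/
def delivered (A : MPCAlgorithm) (c : Config M) (i : Fin M) : Inbox :=
  ∑ j : Fin M, ((((act A c j).2.filter fun m => m.1 = (i : ℕ)).map
    fun m => ((j : ℕ), m.2) : List (ℕ × List ℕ)) : Inbox)

/-- The initial configuration. -/
def start (A : MPCAlgorithm) (I : Input k M G) : Config M where
  mem i := A.init i (I.vertices i) (I.edges i)
  inbox _ := 0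

/-- One synchronous round. -/
def next (A : MPCAlgorithm) (c : Config M) : Config M where
  mem i := (act A c i).1
  inbox i := delivered A c i

/-- The configuration after `t` rounds. -/
def run (A : MPCAlgorithm) (I : Input k M G) (t : ℕ) : Config M :=
  (next A)^[t] (start A I)

/-- All local memories consist of at most `S` words. -/
def MemoryOK (κ n S : ℕ) (c : Config M) : Prop :=
  ∀ i, (c.mem i).length ≤ S ∧ ∀ x ∈ c.mem i, IsWord κ n x

/-- The communication of a round is legal: every machine sends and receives at most `S` words,
and the messages are non-empty, consist of words, and are addressed to machines. -/
def RoundOK (A : MPCAlgorithm) (κ n S : ℕ) (c : Config M) : Prop :=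
  ∀ i, ((act A c i).2.map fun m => m.2.length).sum ≤ S ∧
    (∀ m ∈ (act A c i).2, m.2 ≠ [] ∧ (∀ x ∈ m.2, IsWord κ n x) ∧ m.1 < M) ∧
    (delivered A c i).words ≤ S

/-- The output of machine `i` after `T` rounds. -/
def out (A : MPCAlgorithm) (I : Input k M G) (T : ℕ) (i : Fin M) : List (ℕ × List (ℕ ⊕ ℕ)) :=
  A.output i ((run A I T).mem i) ((run A I T).inbox i)

/-- On the graph `G` and the input representation `I`, the algorithm violates no memory or
bandwidth constraint during `T` rounds, every machine then outputs at most `S` words, and the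
non-empty labels output by the machines, together with the vertices they belong to, are exactly
those of some legal solution. -/
def Correct (A : MPCAlgorithm) (κ S T : ℕ) (P : UnlabeledGraphProblem) (I : Input k M G) :
    Prop :=
  (∀ t ≤ T, MemoryOK κ n S (run A I t)) ∧
  (∀ t < T, RoundOK A κ n S (run A I t)) ∧
  (∀ i, ((out A I T i).map fun q => 1 + q.2.length).sum ≤ S ∧
    ∀ q ∈ out A I T i, IsWord κ n q.1 ∧ ∀ x ∈ q.2, IsWord κ n (tokenValue x)) ∧
  ∃ s : Solution n, P.IsLegal G s ∧
    {q | (∃ i, q ∈ out A I T i) ∧ q.2 ≠ []} =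
      {q | ∃ v, q = ((I.ident v : ℕ), encode I.ident (s v)) ∧ s v ≠ []}

end MPC

/-- `P` is solved in `T n` rounds in the model `MPC(M, S)`, with identifiers below `(n + 1) ^ k`
and words below `(n + 1) ^ κ`: for every `n` there is a program that is correct on all
`n`-vertex instances and all their input representations. -/
def MPCSolvable (k κ : ℕ) (M S : ℕ → ℕ) (P : UnlabeledGraphProblem) (T : ℕ → ℕ) : Prop :=
  ∀ n : ℕ, ∃ A : MPCAlgorithm, ∀ G : SimpleGraph (Fin n), P.IsInstance G →
    ∀ I : MPC.Input k (M n) G, I.Fits (S n) → MPC.Correct A κ (S n) (T n) P I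

end CliqueSim

end

/-! The vertex with the `j`-th smallest identifier is hosted by machine `j`, counting from 0. The
given algorithm is run on the canonical input representation, in which this vertex has identifier
`j` and its ports list the neighbours in increasing order. Up to a renaming of vertices this is an
input representation of the given graph (`NCCStar.exists_similar`). Legality depends only on the
graph, so the run produces a legal solution as soon as ranks are translated back to identifiers
(`NCCStar.Correct.goodRun`).

The graph is kept as one sorted array of all adjacency lists, with two markers per list, cut into
chunks of `4a` consecutive entries. This fits because a graph of arboricity at most `a` has at most
`an` edges. The neighbour behind port `p` of `j` is the entry at a position that machine `j` can
compute, so one question and one answer find it. Conversely, the value of the lookup function at `x`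
is read off the position of an entry, which is found by an `F`-ary search (`reach_ports`). A chunk
meets at most `4a` lists and a vertex starts at most `3C` searches, so no machine serves more than
`12aC` searches at a time. Messages to known identifiers go straight to the machine of that number.

Let `F` be about the square root of `S/2`, and let `D` be the logarithm of `n + 1` to base `F`,
rounded up. Prefix sums of `F` counters take `D` rounds (`reach_scan`), radix sort takes `O(D²)`
rounds (`reach_sort`), and so does answering dictionary queries by sorting (`reach_lookup`). Hence
the array is built in `O(D²)` rounds, and each round is simulated in `2D + 5` rounds (`reach_next`).
The bound `S ≥ n^δ` gives `D = O(1/δ)`. In the first claim `S` also exceeds a large multiple of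
`β²`, which gives `D = O(log_β n)`.

The number `T` of rounds is not bounded in terms of `n`, so a machine cannot store a round counter.
The simulation is therefore a loop whose clock counts only within one iteration
(`exists_mpc_of_reach`). No machine knows which iteration is the last, so each block of `D`
simulated rounds ends with the translation of the current labels. This costs `O(D²)`, that is,
`O(D)` per simulated round.

Local computation is unrestricted and there is one program for each `n`, so algorithms are handled
through what the machines know. `Det` says that some local data determines other data uniformly over
all instances, `Stored` counts the possible values, and `Reach` chains communication rounds.
Networks of bounded size are treated separately: with a large word constant the entire input fits
into one word and is spread by doubling distances (`reach_gossip`). -/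

noncomputable section

namespace CliqueSim

open Finset

/-! ## Sets of bounded size -/

/-- The set `A` has at most `m` elements. -/
def Small {α : Type} (A : Set α) (m : ℕ) : Prop := A.encard ≤ m

namespace Small

variable {α β : Type} {A B : Set α} {m m' : ℕ}

theorem mono (h : Small A m) (hB : B ⊆ A) (hm : m ≤ m') : Small B m' :=
  (Set.encard_le_encard hB).trans (h.trans (by exact_mod_cast hm))

theorem image (h : Small A m) (f : α → β) : Small (f '' A) m := (Set.encard_image_le f A).trans h

theorem prod {C : Set β} (h : Small A m) (hC : Small C m') : Small (A ×ˢ C) (m * m') := by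
  unfold Small at *
  rw [Set.encard_prod, Nat.cast_mul]
  exact mul_le_mul' h hC

/-- Memory contents and messages only have to be counted: any choice of numbers for the elements can
be built into the program. -/
theorem code (h : Small A m) : ∃ f : α → ℕ, Set.InjOn f A ∧ ∀ a ∈ A, f a < m := by
  classical
  have hfin : A.Finite := Set.finite_of_encard_le_coe h
  have hcard : hfin.toFinset.card ≤ m := by
    have := h
    rw [Small, hfin.encard_eq_coe_toFinset_card] at this
    exact_mod_cast this
  let g := hfin.toFinset.equivFin
  refine ⟨fun a => if ha : a ∈ hfin.toFinset then g ⟨a, ha⟩ else 0, ?_, ?_⟩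
  · intro a ha b hb hab
    have ha' := hfin.mem_toFinset.2 ha
    have hb' := hfin.mem_toFinset.2 hb
    simp only [ha', hb', dif_pos] at hab
    simpa using g.injective (Fin.ext hab)
  · intro a ha
    simp only [hfin.mem_toFinset.2 ha, dif_pos]
    exact (g _).2.trans_le hcard

theorem of_code (f : α → ℕ) (hf : Set.InjOn f A) (hm : ∀ a ∈ A, f a < m) : Small A m := by
  have h : A.encard ≤ (Set.Iio m).encard := Set.encard_le_encard_of_injOn (fun a ha => hm a ha) hf
  refine h.trans ?_
  rw [← Finset.coe_Iio, Set.encard_coe_eq_coe_finsetCard]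
  simp

theorem range_lt (A : Set ℕ) (h : ∀ a ∈ A, a < m) : Small A m :=
  of_code id (Set.injOn_id A) h

/-- Induction on head and tail; the `+ 1` in the base pays for the lists that are shorter than `L`.
-/
theorem list (h : Small A m) (L : ℕ) :
    Small {l : List α | l.length ≤ L ∧ ∀ x ∈ l, x ∈ A} ((m + 1) ^ L) := by
  induction L with
  | zero =>
    refine Small.of_code (fun _ => 0) ?_ (by simp)
    intro a ha b hb _
    simp only [Nat.le_zero, List.length_eq_zero_iff, Set.mem_ofPred_eq] at ha hb
    rw [ha.1, hb.1]
  | succ L ih =>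
    have hsub : {l : List α | l.length ≤ L + 1 ∧ ∀ x ∈ l, x ∈ A} ⊆
        {[]} ∪ (fun p : α × List α => p.1 :: p.2) ''
          (A ×ˢ {l : List α | l.length ≤ L ∧ ∀ x ∈ l, x ∈ A}) := by
      intro l hl
      rcases l with _ | ⟨x, l⟩
      · simp
      · right
        refine ⟨(x, l), ?_, rfl⟩
        simp only [List.length_cons, List.mem_cons, forall_eq_or_imp, Set.mem_ofPred_eq] at hl
        exact ⟨hl.2.1, by simpa using hl.1, hl.2.2⟩
    have h2 := (h.prod ih).image (fun p : α × List α => p.1 :: p.2)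
    refine (Set.encard_le_encard hsub).trans ((Set.encard_union_le _ _).trans ?_)
    rw [Set.encard_singleton]
    refine (add_le_add_right h2 1).trans ?_
    have : 1 + m * (m + 1) ^ L ≤ (m + 1) ^ (L + 1) := by
      have := Nat.one_le_pow L (m + 1) (by omega)
      rw [pow_succ]; nlinarith
    exact_mod_cast this

theorem finset (h : Small A m) (L : ℕ) :
    Small {s : Finset α | s.card ≤ L ∧ ∀ x ∈ s, x ∈ A} ((m + 1) ^ L) := by
  classical
  refine ((h.list L).image List.toFinset).mono ?_ le_rfl
  intro s hs
  exact ⟨s.toList, ⟨by simpa using hs.1, by simpa using hs.2⟩, by simp⟩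

theorem funs (h : Small A m) (L : ℕ) :
    Small {f : Fin L → α | ∀ x, f x ∈ A} ((m + 1) ^ L) := by
  obtain ⟨g, hg, hlt⟩ := (h.list L).code
  refine Small.of_code (fun f => g (List.ofFn f)) ?_ ?_
  · intro f hf f' hf' hff
    refine List.ofFn_injective (hg ?_ ?_ hff)
    · simpa [List.mem_ofFn] using hf
    · simpa [List.mem_ofFn] using hf'
  · intro f hf
    exact hlt _ (by simpa [List.mem_ofFn] using hf)

end Small

theorem List.map_injOn {α β : Type} {g : α → β} {A : Set α} (hg : Set.InjOn g A) :
    ∀ {l l' : List α}, (∀ x ∈ l, x ∈ A) → (∀ x ∈ l', x ∈ A) → l.map g = l'.map g → l = l' := by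
  intro l
  induction l with
  | nil => intro l' _ _ h; simpa using h.symm
  | cons x l ih =>
    rintro (_ | ⟨y, l'⟩) h1 h2 h
    · simp at h
    · simp only [List.map_cons, List.cons.injEq] at h
      rw [hg (h1 x (by simp)) (h2 y (by simp)) h.1,
        ih (fun z hz => h1 z (by simp [hz])) (fun z hz => h2 z (by simp [hz])) h.2]

/-! ## Local data and knowledge -/

variable {E : Type} {n : ℕ} {α β γ : Type}

/-- The local data `Y` of every machine is determined by its local data `X`. -/
def Det (X : E → Fin n → α) (Y : E → Fin n → β) : Prop :=
  ∀ i e e', X e i = X e' i → Y e i = Y e' i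

theorem Det.refl (X : E → Fin n → α) : Det X X := fun _ _ _ h => h

theorem Det.trans {X : E → Fin n → α} {Y : E → Fin n → β} {Z : E → Fin n → γ}
    (h : Det X Y) (h' : Det Y Z) : Det X Z := fun i e e' hx => h' i e e' (h i e e' hx)

/-- At every machine the local data takes at most `(n + 1) ^ b` values. -/
def Stored (b : ℕ) (X : E → Fin n → α) : Prop :=
  ∀ i, Small (Set.range fun e => X e i) ((n + 1) ^ b)

theorem Stored.mono {b b' : ℕ} {X : E → Fin n → α} (h : Stored b X) (hb : b ≤ b') :
    Stored b' X :=
  fun i => (h i).mono subset_rfl (Nat.pow_le_pow_right (by omega) hb)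

theorem Stored.prod {b b' : ℕ} {X : E → Fin n → α} {Y : E → Fin n → β} (h : Stored b X)
    (h' : Stored b' Y) : Stored (b + b') fun e i => (X e i, Y e i) := by
  intro i
  rw [pow_add]
  refine ((h i).prod (h' i)).mono ?_ le_rfl
  rintro _ ⟨e, rfl⟩
  exact ⟨⟨e, rfl⟩, ⟨e, rfl⟩⟩

/-- Choosing one preimage for every value of `Y` embeds these values into those of `X`. So data that
is computed locally never needs a memory bound of its own. -/
theorem Stored.det {b : ℕ} {X : E → Fin n → α} {Y : E → Fin n → β} (h : Stored b X)
    (hd : Det X Y) : Stored b Y := by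
  intro i
  obtain ⟨f, hf, hlt⟩ := (h i).code
  classical
  refine Small.of_code
    (fun y => if hy : ∃ e, Y e i = y then f (X hy.choose i) else 0) ?_ ?_
  · rintro _ ⟨e, rfl⟩ _ ⟨e', rfl⟩ hee
    have h1 : ∃ e₁, Y e₁ i = Y e i := ⟨e, rfl⟩
    have h2 : ∃ e₁, Y e₁ i = Y e' i := ⟨e', rfl⟩
    simp only [h1, h2, dif_pos] at hee
    have := hd i _ _ (hf ⟨_, rfl⟩ ⟨_, rfl⟩ hee)
    rwa [h1.choose_spec, h2.choose_spec] at this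
  · rintro _ ⟨e, rfl⟩
    have h1 : ∃ e₁, Y e₁ i = Y e i := ⟨e, rfl⟩
    simp only [h1, dif_pos]
    exact hlt _ ⟨_, rfl⟩

theorem succ_pow_le (n u : ℕ) (hn : 0 < n) : (n + 1) ^ u + 1 ≤ (n + 1) ^ (u + 1) := by
  have := Nat.one_le_pow u (n + 1) (by omega)
  rw [pow_succ]; nlinarith

/-- The bounds for lists, finite sets and functions have base `m + 1` instead of `m`; one more unit
in the exponent absorbs this when the base is a power of `n + 1`. -/
theorem Small.le_pow {A : Set α} {m u L : ℕ} (h : Small A ((m + 1) ^ L)) (hn : 0 < n)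
    (hm : m ≤ (n + 1) ^ u) : Small A ((n + 1) ^ ((u + 1) * L)) := by
  refine h.mono subset_rfl ?_
  rw [pow_mul]
  exact Nat.pow_le_pow_left ((Nat.add_le_add_right hm 1).trans (succ_pow_le n u hn)) L

theorem Stored.finset {X : E → Fin n → Finset α} {U : Set α} {u L : ℕ}
    (hU : Small U ((n + 1) ^ u)) (hL : ∀ e i, (X e i).card ≤ L) (hX : ∀ e i, ∀ x ∈ X e i, x ∈ U) :
    Stored ((u + 1) * L) X := by
  intro i
  refine ((hU.finset L).le_pow i.pos le_rfl).mono ?_ le_rfl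
  rintro _ ⟨e, rfl⟩
  exact ⟨hL e i, hX e i⟩

theorem Stored.list {X : E → Fin n → List α} {U : Set α} {u L : ℕ}
    (hU : Small U ((n + 1) ^ u)) (hL : ∀ e i, (X e i).length ≤ L)
    (hX : ∀ e i, ∀ x ∈ X e i, x ∈ U) : Stored ((u + 1) * L) X := by
  intro i
  refine ((hU.list L).le_pow i.pos le_rfl).mono ?_ le_rfl
  rintro _ ⟨e, rfl⟩
  exact ⟨hL e i, hX e i⟩

theorem Stored.funs {L : ℕ} {X : E → Fin n → Fin L → α} {U : Set α} {u : ℕ}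
    (hU : Small U ((n + 1) ^ u)) (hX : ∀ e i x, X e i x ∈ U) : Stored ((u + 1) * L) X := by
  intro i
  refine ((hU.funs L).le_pow i.pos le_rfl).mono ?_ le_rfl
  rintro _ ⟨e, rfl⟩
  exact hX e i

theorem Stored.nat {X : E → Fin n → ℕ} {u : ℕ} (hX : ∀ e i, X e i < (n + 1) ^ u) :
    Stored u X := by
  intro i
  refine Small.range_lt _ ?_
  rintro _ ⟨e, rfl⟩
  exact hX e i

/-- A round of communication: machine `j` sends to machine `i` the list `M e j i`, each entry of
which takes a word, and at most `S` words are sent and received by each machine. -/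
structure Exchange (w S : ℕ) (X : E → Fin n → α) {μ : Type}
    (M : E → Fin n → Fin n → List μ) : Prop where
  small : Small {m | ∃ e j i, m ∈ M e j i} ((n + 1) ^ w)
  det : Det X M
  send : ∀ e j, ∑ i, (M e j i).length ≤ S
  recv : ∀ e i, ∑ j, (M e j i).length ≤ S

/-- From the local data `X`, the machines can compute the local data `Y` in `L` rounds, with
words below `(n + 1) ^ w`, with at most `S` words sent and received per round, and with at most
`(n + 1) ^ b` states of each machine at each time. -/
inductive Reach (w S b : ℕ) (X : E → Fin n → α) : ℕ → {β : Type} → (E → Fin n → β) → Prop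
  | loc {β : Type} {Y : E → Fin n → β} (hd : Det X Y) (hs : Stored b Y) : Reach w S b X 0 Y
  | round {β γ μ : Type} {L : ℕ} {Y : E → Fin n → β} {Z : E → Fin n → γ}
      {M : E → Fin n → Fin n → List μ} (h : Reach w S b X L Y) (hM : Exchange w S Y M)
      (hd : Det (fun e i => (Y e i, fun j => M e j i)) Z) (hs : Stored b Z) :
      Reach w S b X (L + 1) Z

namespace Reach

variable {w S b L : ℕ} {X : E → Fin n → α} {Y : E → Fin n → β} {Z : E → Fin n → γ}

theorem stored (h : Reach w S b X L Y) : Stored b Y := by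
  cases h with
  | loc _ hs => exact hs
  | round _ _ _ hs => exact hs

theorem mono {w' S' b' : ℕ} (h : Reach w S b X L Y) (hw : w ≤ w') (hS : S ≤ S') (hb : b ≤ b') :
    Reach w' S' b' X L Y := by
  induction h with
  | loc hd hs => exact .loc hd (hs.mono hb)
  | round h hM hd hs ih =>
    exact .round ih ⟨hM.small.mono subset_rfl (Nat.pow_le_pow_right (by omega) hw), hM.det,
      fun e j => (hM.send e j).trans hS, fun e j => (hM.recv e j).trans hS⟩ hd (hs.mono hb)

theorem det_right (h : Reach w S b X L Y) (hd : Det Y Z) : Reach w S b X L Z := by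
  cases h with
  | loc hd' hs => exact .loc (hd'.trans hd) (hs.det hd)
  | round h hM hd' hs => exact .round h hM (hd'.trans hd) (hs.det hd)

theorem trans {L' : ℕ} (h : Reach w S b X L Y) (h' : Reach w S b Y L' Z) :
    Reach w S b X (L + L') Z := by
  induction h' with
  | loc hd hs => exact h.det_right hd
  | round _ hM hd hs ih => exact .round ih hM hd hs

theorem det_left {α' : Type} {X' : E → Fin n → α'} (h : Reach w S b X L Y) (hd : Det X' X) :
    Reach w S b X' L Y := by
  induction h with
  | loc hd' hs => exact .loc (hd.trans hd') hs
  | round _ hM hd' hs ih => exact .round ih hM hd' hs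

/-- Data that the computation does not touch can be kept aside; it only adds to the memory. -/
theorem frame {δ : Type} {b' : ℕ} {R : E → Fin n → δ} (h : Reach w S b X L Y)
    (hR : Stored b' R) :
    Reach w S (b + b') (fun e i => (X e i, R e i)) L (fun e i => (Y e i, R e i)) := by
  induction h with
  | loc hd hs =>
    refine .loc (fun i e e' h => ?_) (hs.prod hR)
    rw [Prod.mk.injEq] at h ⊢
    exact ⟨hd i e e' h.1, h.2⟩
  | round _ hM hd hs ih =>
    refine .round ih ⟨hM.small, fun i e e' h => ?_, hM.send, hM.recv⟩ (fun i e e' h => ?_)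
      (hs.prod hR)
    · exact hM.det i e e' (Prod.mk.inj h).1
    · simp only [Prod.mk.injEq] at h ⊢
      exact ⟨hd i e e' (Prod.ext h.1.1 h.2), h.1.2⟩

/-- Every machine sends each of its items to a destination of its choice. -/
theorem move {μ : Type} (h : Reach w S b X L Y) (items : E → Finset μ) (src dst : E → μ → ℕ)
    (hsmall : Small {y | ∃ e, y ∈ items e} ((n + 1) ^ w))
    (hdet : ∀ (j : Fin n) e e', Y e j = Y e' j → ∀ y ∈ items e, src e y = j →
      y ∈ items e' ∧ src e' y = j ∧ dst e' y = dst e y)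
    (hsrc : ∀ e, ∀ y ∈ items e, src e y < n)
    (hsend : ∀ e (j : Fin n), ((items e).filter fun y => src e y = j).card ≤ S)
    (hrecv : ∀ e (j : Fin n), ((items e).filter fun y => dst e y = j).card ≤ S)
    (hZ : Det (fun e i => (Y e i, (items e).filter fun y => dst e y = i)) Z) (hs : Stored b Z) :
    Reach w S b X (L + 1) Z := by
  -- The items of one sender split according to their destinations, and those of one receiver
  -- according to their sources, so the sums over pairs are bounded by the loads of single machines.
  have hsum : ∀ (s : Finset μ) (p : μ → Prop) [DecidablePred p] (f : μ → ℕ),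
      ∑ i : Fin n, (s.filter fun y => p y ∧ f y = i).card ≤ (s.filter p).card := by
    intro s p _ f
    classical
    rw [← Finset.card_biUnion]
    · refine Finset.card_le_card fun y hy => ?_
      simp only [Finset.mem_biUnion, Finset.mem_filter] at hy ⊢
      obtain ⟨i, -, h1, h2, -⟩ := hy
      exact ⟨h1, h2⟩
    · intro i _ j _ hij
      rw [Function.onFun, Finset.disjoint_left]
      intro y hy hy'
      simp only [Finset.mem_filter] at hy hy'
      exact hij (Fin.ext (hy.2.2.symm.trans hy'.2.2))
  refine .round (M := fun e j i => ((items e).filter fun y => src e y = j ∧ dst e y = i).toList)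
    h ⟨hsmall.mono ?_ le_rfl, ?_, ?_, ?_⟩ ?_ hs
  · rintro m ⟨e, j, i, hm⟩
    rw [Finset.mem_toList, Finset.mem_filter] at hm
    exact ⟨e, hm.1⟩
  · intro j e e' hY
    funext i
    refine congrArg Finset.toList (Finset.ext fun y => ?_)
    simp only [Finset.mem_filter]
    constructor
    · rintro ⟨h1, h2, h3⟩
      obtain ⟨h4, h5, h6⟩ := hdet j e e' hY y h1 h2
      exact ⟨h4, h5, h6.trans h3⟩
    · rintro ⟨h1, h2, h3⟩
      obtain ⟨h4, h5, h6⟩ := hdet j e' e hY.symm y h1 h2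
      exact ⟨h4, h5, h6.trans h3⟩
  · intro e j
    simp only [Finset.length_toList]
    exact (hsum _ _ _).trans (hsend e j)
  · intro e i
    simp only [Finset.length_toList]
    have := hsum (items e) (fun y => dst e y = i) (src e)
    simp only [and_comm (a := dst e _ = i)] at this
    exact this.trans (hrecv e i)
  · intro i e e' hY
    apply hZ
    simp only [Prod.mk.injEq] at hY ⊢
    refine ⟨hY.1, ?_⟩
    ext y
    -- The received lists are indexed by the sender. Since every item has a source among the
    -- machines, the union of these lists is the whole set of items with destination `i`.
    have key : ∀ j : Fin n, _ := fun j => congrArg (fun l => y ∈ l) (congrFun hY.2 j)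
    simp only [Finset.mem_toList, Finset.mem_filter, eq_iff_iff] at key ⊢
    constructor
    · intro h
      have := (key ⟨src e y, hsrc e y h.1⟩).1 ⟨h.1, rfl, h.2⟩
      exact ⟨this.1, this.2.2⟩
    · intro h
      have := (key ⟨src e' y, hsrc e' y h.1⟩).2 ⟨h.1, rfl, h.2⟩
      exact ⟨this.1, this.2.2⟩

/-- Iteration of a computation that works uniformly in a time parameter. -/
theorem iterate {Y : ℕ → E → Fin n → β} (q : ℕ) (hs : Stored b (Y 0))
    (h : ∀ c < q, Reach w S b (Y c) L (Y (c + 1))) : Reach w S b (Y 0) (q * L) (Y q) := by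
  induction q with
  | zero => rw [zero_mul]; exact .loc (Det.refl _) hs
  | succ q ih =>
    rw [add_mul, one_mul]
    exact (ih fun c hc => h c (by omega)).trans (h q (by omega))

/-- The states of the machines and the messages, written as numbers. -/
theorem trace (h : Reach w S b X L Y) :
    ∃ (Z : ℕ → E → Fin n → ℕ) (M : ℕ → E → Fin n → Fin n → List ℕ),
      Det X (Z 0) ∧ Det (Z L) Y ∧ (∀ t ≤ L, ∀ e i, Z t e i < (n + 1) ^ b) ∧
      ∀ t < L, (∀ e j i, ∀ x ∈ M t e j i, x < (n + 1) ^ w) ∧ Det (Z t) (M t) ∧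
        (∀ e j, ∑ i, (M t e j i).length ≤ S) ∧ (∀ e i, ∑ j, (M t e j i).length ≤ S) ∧
        Det (fun e i => (Z t e i, fun j => M t e j i)) (Z (t + 1)) := by
  induction h with
  | loc hd hs =>
    choose f hf hlt using fun i => (hs i).code
    rename_i Y
    refine ⟨fun _ e i => f i (Y e i), fun _ _ _ _ => [], ?_, ?_, ?_, ?_⟩
    · intro i e e' h
      simp only [hd i e e' h]
    · intro i e e' h
      exact hf i ⟨e, rfl⟩ ⟨e', rfl⟩ h
    · intro t _ e i
      exact hlt i _ ⟨e, rfl⟩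
    · simp
  | round _ hM hd hs ih =>
    rename_i L Y Z M' _
    obtain ⟨Zs, Ms, h0, hL, hlt, hst⟩ := ih
    choose f hf hflt using fun i => (hs i).code
    obtain ⟨g, hg, hglt⟩ := hM.small.code
    refine ⟨fun t e i => if t ≤ L then Zs t e i else f i (Z e i),
      fun t e j i => if t < L then Ms t e j i else (M' e j i).map g, ?_, ?_, ?_, ?_⟩
    · simpa using h0
    · intro i e e' h
      simp only [Nat.not_succ_le_self, if_false] at h
      exact hf i ⟨e, rfl⟩ ⟨e', rfl⟩ h
    · intro t ht e i
      by_cases htL : t ≤ L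
      · simpa [htL] using hlt t htL e i
      · simpa [htL] using hflt i _ ⟨e, rfl⟩
    · intro t ht
      by_cases htL : t < L
      · have h1 : t ≤ L := by omega
        have h2 : t + 1 ≤ L := by omega
        simpa only [htL, h1, h2, if_true] using hst t htL
      · obtain rfl : t = L := by omega
        simp only [lt_irrefl, if_false, le_refl, if_true, List.length_map, Nat.not_succ_le_self,
          List.mem_map]
        refine ⟨?_, ?_, hM.send, hM.recv, ?_⟩
        · rintro e j i _ ⟨m, hm, rfl⟩
          exact hglt _ ⟨e, j, i, hm⟩
        · intro j e e' h
          funext i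
          exact congrArg (fun m => (m i).map g) (hM.det j e e' (hL j e e' h))
        · intro i e e' h
          simp only [Prod.mk.injEq] at h
          -- The coding `g` is injective on messages that occur, so equal coded messages come from
          -- equal messages.
          have : Z e i = Z e' i := by
            apply hd
            simp only [Prod.mk.injEq]
            refine ⟨hL i e e' h.1, ?_⟩
            funext j
            have hj := congrFun h.2 j
            exact List.map_injOn hg (fun x hx => ⟨e, j, i, hx⟩) (fun x hx => ⟨e', j, i, hx⟩) hj
          simp only [this]

end Reach


/-! ## From computations to algorithms -/

/-- The digits of a number in base `W`, written as a list of length `S`. -/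
def packed (W S z : ℕ) : List ℕ :=
  if h : z < W ^ S then List.ofFn fun j => (finFunctionFinEquiv.symm ⟨z, h⟩ j : ℕ) else []

theorem packed_inj {W S z z' : ℕ} (h : z < W ^ S) (h' : z' < W ^ S)
    (hz : packed W S z = packed W S z') : z = z' := by
  simp only [packed, h, h', dif_pos] at hz
  have h1 := List.ofFn_injective hz
  have h2 : finFunctionFinEquiv.symm ⟨z, h⟩ = finFunctionFinEquiv.symm ⟨z', h'⟩ := by
    funext j
    exact Fin.ext (congrFun h1 j)
  simpa using finFunctionFinEquiv.symm.injective h2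

theorem length_packed_le (W S z : ℕ) : (packed W S z).length ≤ S := by
  unfold packed
  split_ifs <;> simp

theorem packed_lt {W S z x : ℕ} (hx : x ∈ packed W S z) : x < W := by
  unfold packed at hx
  split_ifs at hx
  · rw [List.mem_ofFn] at hx
    obtain ⟨j, rfl⟩ := hx
    exact (finFunctionFinEquiv.symm _ j).2
  · simp at hx

/-- The inbox of a machine that receives the list `f j` from machine `j`. -/
def boxOf {n : ℕ} (f : Fin n → List ℕ) : Inbox :=
  ∑ j, if f j = [] then 0 else {((j : ℕ), f j)}

/-- The messages of a machine that sends the list `f i` to machine `i`. -/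
def outsOf {n : ℕ} (f : Fin n → List ℕ) : List (ℕ × List ℕ) :=
  ((List.finRange n).filter fun i => f i ≠ []).map fun i : Fin n => ((i : ℕ), f i)

theorem mem_boxOf {n : ℕ} {f : Fin n → List ℕ} {p : ℕ × List ℕ} :
    p ∈ boxOf f ↔ ∃ j, f j ≠ [] ∧ p = ((j : ℕ), f j) := by
  unfold boxOf
  rw [Multiset.mem_sum]
  constructor
  · rintro ⟨j, -, hj⟩
    by_cases h : f j = []
    · simp [h] at hj
    · exact ⟨j, h, by simpa [h] using hj⟩
  · rintro ⟨j, h, rfl⟩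
    exact ⟨j, mem_univ _, by simp [h]⟩

/-- An inbox has no order, but it shows the senders, and each machine sends at most one list to each
machine. An absent sender stands for the empty list. -/
theorem boxOf_injective {n : ℕ} {f f' : Fin n → List ℕ} (h : boxOf f = boxOf f') : f = f' := by
  have key : ∀ f f' : Fin n → List ℕ, boxOf f = boxOf f' → ∀ j, f j ≠ [] → f j = f' j := by
    intro f f' h j hj
    have : ((j : ℕ), f j) ∈ boxOf f' := h ▸ mem_boxOf.2 ⟨j, hj, rfl⟩
    obtain ⟨j', h1, h2⟩ := mem_boxOf.1 this
    rw [Prod.mk.injEq] at h2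
    obtain rfl := Fin.ext h2.1
    exact h2.2
  funext j
  by_cases hj : f j = []
  · by_cases hj' : f' j = []
    · rw [hj, hj']
    · exact (key f' f h.symm j hj').symm
  · exact key f f' h j hj

theorem words_boxOf {n : ℕ} (f : Fin n → List ℕ) : (boxOf f).words = ∑ j, (f j).length := by
  unfold Inbox.words boxOf
  induction (univ : Finset (Fin n)) using Finset.induction_on with
  | empty => simp
  | insert a s ha ih =>
    rw [sum_insert ha, sum_insert ha, Multiset.map_add, Multiset.sum_add, ih]
    by_cases h : f a = [] <;> simp [h]

theorem sum_length_outsOf {n : ℕ} (f : Fin n → List ℕ) :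
    ((outsOf f).map fun m => m.2.length).sum = ∑ j, (f j).length := by
  unfold outsOf
  rw [List.map_map, ← List.sum_ofFn, List.ofFn_eq_map]
  induction List.finRange n with
  | nil => simp
  | cons a l ih =>
    by_cases h : f a = []
    · simpa [h, List.filter_cons] using ih
    · simpa [h, List.filter_cons] using ih

theorem delivered_outsOf {n : ℕ} (f : Fin n → List ℕ) (i j : Fin n) :
    (((((outsOf f).filter fun m => m.1 = (i : ℕ)).map fun m => ((j : ℕ), m.2) :
      List (ℕ × List ℕ))) : Inbox) = if f i = [] then 0 else {((j : ℕ), f i)} := by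
  have h1 : (outsOf f).filter (fun m => m.1 = (i : ℕ)) =
      if f i = [] then [] else [((i : ℕ), f i)] := by
    unfold outsOf
    rw [List.filter_map, List.filter_filter]
    have : (fun a : Fin n => ((fun m : ℕ × List ℕ => decide (m.1 = (i : ℕ))) ∘
        fun i : Fin n => ((i : ℕ), f i)) a && decide (f a ≠ [])) =
        fun a => decide (f i ≠ []) && (a == i) := by
      funext a
      by_cases h : a = i
      · subst h; simp
      · have : (a : ℕ) ≠ i := fun h' => h (Fin.ext h')
        simp [h, this]
    rw [this]
    simp only [← List.filter_filter]
    rw [List.filter_beq,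
      List.count_eq_one_of_mem (List.nodup_finRange n) (List.mem_finRange i)]
    by_cases h : f i = [] <;> simp [h]
  rw [h1]
  split_ifs <;> simp

section Raw

variable {k κ n S R b T : ℕ} {P : UnlabeledGraphProblem}

/-- The instances of a problem together with their placements on the machines. -/
abbrev Instance (k n S : ℕ) (P : UnlabeledGraphProblem) : Type :=
  {p : Σ G : SimpleGraph (Fin n), MPC.Input k n G // P.IsInstance p.1 ∧ p.2.Fits S}

/-- The vertices and edges that are initially placed on the machines. -/
def placed (e : Instance k n S P) (i : Fin n) : Finset ℕ × Finset (Sym2 ℕ) :=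
  (e.1.2.vertices i, e.1.2.edges i)

/-- Acceptable outputs on an instance. -/
structure OutputOK (κ : ℕ) (e : Instance k n S P) (O : Fin n → List (ℕ × List (ℕ ⊕ ℕ))) :
    Prop where
  size : ∀ i, ((O i).map fun q => 1 + q.2.length).sum ≤ S
  word : ∀ i, ∀ q ∈ O i, IsWord κ n q.1 ∧ ∀ x ∈ q.2, IsWord κ n (tokenValue x)
  legal : ∃ s : Solution n, P.IsLegal e.1.1 s ∧
    {q | (∃ i, q ∈ O i) ∧ q.2 ≠ []} =
      {q | ∃ v, q = ((e.1.2.ident v : ℕ), encode e.1.2.ident (s v)) ∧ s v ≠ []}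

/-- A program sees its memory and its inbox but not the number of the round. The memory therefore
carries a clock `τ`: rounds with the same clock value must follow the same rules, and the clock must
determine its own next value. Only the bound `T` on the clock, not the number `R` of rounds, enters
the memory bound.

The stored state lags behind by one round, because messages of round `t` are still in the inbox when
round `t + 1` begins. Clock values are shifted by one so that 0 marks the initial memory, before
anything has been sent. -/
theorem exists_mpc_of_run (τ : ℕ → ℕ) (hτ : ∀ t < R, τ t < T)
    (hτs : ∀ t < R, ∀ t' < R, τ t = τ t' → τ (t + 1) = τ (t' + 1))
    (Y : ℕ → Instance k n S P → Fin n → ℕ) (M : ℕ → Instance k n S P → Fin n → Fin n → List ℕ)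
    (hY : ∀ t ≤ R, ∀ e i, Y t e i < (n + 1) ^ b)
    (hb : (T + 1) * (n + 1) ^ b ≤ ((n + 1) ^ κ) ^ S)
    (hinit : Det placed (Y 0))
    (hM : ∀ t < R, ∀ e j i, ∀ x ∈ M t e j i, x < (n + 1) ^ κ)
    (hdM : ∀ t < R, ∀ t' < R, τ t = τ t' → ∀ e e' j, Y t e j = Y t' e' j → M t e j = M t' e' j)
    (hdY : ∀ t < R, ∀ t' < R, τ t = τ t' → ∀ e e' i, Y t e i = Y t' e' i →
      (∀ j, M t e j i = M t' e' j i) → Y (t + 1) e i = Y (t' + 1) e' i)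
    (hsend : ∀ t < R, ∀ e j, ∑ i, (M t e j i).length ≤ S)
    (hrecv : ∀ t < R, ∀ e i, ∑ j, (M t e j i).length ≤ S)
    (O : Instance k n S P → Fin n → List (ℕ × List (ℕ ⊕ ℕ))) (hdO : Det (Y R) O)
    (hO : ∀ e, OutputOK κ e (O e)) :
    ∃ A : MPCAlgorithm, ∀ G : SimpleGraph (Fin n), P.IsInstance G →
      ∀ I : MPC.Input k n G, I.Fits S → MPC.Correct A κ S R P I := by
  classical
  -- The state and the pending messages before the computation of round `t`.
  let Z : ℕ → Instance k n S P → Fin n → ℕ := fun t e i =>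
    match t with
    | 0 => (T + 1) * Y 0 e i
    | t + 1 => (T + 1) * Y t e i + (τ t + 1)
  let N : ℕ → Instance k n S P → Fin n → Fin n → List ℕ := fun t e j i =>
    match t with
    | 0 => []
    | t + 1 => M t e j i
  have hsplit : ∀ y y' r r' : ℕ, r < T + 1 → r' < T + 1 →
      (T + 1) * y + r = (T + 1) * y' + r' → y = y' ∧ r = r' := by
    intro y y' r r' hr hr' h
    have h1 := congrArg (· / (T + 1)) h
    have h2 := congrArg (· % (T + 1)) h
    simp only [Nat.mul_add_div (Nat.succ_pos T), Nat.div_eq_of_lt hr, Nat.div_eq_of_lt hr',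
      Nat.mul_add_mod, Nat.mod_eq_of_lt hr, Nat.mod_eq_of_lt hr'] at h1 h2
    exact ⟨by omega, h2⟩
  have hZ : ∀ t ≤ R, ∀ e i, Z t e i < ((n + 1) ^ κ) ^ S := by
    have aux : ∀ y r, y < (n + 1) ^ b → r < T + 1 → (T + 1) * y + r < ((n + 1) ^ κ) ^ S := by
      intro y r hy hr
      refine lt_of_lt_of_le ?_ hb
      have : (T + 1) * (y + 1) ≤ (T + 1) * (n + 1) ^ b := Nat.mul_le_mul_left _ hy
      rw [mul_add] at this
      omega
    intro t ht e i
    rcases t with _ | t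
    · exact aux _ 0 (hY 0 ht e i) (by omega)
    · exact aux _ _ (hY t (by omega) e i) (by have := hτ t (by omega); omega)
  -- The state and the messages of a round determine the state.
  have hY1 : ∀ t ≤ R, ∀ t' ≤ R, ∀ e e' i, Z t e i = Z t' e' i →
      (∀ j, N t e j i = N t' e' j i) →
      Y t e i = Y t' e' i ∧ (t < R → t' < R → τ t = τ t') := by
    intro t ht t' ht' e e' i hz hn
    rcases t with _ | t <;> rcases t' with _ | t'
    · exact ⟨(hsplit _ _ 0 0 (by omega) (by omega) hz).1, fun _ _ => rfl⟩
    · have := (hsplit _ _ 0 _ (by omega) (by have := hτ t' (by omega); omega) hz).2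
      omega
    · have := (hsplit _ _ _ 0 (by have := hτ t (by omega); omega) (by omega) hz).2
      omega
    · obtain ⟨h1, h2⟩ := hsplit _ _ _ _ (by have := hτ t (by omega); omega)
        (by have := hτ t' (by omega); omega) hz
      have h3 : τ t = τ t' := by omega
      exact ⟨hdY t (by omega) t' (by omega) h3 e e' i h1 hn,
        fun _ _ => hτs t (by omega) t' (by omega) h3⟩
  let pk := packed ((n + 1) ^ κ) S
  -- On a memory and inbox that occur in some execution, the program continues a chosen execution of
  -- this kind. The determinacy hypotheses make the result independent of the choice. Everything
  -- else gets a default value that is never used.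
  let A : MPCAlgorithm :=
    { init := fun i V D =>
        if h : ∃ (i' : Fin n) (e : Instance k n S P), (i' : ℕ) = i ∧ placed e i' = (V, D) then
          pk (Z 0 h.choose_spec.choose h.choose) else []
      step := fun i m I =>
        if h : ∃ (i' : Fin n) (t : ℕ) (e : Instance k n S P), t < R ∧ (i' : ℕ) = i ∧
            m = pk (Z t e i') ∧ I = boxOf (fun j => N t e j i') then
          (pk (Z (h.choose_spec.choose + 1) h.choose_spec.choose_spec.choose h.choose),
            outsOf (N (h.choose_spec.choose + 1) h.choose_spec.choose_spec.choose h.choose))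
        else ([], [])
      output := fun i m I =>
        if h : ∃ (i' : Fin n) (e : Instance k n S P), (i' : ℕ) = i ∧
            m = pk (Z R e i') ∧ I = boxOf (fun j => N R e j i') then
          O h.choose_spec.choose h.choose else [] }
  have hstep : ∀ t < R, ∀ e (i : Fin n), A.step i (pk (Z t e i)) (boxOf fun j => N t e j i) =
      (pk (Z (t + 1) e i), outsOf (N (t + 1) e i)) := by
    intro t ht e i
    have h : ∃ (i' : Fin n) (t' : ℕ) (e' : Instance k n S P), t' < R ∧ (i' : ℕ) = i ∧
        pk (Z t e i) = pk (Z t' e' i') ∧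
        (boxOf fun j => N t e j i) = boxOf (fun j => N t' e' j i') := ⟨i, t, e, ht, rfl, rfl, rfl⟩
    simp only [A, h, dif_pos]
    obtain ⟨h1, h2, h3, h4⟩ := h.choose_spec.choose_spec.choose_spec
    generalize h.choose_spec.choose_spec.choose = e' at *
    generalize h.choose_spec.choose = t' at *
    generalize h.choose = i' at *
    obtain rfl := Fin.ext h2
    obtain ⟨h5, h6⟩ := hY1 t ht.le t' h1.le e e' i'
      (packed_inj (hZ t ht.le e i') (hZ t' h1.le e' i') h3) (congrFun (boxOf_injective h4))
    have h7 := h6 ht h1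
    have h8 : M t' e' i' = M t e i' := (hdM t ht t' h1 h7 e e' i' h5).symm
    change (pk ((T + 1) * Y t' e' i' + (τ t' + 1)), outsOf (M t' e' i')) =
      (pk ((T + 1) * Y t e i' + (τ t + 1)), outsOf (M t e i'))
    rw [h5, h7, h8]
  refine ⟨A, fun G hG I hI => ?_⟩
  let e : Instance k n S P := ⟨⟨G, I⟩, hG, hI⟩
  have hrun : ∀ t ≤ R, MPC.run A I t =
      ⟨fun i => pk (Z t e i), fun i => boxOf fun j => N t e j i⟩ := by
    intro t
    induction t with
    | zero =>
      intro _
      simp only [MPC.run, Function.iterate_zero, id, MPC.start, MPC.Config.mk.injEq]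
      constructor
      · funext i
        have h : ∃ (i' : Fin n) (e' : Instance k n S P), (i' : ℕ) = i ∧
            placed e' i' = (I.vertices i, I.edges i) := ⟨i, e, rfl, rfl⟩
        simp only [A, h, dif_pos]
        obtain ⟨h2, h3⟩ := h.choose_spec.choose_spec
        generalize h.choose_spec.choose = e' at *
        generalize h.choose = i' at *
        obtain rfl := Fin.ext h2
        have : Y 0 e' i' = Y 0 e i' := hinit i' e' e h3
        change pk ((T + 1) * Y 0 e' i') = pk ((T + 1) * Y 0 e i')
        rw [this]
      · funext i
        simp [boxOf, N]
    | succ t ih =>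
      intro ht
      rw [MPC.run, Function.iterate_succ_apply']
      change MPC.next A (MPC.run A I t) = _
      rw [ih (by omega)]
      simp only [MPC.next, MPC.delivered, MPC.act, MPC.Config.mk.injEq]
      simp only [hstep t (by omega), delivered_outsOf]
      exact ⟨trivial, rfl⟩
  have hact : ∀ t < R, ∀ i, MPC.act A (MPC.run A I t) i =
      (pk (Z (t + 1) e i), outsOf (N (t + 1) e i)) := by
    intro t ht i
    rw [hrun t ht.le, MPC.act]
    exact hstep t ht e i
  have hout : ∀ i, MPC.out A I R i = O e i := by
    intro i
    rw [MPC.out, hrun R le_rfl]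
    have h : ∃ (i' : Fin n) (e' : Instance k n S P), (i' : ℕ) = i ∧
        pk (Z R e i) = pk (Z R e' i') ∧
        (boxOf fun j => N R e j i) = boxOf (fun j => N R e' j i') := ⟨i, e, rfl, rfl, rfl⟩
    simp only [A, h, dif_pos]
    obtain ⟨h2, h3, h4⟩ := h.choose_spec.choose_spec
    generalize h.choose_spec.choose = e' at *
    generalize h.choose = i' at *
    obtain rfl := Fin.ext h2
    exact (hdO i' e e' (hY1 R le_rfl R le_rfl e e' i'
      (packed_inj (hZ R le_rfl e i') (hZ R le_rfl e' i') h3)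
      (congrFun (boxOf_injective h4))).1).symm
  refine ⟨?_, ?_, ?_, ?_⟩
  · intro t ht i
    rw [hrun t ht]
    exact ⟨length_packed_le _ _ _, fun x hx => packed_lt hx⟩
  · intro t ht i
    rw [hact t ht i]
    refine ⟨?_, ?_, ?_⟩
    · rw [sum_length_outsOf]
      exact hsend t ht e i
    · intro m hm
      simp only [outsOf, List.mem_map, List.mem_filter, List.mem_finRange, true_and] at hm
      obtain ⟨i', h1, rfl⟩ := hm
      exact ⟨by simpa using h1, fun x hx => hM t ht e i i' x hx, i'.2⟩
    · have : MPC.delivered A (MPC.run A I t) i = boxOf fun j => N (t + 1) e j i := by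
        simp only [MPC.delivered, hact t ht, delivered_outsOf]
        rfl
      rw [this, words_boxOf]
      exact hrecv t ht e i
  · intro i
    rw [hout]
    exact ⟨(hO e).size i, (hO e).word i⟩
  · obtain ⟨s, h1, h2⟩ := (hO e).legal
    refine ⟨s, h1, ?_⟩
    simp only [hout]
    exact h2

end Raw


/-! ### Repeated blocks with a bounded clock -/

section Loop

variable {k κ n S b : ℕ} {P : UnlabeledGraphProblem}

/-- After a preamble, the same block of `L₁` rounds is repeated `q` times, with a clock that counts
only to `L₀ + L₁`. The block is one computation on the index set of pairs of an instance and an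
iteration, so its rules do not depend on the iteration, and `q` does not enter the memory bound. -/
theorem exists_mpc_of_reach {γ : Type} {L₀ L₁ q w : ℕ} (Y : ℕ → Instance k n S P → Fin n → γ)
    (hpre : Reach w S b (placed (P := P)) L₀ (Y 0))
    (hloop : Reach w S b (fun (p : Instance k n S P × Fin q) => Y p.2 p.1) L₁
      fun p => Y (p.2 + 1) p.1)
    (hL₁ : 0 < L₁) (hw : w ≤ κ)
    (hb : (L₀ + L₁ + 1) * (n + 1) ^ (b + 1) ≤ ((n + 1) ^ κ) ^ S)
    (O : Instance k n S P → Fin n → List (ℕ × List (ℕ ⊕ ℕ))) (hdO : Det (Y q) O)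
    (hO : ∀ e, OutputOK κ e (O e)) :
    ∃ A : MPCAlgorithm, ∀ G : SimpleGraph (Fin n), P.IsInstance G →
      ∀ I : MPC.Input k n G, I.Fits S → MPC.Correct A κ S (L₀ + q * L₁) P I := by
  obtain ⟨Z₀, M₀, h0X, h0Y, h0lt, h0⟩ := hpre.trace
  obtain ⟨Z₁, M₁, h1X, h1Y, h1lt, h1⟩ := hloop.trace
  -- One coding serves the states between blocks in all iterations, so that the end of a block and
  -- the start of the next are the same number. These states come from the preamble or from the
  -- loop, hence the factor 2, which costs one unit in the exponent.
  have hcode : ∀ i, ∃ f : γ → ℕ, Set.InjOn f {y | ∃ c ≤ q, ∃ e, y = Y c e i} ∧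
      ∀ y ∈ {y | ∃ c ≤ q, ∃ e, y = Y c e i}, f y < (n + 1) ^ (b + 1) := by
    intro i
    refine Small.code ?_
    have h2 := (Set.encard_union_le _ _).trans (add_le_add (hpre.stored i) (hloop.stored i))
    refine Small.mono (m := 2 * (n + 1) ^ b) (by rw [two_mul]; exact_mod_cast h2) ?_ ?_
    · rintro y ⟨c, hc, e, rfl⟩
      rcases c with _ | c
      · exact Or.inl ⟨e, rfl⟩
      · exact Or.inr ⟨(e, ⟨c, hc⟩), rfl⟩
    · have := i.pos
      rw [pow_succ, mul_comm]
      exact Nat.mul_le_mul_left _ (by omega)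
  choose f hf hflt using hcode
  -- The clock runs once through the preamble and then cycles through the block.
  let τ : ℕ → ℕ := fun t => if t < L₀ then t else L₀ + (t - L₀) % L₁
  let YY : ℕ → Instance k n S P → Fin n → ℕ := fun t e i =>
    if t < L₀ then Z₀ t e i else if (t - L₀) % L₁ = 0 then f i (Y ((t - L₀) / L₁) e i)
    else if h : (t - L₀) / L₁ < q then Z₁ ((t - L₀) % L₁) (e, ⟨_, h⟩) i else 0
  let MM : ℕ → Instance k n S P → Fin n → Fin n → List ℕ := fun t e j i =>
    if t < L₀ then M₀ t e j i
    else if h : (t - L₀) / L₁ < q then M₁ ((t - L₀) % L₁) (e, ⟨_, h⟩) j i else []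
  have hdiv : ∀ c s, s < L₁ → (L₀ + c * L₁ + s - L₀) / L₁ = c ∧
      (L₀ + c * L₁ + s - L₀) % L₁ = s := by
    intro c s hs
    rw [add_assoc, Nat.add_sub_cancel_left, add_comm, Nat.add_mul_div_right _ _ hL₁,
      Nat.div_eq_of_lt hs, Nat.add_mul_mod_self_right, Nat.mod_eq_of_lt hs]
    simp
  have hcase : ∀ t < L₀ + q * L₁, t < L₀ ∨ ∃ c < q, ∃ s < L₁, t = L₀ + c * L₁ + s := by
    intro t ht
    by_cases h : t < L₀
    · exact .inl h
    · refine .inr ⟨(t - L₀) / L₁, ?_, (t - L₀) % L₁, Nat.mod_lt _ hL₁, ?_⟩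
      · rw [Nat.div_lt_iff_lt_mul hL₁]; omega
      · have := Nat.div_add_mod (t - L₀) L₁
        rw [mul_comm] at this; omega
  have hτ0 : ∀ t < L₀, τ t = t := fun t ht => by simp [τ, ht]
  have hτ1 : ∀ c s, s < L₁ → τ (L₀ + c * L₁ + s) = L₀ + s := by
    intro c s hs
    have : ¬ L₀ + c * L₁ + s < L₀ := by omega
    simp only [τ, this, if_false, (hdiv c s hs).2]
  have hY0 : ∀ t < L₀, YY t = Z₀ t := fun t ht => by funext e i; simp [YY, ht]
  have hM0 : ∀ t < L₀, MM t = M₀ t := fun t ht => by funext e i; simp [MM, ht]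
  have hYb : ∀ c e i, YY (L₀ + c * L₁) e i = f i (Y c e i) := by
    intro c e i
    have := hdiv c 0 hL₁
    have h' : ¬ L₀ + c * L₁ < L₀ := by omega
    simp only [add_zero] at this
    simp only [YY, h', if_false, this.1, this.2, if_true]
  have hYs : ∀ c (hc : c < q) s, s < L₁ → s ≠ 0 → ∀ e i,
      YY (L₀ + c * L₁ + s) e i = Z₁ s (e, ⟨c, hc⟩) i := by
    intro c hc s hs hs0 e i
    have h' : ¬ L₀ + c * L₁ + s < L₀ := by omega
    simp only [YY, h', if_false, (hdiv c s hs).1, (hdiv c s hs).2, hs0, hc, dif_pos]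
  have hMs : ∀ c (hc : c < q) s, s < L₁ → ∀ e,
      MM (L₀ + c * L₁ + s) e = M₁ s (e, ⟨c, hc⟩) := by
    intro c hc s hs e
    have h' : ¬ L₀ + c * L₁ + s < L₀ := by omega
    funext j i
    simp only [MM, h', if_false, (hdiv c s hs).1, (hdiv c s hs).2, hc, dif_pos]
  -- At the start of a block the stored number codes `Y`, which determines the internal start state
  -- of the block; later the internal state itself is stored.
  have hkey : ∀ c (hc : c < q) c' (hc' : c' < q) s, s < L₁ → ∀ e e' i,
      YY (L₀ + c * L₁ + s) e i = YY (L₀ + c' * L₁ + s) e' i →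
      Z₁ s (e, ⟨c, hc⟩) i = Z₁ s (e', ⟨c', hc'⟩) i := by
    intro c hc c' hc' s hs e e' i h
    by_cases hs0 : s = 0
    · subst hs0
      simp only [add_zero, hYb] at h
      exact h1X i (e, ⟨c, hc⟩) (e', ⟨c', hc'⟩)
        (hf i ⟨c, hc.le, e, rfl⟩ ⟨c', hc'.le, e', rfl⟩ h)
    · rwa [hYs c hc s hs hs0, hYs c' hc' s hs hs0] at h
  have hnext : ∀ c (hc : c < q) c' (hc' : c' < q) s, s < L₁ → ∀ e e' i,
      Z₁ (s + 1) (e, ⟨c, hc⟩) i = Z₁ (s + 1) (e', ⟨c', hc'⟩) i →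
      YY (L₀ + c * L₁ + s + 1) e i = YY (L₀ + c' * L₁ + s + 1) e' i := by
    intro c hc c' hc' s hs e e' i h
    by_cases hs1 : s + 1 = L₁
    · have e1 : ∀ c, L₀ + c * L₁ + s + 1 = L₀ + (c + 1) * L₁ := by
        intro c; rw [add_mul, one_mul]; omega
      rw [hs1] at h
      rw [e1, e1, hYb, hYb]
      exact congrArg (f i) (h1Y i (e, ⟨c, hc⟩) (e', ⟨c', hc'⟩) h)
    · rw [add_assoc, add_assoc _ s 1, hYs c hc (s + 1) (by omega) (by omega),
        hYs c' hc' (s + 1) (by omega) (by omega)]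
      exact h
  have hnext0 : ∀ t < L₀, ∀ e e' i, Z₀ (t + 1) e i = Z₀ (t + 1) e' i →
      YY (t + 1) e i = YY (t + 1) e' i := by
    intro t ht e e' i h
    by_cases ht1 : t + 1 = L₀
    · rw [ht1] at h ⊢
      have := hYb 0
      rw [zero_mul, add_zero] at this
      rw [this, this, h0Y i e e' h]
    · rw [hY0 (t + 1) (by omega)]; exact h
  refine exists_mpc_of_run (R := L₀ + q * L₁) (T := L₀ + L₁) (b := b + 1) τ ?_ ?_ YY MM ?_ hb
    ?_ ?_ ?_ ?_ ?_ ?_ O ?_ hO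
  · intro t ht
    rcases hcase t ht with h | ⟨c, hc, s, hs, rfl⟩
    · rw [hτ0 t h]; omega
    · rw [hτ1 c s hs]; omega
  · intro t ht t' ht' h
    rcases hcase t ht with h1 | ⟨c, hc, s, hs, rfl⟩ <;>
      rcases hcase t' ht' with h2 | ⟨c', hc', s', hs', rfl⟩
    · rw [hτ0 t h1, hτ0 t' h2] at h; rw [h]
    · rw [hτ0 t h1, hτ1 c' s' hs'] at h; omega
    · rw [hτ0 t' h2, hτ1 c s hs] at h; omega
    · rw [hτ1 c s hs, hτ1 c' s' hs'] at h
      obtain rfl : s = s' := by omega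
      by_cases hs1 : s + 1 = L₁
      · have e1 : ∀ c, L₀ + c * L₁ + s + 1 = L₀ + (c + 1) * L₁ + 0 := by
          intro c; rw [add_mul, one_mul]; omega
        rw [e1, e1, hτ1 _ 0 hL₁, hτ1 _ 0 hL₁]
      · rw [add_assoc, add_assoc _ s 1, hτ1 c (s + 1) (by omega), hτ1 c' (s + 1) (by omega)]
  · intro t ht e i
    have hmono : (n + 1) ^ b ≤ (n + 1) ^ (b + 1) := Nat.pow_le_pow_right (by omega) (by omega)
    rcases ht.lt_or_eq with ht | rfl
    · rcases hcase t ht with h | ⟨c, hc, s, hs, rfl⟩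
      · rw [hY0 t h]; exact (h0lt t h.le e i).trans_le hmono
      · by_cases hs0 : s = 0
        · subst hs0; rw [add_zero, hYb]; exact hflt i _ ⟨c, hc.le, e, rfl⟩
        · rw [hYs c hc s hs hs0]; exact (h1lt s hs.le _ i).trans_le hmono
    · rw [hYb]; exact hflt i _ ⟨q, le_rfl, e, rfl⟩
  · intro i e e' h
    by_cases hL : 0 < L₀
    · rw [hY0 0 hL]; exact h0X i e e' h
    · have hL0 : L₀ = 0 := by omega
      subst hL0
      have := hYb 0
      rw [zero_mul, add_zero] at this
      rw [this, this, h0Y i e e' (h0X i e e' h)]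
  · intro t ht e j i x hx
    refine lt_of_lt_of_le ?_ (Nat.pow_le_pow_right (by omega) hw)
    rcases hcase t ht with h | ⟨c, hc, s, hs, rfl⟩
    · rw [hM0 t h] at hx; exact (h0 t h).1 e j i x hx
    · rw [hMs c hc s hs] at hx; exact (h1 s hs).1 _ j i x hx
  · intro t ht t' ht' h e e' j hY
    rcases hcase t ht with h1' | ⟨c, hc, s, hs, rfl⟩ <;>
      rcases hcase t' ht' with h2' | ⟨c', hc', s', hs', rfl⟩
    · rw [hτ0 t h1', hτ0 t' h2'] at h
      subst h
      rw [hY0 t h1'] at hY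
      rw [hM0 t h1']
      exact (h0 t h1').2.1 j e e' hY
    · rw [hτ0 t h1', hτ1 c' s' hs'] at h; omega
    · rw [hτ0 t' h2', hτ1 c s hs] at h; omega
    · rw [hτ1 c s hs, hτ1 c' s' hs'] at h
      obtain rfl : s = s' := by omega
      rw [hMs c hc s hs, hMs c' hc' s hs]
      exact (h1 s hs).2.1 j _ _ (hkey c hc c' hc' s hs e e' j hY)
  · intro t ht t' ht' h e e' i hY hm
    rcases hcase t ht with h1' | ⟨c, hc, s, hs, rfl⟩ <;>
      rcases hcase t' ht' with h2' | ⟨c', hc', s', hs', rfl⟩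
    · rw [hτ0 t h1', hτ0 t' h2'] at h
      subst h
      rw [hY0 t h1'] at hY
      rw [hM0 t h1'] at hm
      exact hnext0 t h1' e e' i ((h0 t h1').2.2.2.2 i e e' (Prod.ext hY (funext hm)))
    · rw [hτ0 t h1', hτ1 c' s' hs'] at h; omega
    · rw [hτ0 t' h2', hτ1 c s hs] at h; omega
    · rw [hτ1 c s hs, hτ1 c' s' hs'] at h
      obtain rfl : s = s' := by omega
      rw [hMs c hc s hs, hMs c' hc' s hs] at hm
      exact hnext c hc c' hc' s hs e e' i ((h1 s hs).2.2.2.2 i (e, ⟨c, hc⟩) (e', ⟨c', hc'⟩)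
        (Prod.ext (hkey c hc c' hc' s hs e e' i hY) (funext hm)))
  · intro t ht e j
    rcases hcase t ht with h | ⟨c, hc, s, hs, rfl⟩
    · rw [hM0 t h]; exact (h0 t h).2.2.1 e j
    · rw [hMs c hc s hs]; exact (h1 s hs).2.2.1 _ j
  · intro t ht e j
    rcases hcase t ht with h | ⟨c, hc, s, hs, rfl⟩
    · rw [hM0 t h]; exact (h0 t h).2.2.2.1 e j
    · rw [hMs c hc s hs]; exact (h1 s hs).2.2.2.1 _ j
  · intro i e e' h
    rw [hYb, hYb] at h
    exact hdO i e e' (hf i ⟨q, le_rfl, e, rfl⟩ ⟨q, le_rfl, e', rfl⟩ h)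

end Loop


/-! ## Prefix sums -/

section Scan

variable {E : Type} {n : ℕ}

/-- A window of length `q * F` is the disjoint union of `F` windows of length `q`. The one that
contains `x` ends at the position reached from `i` by `(i - x) / q` steps of length `q`. -/
theorem sum_window_left (g : Fin n → ℕ) (i : Fin n) {q F : ℕ} (hq : 0 < q) :
    ∑ x ∈ univ.filter (fun x : Fin n => (x : ℕ) ≤ i ∧ (i : ℕ) < x + q * F), g x =
      ∑ j ∈ univ.filter (fun j : Fin n => ∃ r < F, (i : ℕ) = j + r * q),
        ∑ x ∈ univ.filter (fun x : Fin n => (x : ℕ) ≤ j ∧ (j : ℕ) < x + q), g x := by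
  have hlt : ∀ x : Fin n, (i : ℕ) - (i - x) / q * q < n := fun x =>
    lt_of_le_of_lt (Nat.sub_le _ _) i.2
  rw [← sum_fiberwise_of_maps_to (g := fun x : Fin n => (⟨_, hlt x⟩ : Fin n))
    (t := univ.filter fun j : Fin n => ∃ r < F, (i : ℕ) = j + r * q)]
  · refine sum_congr rfl fun j hj => sum_congr ?_ fun _ _ => rfl
    obtain ⟨r, hr, hij⟩ := (mem_filter.1 hj).2
    ext x
    simp only [mem_filter, mem_univ, true_and, Fin.ext_iff]
    have h1 := Nat.div_add_mod ((i : ℕ) - x) q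
    have h2 := Nat.mod_lt ((i : ℕ) - x) hq
    rw [mul_comm] at h1
    constructor
    · rintro ⟨⟨h3, h4⟩, h5⟩
      omega
    · rintro ⟨h3, h4⟩
      have h6 : ((i : ℕ) - x) / q = r := by
        rw [Nat.div_eq_iff hq]
        constructor <;> omega
      have h7 : (r + 1) * q ≤ F * q := Nat.mul_le_mul_right _ hr
      rw [add_mul, one_mul, mul_comm F] at h7
      rw [h6]
      omega
  · intro x hx
    simp only [mem_univ, true_and, mem_filter] at hx ⊢
    refine ⟨((i : ℕ) - x) / q, ?_, ?_⟩
    · rw [Nat.div_lt_iff_lt_mul hq, mul_comm]; omega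
    · have h1 := Nat.div_mul_le_self ((i : ℕ) - x) q
      omega

theorem sum_window_right (g : Fin n → ℕ) (i : Fin n) {q F : ℕ} (hq : 0 < q) :
    ∑ x ∈ univ.filter (fun x : Fin n => (i : ℕ) ≤ x ∧ (x : ℕ) < i + q * F), g x =
      ∑ j ∈ univ.filter (fun j : Fin n => ∃ r < F, (j : ℕ) = i + r * q),
        ∑ x ∈ univ.filter (fun x : Fin n => (j : ℕ) ≤ x ∧ (x : ℕ) < j + q), g x := by
  have hlt : ∀ x : Fin n, (x : ℕ) - (x - i) % q < n := fun x =>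
    lt_of_le_of_lt (Nat.sub_le _ _) x.2
  rw [← sum_fiberwise_of_maps_to (g := fun x : Fin n => (⟨_, hlt x⟩ : Fin n))
    (t := univ.filter fun j : Fin n => ∃ r < F, (j : ℕ) = i + r * q)]
  · refine sum_congr rfl fun j hj => sum_congr ?_ fun _ _ => rfl
    obtain ⟨r, hr, hij⟩ := (mem_filter.1 hj).2
    ext x
    simp only [mem_filter, mem_univ, true_and, Fin.ext_iff]
    have h1 := Nat.div_add_mod ((x : ℕ) - i) q
    have h2 := Nat.mod_lt ((x : ℕ) - i) hq
    rw [mul_comm] at h1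
    constructor
    · rintro ⟨⟨h3, h4⟩, h5⟩
      omega
    · rintro ⟨h3, h4⟩
      have h6 : ((x : ℕ) - i) / q = r := by
        rw [Nat.div_eq_iff hq]
        constructor <;> omega
      have h7 : (r + 1) * q ≤ F * q := Nat.mul_le_mul_right _ hr
      rw [add_mul, one_mul, mul_comm F] at h7
      rw [h6] at h1
      omega
  · intro x hx
    simp only [mem_univ, true_and, mem_filter] at hx ⊢
    refine ⟨((x : ℕ) - i) / q, ?_, ?_⟩
    · rw [Nat.div_lt_iff_lt_mul hq, mul_comm]; omega
    · have h1 := Nat.div_add_mod ((x : ℕ) - i) q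
      rw [mul_comm] at h1
      omega

/-- Machines `i` and `j` exchange their sums in round `t` of the computation of prefix sums. -/
def Near (F t : ℕ) (j i : Fin n) : Prop :=
  i ≠ j ∧ ∃ r < F, (i : ℕ) = j + r * F ^ t ∨ (j : ℕ) = i + r * F ^ t

open Classical in
theorem card_near_le (F t : ℕ) (j : Fin n) :
    (univ.filter fun i : Fin n => Near F t j i).card ≤ 2 * F := by
  rw [← card_map Fin.valEmbedding, two_mul]
  have : (univ.filter fun i : Fin n => Near F t j i).map Fin.valEmbedding ⊆
      ((range F).image fun r => (j : ℕ) + r * F ^ t) ∪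
        (range F).image fun r => (j : ℕ) - r * F ^ t := by
    intro x hx
    simp only [mem_map, mem_filter, mem_univ, true_and, Fin.valEmbedding_apply, mem_union,
      mem_image, mem_range] at hx ⊢
    obtain ⟨i, ⟨-, r, hr, h | h⟩, rfl⟩ := hx
    · exact .inl ⟨r, hr, h.symm⟩
    · exact .inr ⟨r, hr, by omega⟩
  refine (card_le_card this).trans ((card_union_le _ _).trans ?_)
  exact add_le_add (card_image_le.trans (card_range F).le) (card_image_le.trans (card_range F).le)

theorem Near.symm {F t : ℕ} {i j : Fin n} (h : Near F t j i) : Near F t i j := by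
  obtain ⟨h, r, hr, h'⟩ := h
  exact ⟨h.symm, r, hr, h'.symm⟩

open Classical in
theorem sum_length_near_le {F t m S : ℕ} (hS : 2 * F * m ≤ S) (v : Fin n → Fin m → ℕ)
    (j : Fin n) : ∑ i, (if Near F t j i then List.ofFn (v i) else []).length ≤ S := by
  have : ∀ i, (if Near F t j i then List.ofFn (v i) else []).length =
      if Near F t j i then m else 0 := by
    intro i; split_ifs <;> simp
  simp only [this]
  rw [← sum_filter, sum_const, smul_eq_mul]
  exact (Nat.mul_le_mul_right m (card_near_le F t j)).trans hS

/-- After `t` rounds every machine knows the sums over the windows of length `F ^ t` that end and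
that start at it. One round combines `F` windows on each side, so after `D` rounds the windows cover
everything. The window to the right is needed for the total. -/
theorem reach_scan {m F D w S : ℕ} (hFD : n ≤ F ^ D) (c : E → Fin n → Fin m → ℕ)
    (hc : ∀ e φ, ∑ i, c e i φ < (n + 1) ^ w) (hS : 2 * F * m ≤ S) :
    Reach w S (3 * ((w + 1) * m)) c D fun e i =>
      (c e i, (fun φ => ∑ j with j < i, c e j φ), fun φ => ∑ j, c e j φ) := by
  classical
  let Lw : ℕ → E → Fin n → Fin m → ℕ := fun t e i φ =>
    ∑ x ∈ univ.filter (fun x : Fin n => (x : ℕ) ≤ i ∧ (i : ℕ) < x + F ^ t), c e x φ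
  let Rw : ℕ → E → Fin n → Fin m → ℕ := fun t e i φ =>
    ∑ x ∈ univ.filter (fun x : Fin n => (i : ℕ) ≤ x ∧ (x : ℕ) < i + F ^ t), c e x φ
  have hlt : ∀ (s : Finset (Fin n)) e φ, ∑ x ∈ s, c e x φ < (n + 1) ^ w := fun s e φ =>
    lt_of_le_of_lt (sum_le_sum_of_subset (subset_univ s)) (hc e φ)
  have hclt : ∀ e i φ, c e i φ < (n + 1) ^ w := by
    intro e i φ
    simpa using hlt {i} e φ
  have hst : ∀ f : E → Fin n → Fin m → ℕ, (∀ e i φ, f e i φ < (n + 1) ^ w) →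
      Stored ((w + 1) * m) f := fun f hf =>
    Stored.funs (U := {x | x < (n + 1) ^ w}) (Small.range_lt _ fun a ha => ha) hf
  have hst3 : ∀ f g h : E → Fin n → Fin m → ℕ, (∀ e i φ, f e i φ < (n + 1) ^ w) →
      (∀ e i φ, g e i φ < (n + 1) ^ w) → (∀ e i φ, h e i φ < (n + 1) ^ w) →
      Stored (3 * ((w + 1) * m)) fun e i => (f e i, g e i, h e i) := by
    intro f g h hf hg hh
    refine ((hst f hf).prod ((hst g hg).prod (hst h hh))).mono ?_
    omega
  have key : ∀ t ≤ D, Reach w S (3 * ((w + 1) * m)) c t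
      fun e i => (c e i, Lw t e i, Rw t e i) := by
    intro t
    induction t with
    | zero =>
      intro _
      refine .loc ?_ (hst3 _ _ _ hclt (fun e i φ => hlt _ e φ) (fun e i φ => hlt _ e φ))
      intro i e e' h
      have e1 : (univ.filter fun x : Fin n => (x : ℕ) ≤ i ∧ (i : ℕ) < x + F ^ 0) = {i} := by
        ext x; simp only [mem_filter, mem_univ, true_and, mem_singleton, Fin.ext_iff, pow_zero]
        omega
      have e2 : (univ.filter fun x : Fin n => (i : ℕ) ≤ x ∧ (x : ℕ) < i + F ^ 0) = {i} := by
        ext x; simp only [mem_filter, mem_univ, true_and, mem_singleton, Fin.ext_iff, pow_zero]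
        omega
      simp only [Lw, Rw, e1, e2, sum_singleton, h]
    | succ t ih =>
      intro ht
      -- There is at least one round here, so `F = 0` forces `n = 0` and there are no machines.
      by_cases hF : F = 0
      · subst hF
        have : n = 0 := by
          have : D ≠ 0 := by omega
          simpa [this] using hFD
        subst this
        refine .round (M := fun (_ : E) (_ _ : Fin 0) => ([] : List ℕ)) (ih (by omega))
          ⟨?_, fun i => i.elim0, fun _ i => i.elim0, fun _ i => i.elim0⟩ (fun i => i.elim0)
          (fun i => i.elim0)
        exact Small.range_lt _ (by simp)
      have hq : 0 < F ^ t := Nat.pow_pos (by omega)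
      -- Sums over left windows travel to the right, and sums over right windows to the left.
      refine .round (M := fun e j i => if Near F t j i then
          List.ofFn (if j < i then Lw t e j else Rw t e j) else []) (ih (by omega)) ⟨?_, ?_, ?_, ?_⟩
        ?_ (hst3 _ _ _ hclt (fun e i φ => hlt _ e φ) (fun e i φ => hlt _ e φ))
      · refine Small.range_lt _ ?_
        rintro x ⟨e, j, i, hx⟩
        split_ifs at hx
        · obtain ⟨φ, rfl⟩ := List.mem_ofFn.1 hx; exact hlt _ e φ
        · obtain ⟨φ, rfl⟩ := List.mem_ofFn.1 hx; exact hlt _ e φ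
        · simp at hx
      · intro j e e' h
        simp only [Prod.mk.injEq] at h
        funext i
        simp only [h.2.1, h.2.2]
      · intro e j
        exact sum_length_near_le hS _ j
      · intro e i
        have : ∀ j, Near F t j i ↔ Near F t i j := fun j => ⟨Near.symm, Near.symm⟩
        simp only [this]
        exact sum_length_near_le hS _ i
      · intro i e e' h
        simp only [Prod.mk.injEq] at h ⊢
        obtain ⟨⟨h1, h2, h3⟩, h4⟩ := h
        refine ⟨h1, ?_, ?_⟩
        · funext φ
          simp only [Lw, pow_succ]
          rw [sum_window_left _ i hq, sum_window_left _ i hq]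
          refine sum_congr rfl fun j hj => ?_
          obtain ⟨r, hr, hij⟩ := (mem_filter.1 hj).2
          by_cases hji : i = j
          · subst hji
            exact congrFun h2 φ
          · have h5 := congrFun h4 j
            have h6 : j < i := by
              rw [Fin.lt_def]
              have : (i : ℕ) ≠ j := fun h => hji (Fin.ext h)
              omega
            have h7 : Near F t j i := ⟨hji, r, hr, .inl hij⟩
            simp only [h6, h7, if_true] at h5
            exact congrFun (List.ofFn_injective h5) φ
        · funext φ
          simp only [Rw, pow_succ]
          rw [sum_window_right _ i hq, sum_window_right _ i hq]
          refine sum_congr rfl fun j hj => ?_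
          obtain ⟨r, hr, hij⟩ := (mem_filter.1 hj).2
          by_cases hji : i = j
          · subst hji
            exact congrFun h3 φ
          · have h5 := congrFun h4 j
            have h6 : ¬ j < i := by
              rw [Fin.lt_def]
              omega
            have h7 : Near F t j i := ⟨hji, r, hr, .inr hij⟩
            simp only [h6, h7, if_true, if_false] at h5
            exact congrFun (List.ofFn_injective h5) φ
  refine (key D le_rfl).det_right ?_
  -- Both windows contain the machine itself. Its own summand is removed for the prefix sum, and
  -- then counted once in the total.
  have hL : ∀ e i φ, Lw D e i φ = ∑ j with j < i, c e j φ + c e i φ := by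
    intro e i φ
    have : (univ.filter fun x : Fin n => (x : ℕ) ≤ i ∧ (i : ℕ) < x + F ^ D) =
        insert i (univ.filter fun j => j < i) := by
      ext x
      simp only [mem_filter, mem_univ, true_and, mem_insert, Fin.ext_iff, Fin.lt_def]
      have := i.2
      omega
    simp only [Lw, this]
    rw [sum_insert (by simp), add_comm]
  have hR : ∀ e i φ, ∑ j with j < i, c e j φ + Rw D e i φ = ∑ j, c e j φ := by
    intro e i φ
    rw [← sum_filter_add_sum_filter_not univ (fun j => j < i)]
    refine congrArg _ (sum_congr ?_ fun _ _ => rfl)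
    ext x
    simp only [mem_filter, mem_univ, true_and, Fin.lt_def]
    have := x.2
    omega
  intro i e e' h
  simp only [Prod.mk.injEq] at h ⊢
  obtain ⟨h1, h2, h3⟩ := h
  have h4 : ∀ φ, ∑ j with j < i, c e j φ = ∑ j with j < i, c e' j φ := by
    intro φ
    have := congrFun h2 φ
    rw [hL, hL, h1] at this
    omega
  refine ⟨h1, funext h4, funext fun φ => ?_⟩
  have := congrFun h3 φ
  rw [← hR e i φ, ← hR e' i φ, h4 φ, this]

end Scan


/-! ## Sorting -/

/-- The number of elements of `s` below `x`. -/
def rank (s : Finset ℕ) (x : ℕ) : ℕ := (s.filter (· < x)).card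

theorem rank_lt_rank {s : Finset ℕ} {x y : ℕ} (hx : x ∈ s) (h : x < y) : rank s x < rank s y := by
  refine card_lt_card ⟨fun z hz => ?_, fun hsub => ?_⟩
  · rw [mem_filter] at hz ⊢
    exact ⟨hz.1, hz.2.trans h⟩
  · have := hsub (mem_filter.2 ⟨hx, h⟩)
    exact lt_irrefl _ (mem_filter.1 this).2

theorem rank_mono (s : Finset ℕ) {x y : ℕ} (h : x ≤ y) : rank s x ≤ rank s y :=
  card_le_card fun z hz => by
    rw [mem_filter] at hz ⊢
    exact ⟨hz.1, hz.2.trans_le h⟩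

theorem rank_lt_card {s : Finset ℕ} {x : ℕ} (hx : x ∈ s) : rank s x < s.card :=
  card_lt_card ⟨filter_subset _ _, fun h => lt_irrefl _ (mem_filter.1 (h hx)).2⟩

theorem rank_inj {s : Finset ℕ} {x y : ℕ} (hx : x ∈ s) (hy : y ∈ s) (h : rank s x = rank s y) :
    x = y := by
  rcases lt_trichotomy x y with h' | h' | h'
  · exact absurd h (rank_lt_rank hx h').ne
  · exact h'
  · exact absurd h (rank_lt_rank hy h').ne'

/-- The values with quotient `i` lie in an interval of length `s`. So assigning elements to machines
by rank divided by `s` puts at most `s` elements on each machine. -/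
theorem card_filter_div_le {α : Type} (A : Finset α) (f : α → ℕ)
    (hf : ∀ x ∈ A, ∀ y ∈ A, f x = f y → x = y) {s : ℕ} (hs : 0 < s) (i : ℕ) :
    (A.filter fun x => f x / s = i).card ≤ s := by
  refine (card_le_card_of_injOn (t := Ico (i * s) (i * s + s)) f ?_ ?_).trans (by simp)
  · intro x hx
    obtain ⟨h1, h2⟩ := mem_filter.1 hx
    have h3 := Nat.div_mul_le_self (f x) s
    have h4 := Nat.lt_div_mul_add (a := f x) hs
    rw [h2] at h3 h4
    simp only [coe_Ico, Set.mem_Ico]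
    omega
  · intro x hx y hy
    exact hf x (mem_filter.1 hx).1 y (mem_filter.1 hy).1

section Pass

variable {E : Type} {n F D S s v : ℕ} (All : E → Finset ℕ) (loc ρ : E → ℕ → ℕ)

/-- The elements held by a machine together with their ranks. -/
def held (e : E) (i : Fin n) : Finset (ℕ × ℕ) :=
  ((All e).filter fun x => loc e x = i).image fun x => (x, ρ e x)

/-- The rank of an element with respect to `g`, where ties are resolved by `ρ`. -/
def passRank (g : ℕ → Fin F) (e : E) (x : ℕ) : ℕ :=
  ((All e).filter fun y => g y < g x ∨ (g y = g x ∧ ρ e y < ρ e x)).card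

variable {All loc ρ}

theorem mem_held {e : E} {i : Fin n} {p : ℕ × ℕ} :
    p ∈ held All loc ρ e i ↔ p.1 ∈ All e ∧ loc e p.1 = i ∧ p.2 = ρ e p.1 := by
  rcases p with ⟨x, r⟩
  simp only [held, mem_image, mem_filter, Prod.mk.injEq]
  constructor
  · rintro ⟨y, ⟨h1, h2⟩, rfl, rfl⟩; exact ⟨h1, h2, rfl⟩
  · rintro ⟨h1, h2, h3⟩; exact ⟨x, ⟨h1, h2⟩, rfl, h3.symm⟩

theorem held_eq {e e' : E} {i : Fin n} (h : held All loc ρ e i = held All loc ρ e' i) {x : ℕ}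
    (hx : x ∈ All e) (hi : loc e x = i) : x ∈ All e' ∧ loc e' x = i ∧ ρ e' x = ρ e x := by
  have : (x, ρ e x) ∈ held All loc ρ e' i := h ▸ mem_held.2 ⟨hx, hi, rfl⟩
  obtain ⟨h1, h2, h3⟩ := mem_held.1 this
  exact ⟨h1, h2, h3.symm⟩

theorem stored_held (hx : ∀ e, ∀ x ∈ All e, x < (n + 1) ^ v)
    (hρ : ∀ e, ∀ x ∈ All e, ρ e x < (n + 1) ^ v)
    (hheld : ∀ e (i : Fin n), ((All e).filter fun x => loc e x = i).card ≤ S) :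
    Stored (n := n) ((2 * v + 1) * S) (held All loc ρ) := by
  have hU : Small ({x : ℕ | x < (n + 1) ^ v} ×ˢ {x : ℕ | x < (n + 1) ^ v}) ((n + 1) ^ (2 * v)) := by
    rw [two_mul, pow_add]
    exact (Small.range_lt _ fun a ha => ha).prod (Small.range_lt _ fun a ha => ha)
  refine Stored.finset hU (fun e i => card_image_le.trans (hheld e i)) ?_
  intro e i p hp
  obtain ⟨h1, -, h2⟩ := mem_held.1 hp
  exact ⟨hx e _ h1, by rw [Set.mem_ofPred_eq, h2]; exact hρ e _ h1⟩

theorem passRank_lt_passRank {g : ℕ → Fin F} {e : E} {x y : ℕ} (hy : y ∈ All e)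
    (h : g y < g x ∨ (g y = g x ∧ ρ e y < ρ e x)) :
    passRank All ρ g e y < passRank All ρ g e x := by
  refine card_lt_card ⟨fun z hz => ?_, fun hsub => ?_⟩
  · rw [mem_filter] at hz ⊢
    refine ⟨hz.1, ?_⟩
    rcases hz.2 with h1 | ⟨h1, h2⟩ <;> rcases h with h3 | ⟨h3, h4⟩
    · exact .inl (h1.trans h3)
    · exact .inl (h3 ▸ h1)
    · exact .inl (h1 ▸ h3)
    · exact .inr ⟨h1.trans h3, h2.trans h4⟩
  · have := hsub (mem_filter.2 ⟨hy, h⟩)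
    rcases (mem_filter.1 this).2 with h1 | ⟨h1, h2⟩
    · exact lt_irrefl _ h1
    · exact lt_irrefl _ h2

theorem passRank_lt_card {g : ℕ → Fin F} {e : E} {x : ℕ} (hx : x ∈ All e) :
    passRank All ρ g e x < (All e).card :=
  card_lt_card ⟨filter_subset _ _, fun h => by
    rcases (mem_filter.1 (h hx)).2 with h1 | ⟨h1, h2⟩
    · exact lt_irrefl _ h1
    · exact lt_irrefl _ h2⟩

theorem passRank_inj {g : ℕ → Fin F} {e : E}
    (hinj : ∀ x ∈ All e, ∀ y ∈ All e, ρ e x = ρ e y → x = y) {x y : ℕ} (hx : x ∈ All e)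
    (hy : y ∈ All e) (h : passRank All ρ g e x = passRank All ρ g e y) : x = y := by
  rcases lt_trichotomy (g x) (g y) with h1 | h1 | h1
  · exact absurd h (passRank_lt_passRank hx (.inl h1)).ne
  · rcases lt_trichotomy (ρ e x) (ρ e y) with h2 | h2 | h2
    · exact absurd h (passRank_lt_passRank hx (.inr ⟨h1, h2⟩)).ne
    · exact hinj x hx y hy h2
    · exact absurd h (passRank_lt_passRank hy (.inr ⟨h1.symm, h2⟩)).ne'
  · exact absurd h (passRank_lt_passRank hy (.inl h1)).ne'

theorem sum_card_filter_lt (A : Finset ℕ) (l : ℕ → ℕ) (p : ℕ → Prop) [DecidablePred p]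
    (i : Fin n) : ∑ j : Fin n with j < i, (A.filter fun x => l x = j ∧ p x).card =
      (A.filter fun x => l x < i ∧ p x).card := by
  rw [← card_biUnion]
  · congr 1
    ext x
    simp only [mem_biUnion, mem_filter, mem_univ, true_and]
    constructor
    · rintro ⟨j, h1, h2, h3, h4⟩
      exact ⟨h2, h3 ▸ h1, h4⟩
    · rintro ⟨h1, h2, h3⟩
      exact ⟨⟨l x, h2.trans i.2⟩, h2, h1, rfl, h3⟩
  · intro a _ b _ hab
    rw [Function.onFun, disjoint_left]
    intro x h1 h2
    exact hab (Fin.ext ((mem_filter.1 h1).2.1.symm.trans (mem_filter.1 h2).2.1))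

theorem sum_card_filter_le (A : Finset ℕ) (l : ℕ → ℕ) (p : ℕ → Prop) [DecidablePred p] :
    ∑ j : Fin n, (A.filter fun x => l x = j ∧ p x).card ≤ A.card := by
  rw [← card_biUnion]
  · refine card_le_card fun x hx => ?_
    simp only [mem_biUnion, mem_filter] at hx
    exact hx.choose_spec.2.1
  · intro a _ b _ hab
    rw [Function.onFun, disjoint_left]
    intro x h1 h2
    exact hab (Fin.ext ((mem_filter.1 h1).2.1.symm.trans (mem_filter.1 h2).2.1))

/-- One pass of radix sort. -/
theorem reach_pass (g : ℕ → Fin F) (hx : ∀ e, ∀ x ∈ All e, x < (n + 1) ^ v)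
    (hρ : ∀ e, ∀ x ∈ All e, ρ e x < (n + 1) ^ v) (hcard : ∀ e, (All e).card < (n + 1) ^ v)
    (hinj : ∀ e, ∀ x ∈ All e, ∀ y ∈ All e, ρ e x = ρ e y → x = y)
    (hmono : ∀ e, ∀ x ∈ All e, ∀ y ∈ All e, ρ e x < ρ e y → loc e x ≤ loc e y)
    (hloc : ∀ e, ∀ x ∈ All e, loc e x < n)
    (hheld : ∀ e (i : Fin n), ((All e).filter fun x => loc e x = i).card ≤ S)
    (hs : 0 < s) (hsS : s ≤ S) (hFD : n ≤ F ^ D) (hF : 2 * F * F ≤ S) :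
    Reach (n := n) (2 * v) S ((5 * v + 4) * S) (held All loc ρ) (D + 1)
      (held All (fun e x => passRank All ρ g e x / s) (passRank All ρ g)) := by
  classical
  -- The histogram of the current digits on each machine. Prefix sums and totals of the `F` counters
  -- cost `2 * F * F` words per round, which is where the condition on `F` comes from.
  let c : E → Fin n → Fin F → ℕ := fun e i φ =>
    ((All e).filter fun x => loc e x = i ∧ g x = φ).card
  have hFS : F ≤ S := by
    rcases Nat.eq_zero_or_pos F with h | h
    · omega
    · nlinarith
  have hheldS := stored_held (loc := loc) hx hρ hheld
  have hb : 3 * ((v + 1) * F) + (2 * v + 1) * S ≤ (5 * v + 4) * S := by nlinarith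
  have hscan := (((reach_scan (D := D) hFD c (fun e φ =>
    (sum_card_filter_le (All e) (loc e) (fun x => g x = φ)).trans_lt (hcard e)) hF).mono
    (show v ≤ 2 * v by omega) le_rfl le_rfl).frame hheldS).mono le_rfl le_rfl hb
  have hscan' := hscan.det_left (X' := held (n := n) All loc ρ) (by
    intro i e e' h
    simp only [Prod.mk.injEq]
    refine ⟨funext fun φ => ?_, h⟩
    refine congrArg card (Finset.ext fun x => ?_)
    simp only [mem_filter]
    constructor
    · rintro ⟨h1, h2, h3⟩
      obtain ⟨h4, h5, -⟩ := held_eq h h1 h2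
      exact ⟨h4, h5, h3⟩
    · rintro ⟨h1, h2, h3⟩
      obtain ⟨h4, h5, -⟩ := held_eq h.symm h1 h2
      exact ⟨h4, h5, h3⟩)
  -- Stable counting sort: the new rank counts the elements with smaller digit, those with the same
  -- digit on earlier machines, and those with the same digit on the same machine that precede in
  -- the old order. The scan supplies the first two, the machine itself the third. Elements on
  -- earlier machines precede in the old order because locations are monotone in the ranks.
  have hformula : ∀ e (i : Fin n), ∀ x ∈ All e, loc e x = i → passRank All ρ g e x =
      ∑ φ with φ < g x, ∑ j, c e j φ + ∑ j with j < i, c e j (g x) +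
        ((All e).filter fun y => loc e y = i ∧ g y = g x ∧ ρ e y < ρ e x).card := by
    intro e i x hxA hxi
    have h1 : ∑ φ with φ < g x, ∑ j, c e j φ = ((All e).filter fun y => g y < g x).card := by
      have : ∀ φ, ∑ j, c e j φ = ((All e).filter fun y => g y = φ).card := by
        intro φ
        rw [← card_biUnion]
        · congr 1
          ext y
          simp only [mem_biUnion, mem_filter, mem_univ, true_and]
          exact ⟨fun ⟨j, h1, h2, h3⟩ => ⟨h1, h3⟩,
            fun ⟨h1, h2⟩ => ⟨⟨loc e y, hloc e y h1⟩, h1, rfl, h2⟩⟩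
        · intro a _ b _ hab
          rw [Function.onFun, disjoint_left]
          intro x h1 h2
          exact hab (Fin.ext ((mem_filter.1 h1).2.1.symm.trans (mem_filter.1 h2).2.1))
      simp only [this]
      rw [card_eq_sum_card_fiberwise (f := g) (t := univ.filter fun φ => φ < g x)]
      · refine sum_congr rfl fun φ hφ => congrArg card ?_
        ext y
        simp only [mem_filter, mem_univ, true_and] at hφ ⊢
        exact ⟨fun h => ⟨⟨h.1, h.2 ▸ hφ⟩, h.2⟩, fun h => ⟨h.1.1, h.2⟩⟩
      · intro y hy
        simpa using (mem_filter.1 hy).2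
    have h2 : ∑ j with j < i, c e j (g x) =
        ((All e).filter fun y => loc e y < i ∧ g y = g x).card :=
      sum_card_filter_lt (All e) (loc e) (fun y => g y = g x) i
    rw [h1, h2, ← card_union_of_disjoint, ← card_union_of_disjoint]
    · refine congrArg card ?_
      ext y
      simp only [mem_filter, mem_union]
      constructor
      · rintro ⟨h3, h4 | ⟨h4, h5⟩⟩
        · exact .inl (.inl ⟨h3, h4⟩)
        · have h6 := hmono e y h3 x hxA h5
          rw [hxi] at h6
          rcases h6.lt_or_eq with h6 | h6
          · exact .inl (.inr ⟨h3, h6, h4⟩)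
          · exact .inr ⟨h3, h6, h4, h5⟩
      · rintro ((⟨h3, h4⟩ | ⟨h3, h4, h5⟩) | ⟨h3, h4, h5, h6⟩)
        · exact ⟨h3, .inl h4⟩
        · refine ⟨h3, .inr ⟨h5, ?_⟩⟩
          by_contra h6
          rcases (not_lt.1 h6).lt_or_eq with h7 | h7
          · have := hmono e x hxA y h3 h7
            omega
          · rw [hinj e x hxA y h3 h7] at hxi
            omega
        · exact ⟨h3, .inr ⟨h5, h6⟩⟩
    · rw [disjoint_left]
      intro y h3 h4
      simp only [mem_filter, mem_union] at h3 h4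
      rcases h3 with h3 | h3
      · exact h3.2.ne h4.2.2.1
      · omega
    · rw [disjoint_left]
      intro y h3 h4
      exact (mem_filter.1 h3).2.ne (mem_filter.1 h4).2.2
  have hrank : ∀ e, ∀ x ∈ All e, passRank All ρ g e x < (n + 1) ^ v := fun e x hx =>
    (passRank_lt_card hx).trans (hcard e)
  refine hscan'.move (fun e => (All e).image fun x => (x, passRank All ρ g e x))
    (fun e p => loc e p.1) (fun e p => p.2 / s) ?_ ?_ ?_ ?_ ?_ ?_ ?_
  · refine Small.mono (A := {x : ℕ | x < (n + 1) ^ v} ×ˢ {x : ℕ | x < (n + 1) ^ v})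
      (m := (n + 1) ^ v * (n + 1) ^ v)
      ((Small.range_lt _ fun a ha => ha).prod (Small.range_lt _ fun a ha => ha)) ?_
      (by rw [two_mul, pow_add])
    rintro p ⟨e, hp⟩
    obtain ⟨x, hxA, rfl⟩ := mem_image.1 hp
    exact ⟨hx e x hxA, hrank e x hxA⟩
  · intro j e e' h p hp hpj
    obtain ⟨x, hxA, rfl⟩ := mem_image.1 hp
    simp only [Prod.mk.injEq] at h hpj ⊢
    obtain ⟨⟨h1, h2, h3⟩, h4⟩ := h
    obtain ⟨h5, h6, h7⟩ := held_eq h4 hxA hpj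
    have : passRank All ρ g e x = passRank All ρ g e' x := by
      rw [hformula e j x hxA hpj, hformula e' j x h5 h6]
      have e1 : ∀ φ, ∑ j, c e j φ = ∑ j, c e' j φ := congrFun h3
      have e2 : ∀ φ, ∑ i with i < j, c e i φ = ∑ i with i < j, c e' i φ := congrFun h2
      simp only [e1, e2]
      congr 2
      ext y
      simp only [mem_filter]
      constructor
      · rintro ⟨k1, k2, k3, k4⟩
        obtain ⟨k5, k6, k7⟩ := held_eq h4 k1 k2
        exact ⟨k5, k6, k3, by rwa [k7, h7]⟩
      · rintro ⟨k1, k2, k3, k4⟩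
        obtain ⟨k5, k6, k7⟩ := held_eq h4.symm k1 k2
        exact ⟨k5, k6, k3, by rwa [k7, ← h7]⟩
    exact ⟨mem_image.2 ⟨x, h5, by rw [this]⟩, h6, trivial⟩
  · intro e p hp
    obtain ⟨x, hxA, rfl⟩ := mem_image.1 hp
    exact hloc e x hxA
  · intro e i
    rw [filter_image]
    exact card_image_le.trans (hheld e i)
  · intro e i
    rw [filter_image]
    exact card_image_le.trans ((card_filter_div_le _ _
      (fun x hx y hy => passRank_inj (hinj e) hx hy) hs i).trans hsS)
  · intro i e e' h
    have h' := (Prod.mk.inj h).2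
    simp only [filter_image] at h'
    exact h'
  · refine (stored_held hx hrank fun e i => ?_).mono (by nlinarith)
    exact (card_filter_div_le _ _ (fun x hx y hy => passRank_inj (hinj e) hx hy) hs i).trans hsS

end Pass

/-- The part of a set that lies on machine `i` when the set is stored in sorted order, with `s`
elements on each machine. -/
def chunk (B : Finset ℕ) (s i : ℕ) : Finset ℕ := B.filter fun x => rank B x / s = i

theorem mem_chunk {B : Finset ℕ} {s i x : ℕ} : x ∈ chunk B s i ↔ x ∈ B ∧ rank B x / s = i :=
  mem_filter

theorem card_chunk_le (B : Finset ℕ) {s : ℕ} (hs : 0 < s) (i : ℕ) : (chunk B s i).card ≤ s :=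
  card_filter_div_le B (rank B) (fun _ hx _ hy => rank_inj hx hy) hs i

/-- The leading digit decides, and the lower digits break ties. This is why stable passes from the
lowest digit upwards sort correctly. -/
theorem lt_or_eq_of_mod_pow_lt {F d x y : ℕ} (h : x % F ^ (d + 1) < y % F ^ (d + 1)) :
    x / F ^ d % F < y / F ^ d % F ∨
      (x / F ^ d % F = y / F ^ d % F ∧ x % F ^ d < y % F ^ d) := by
  rw [Nat.mod_pow_succ, Nat.mod_pow_succ] at h
  rcases lt_trichotomy (x / F ^ d % F) (y / F ^ d % F) with h1 | h1 | h1
  · exact .inl h1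
  · rw [h1] at h
    exact .inr ⟨h1, by omega⟩
  · exfalso
    rcases Nat.eq_zero_or_pos (F ^ d) with h0 | h0
    · simp [h0] at h h1
    · have h2 := Nat.mod_lt y h0
      have h3 : F ^ d * (y / F ^ d % F + 1) ≤ F ^ d * (x / F ^ d % F) := Nat.mul_le_mul_left _ h1
      rw [mul_add] at h3
      generalize x % F ^ d = a at *
      generalize y % F ^ d = b at *
      omega

/-- Radix sort. -/
theorem reach_sort {E : Type} {n F D S s u : ℕ} (A : E → Fin n → Finset ℕ)
    (hdisj : ∀ e i j x, x ∈ A e i → x ∈ A e j → i = j)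
    (hA : ∀ e i, ∀ x ∈ A e i, x < (n + 1) ^ u) (hAS : ∀ e i, (A e i).card ≤ S)
    (hs : 0 < s) (hsS : s ≤ S) (htot : ∀ e, (univ.biUnion (A e)).card ≤ n * s)
    (hF0 : 0 < F) (hF : 2 * F * F ≤ S) (hD : 0 < D) (hFD : n + 1 ≤ F ^ D) (hu : 0 < u) :
    Reach (2 * (u + 1)) S ((5 * (u + 1) + 4) * S) A (u * D * (D + 1))
      fun e i => chunk (univ.biUnion (A e)) s i := by
  classical
  let All : E → Finset ℕ := fun e => univ.biUnion (A e)
  have hAll : ∀ e x, x ∈ All e ↔ ∃ i, x ∈ A e i := fun e x => by simp [All]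
  have hlt : ∀ e, ∀ x ∈ All e, x < (n + 1) ^ u := fun e x hx => by
    obtain ⟨i, hi⟩ := (hAll e x).1 hx
    exact hA e i x hi
  have hpow : (n + 1) ^ u ≤ (n + 1) ^ (u + 1) := Nat.pow_le_pow_right (by omega) (by omega)
  let loc₀ : E → ℕ → ℕ := fun e x => if h : ∃ i, x ∈ A e i then (h.choose : ℕ) else 0
  have hloc₀ : ∀ e i x, x ∈ A e i → loc₀ e x = i := by
    intro e i x hx
    have h : ∃ i, x ∈ A e i := ⟨i, hx⟩
    simp only [loc₀, h, dif_pos]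
    exact congrArg _ (hdisj e _ _ x h.choose_spec hx)
  let g : ℕ → ℕ → Fin F := fun d x => ⟨x / F ^ d % F, Nat.mod_lt _ hF0⟩
  -- The initial ranks order the elements by machine and only then by value, so that they are
  -- compatible with the initial locations, as a pass requires.
  let ρ : ℕ → E → ℕ → ℕ := fun d => Nat.rec (fun e x => loc₀ e x * (n + 1) ^ u + x)
    (fun d r => passRank All r (g d)) d
  let loc : ℕ → E → ℕ → ℕ := fun d =>
    match d with
    | 0 => loc₀
    | d + 1 => fun e x => ρ (d + 1) e x / s
  have hρs : ∀ d e x, ρ (d + 1) e x = passRank All (ρ d) (g d) e x := fun d e x => rfl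
  have hloclt : ∀ e, ∀ x ∈ All e, loc₀ e x < n := fun e x hx => by
    obtain ⟨i, hi⟩ := (hAll e x).1 hx
    rw [hloc₀ e i x hi]; exact i.2
  have hcard : ∀ e, (All e).card < (n + 1) ^ (u + 1) := by
    intro e
    rcases Nat.eq_zero_or_pos n with h0 | h0
    · have : All e = ∅ := by
        subst h0
        exact eq_empty_of_forall_notMem fun x hx => ((hAll e x).1 hx).choose.elim0
      rw [this]; simp
    · have h1 : (All e).card ≤ (n + 1) ^ u := by
        have : All e ⊆ range ((n + 1) ^ u) := fun x hx => mem_range.2 (hlt e x hx)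
        simpa using card_le_card this
      exact lt_of_lt_of_le (Nat.lt_succ_of_le h1) (succ_pow_le n u h0)
  -- The invariant of radix sort: after `d` passes the ranks respect the order of the residues
  -- modulo `F ^ d`.
  have hinv : ∀ d, (∀ e, ∀ x ∈ All e, ρ d e x < (n + 1) ^ (u + 1)) ∧
      (∀ e, ∀ x ∈ All e, ∀ y ∈ All e, ρ d e x = ρ d e y → x = y) ∧
      (∀ e, ∀ x ∈ All e, ∀ y ∈ All e, x % F ^ d < y % F ^ d → ρ d e x < ρ d e y) := by
    intro d
    induction d with
    | zero =>
      refine ⟨?_, ?_, fun e x _ y _ h => by simp [Nat.mod_one] at h⟩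
      · intro e x hx
        have h1 := hloclt e x hx
        have h2 := hlt e x hx
        have h3 : (loc₀ e x + 1) * (n + 1) ^ u ≤ (n + 1) * (n + 1) ^ u :=
          Nat.mul_le_mul_right _ (by omega)
        change loc₀ e x * (n + 1) ^ u + x < _
        rw [pow_succ, mul_comm _ (n + 1)]
        rw [add_mul, one_mul] at h3
        omega
      · intro e x hx y hy h
        have h1 := congrArg (· % (n + 1) ^ u) h
        change (loc₀ e x * (n + 1) ^ u + x) % _ = (loc₀ e y * (n + 1) ^ u + y) % _ at h1
        rwa [Nat.mul_add_mod_of_lt (hlt e x hx), Nat.mul_add_mod_of_lt (hlt e y hy)] at h1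
    | succ d ih =>
      refine ⟨fun e x hx => (passRank_lt_card hx).trans (hcard e),
        fun e x hx y hy => passRank_inj (ih.2.1 e) hx hy, fun e x hx y hy h => ?_⟩
      refine passRank_lt_passRank hx ?_
      rcases lt_or_eq_of_mod_pow_lt h with h1 | ⟨h1, h2⟩
      · exact .inl h1
      · exact .inr ⟨Fin.ext h1, ih.2.2 e x hx y hy h2⟩
  have hloc : ∀ d, (∀ e, ∀ x ∈ All e, loc d e x < n) ∧
      (∀ e, ∀ x ∈ All e, ∀ y ∈ All e, ρ d e x < ρ d e y → loc d e x ≤ loc d e y) ∧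
      (∀ e (i : Fin n), ((All e).filter fun x => loc d e x = i).card ≤ S) := by
    intro d
    rcases d with _ | d
    · refine ⟨hloclt, fun e x hx y hy h => ?_, fun e i => (card_le_card fun x hx => ?_).trans (hAS e i)⟩
      · by_contra hlt'
        change loc₀ e x * (n + 1) ^ u + x < loc₀ e y * (n + 1) ^ u + y at h
        have h1 : (loc₀ e y + 1) * (n + 1) ^ u ≤ loc₀ e x * (n + 1) ^ u :=
          Nat.mul_le_mul_right _ (not_le.1 hlt')
        have h2 := hlt e y hy
        rw [add_mul, one_mul] at h1
        omega
      · obtain ⟨h1, h2⟩ := mem_filter.1 hx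
        obtain ⟨j, hj⟩ := (hAll e x).1 h1
        have h3 := hloc₀ e j x hj
        change loc₀ e x = i at h2
        have : i = j := Fin.ext (h2.symm.trans h3)
        rwa [this]
    · refine ⟨fun e x hx => ?_, fun e x hx y hy h => Nat.div_le_div_right h.le, fun e i => ?_⟩
      · exact (Nat.div_lt_iff_lt_mul hs).2 ((passRank_lt_card hx).trans_le (htot e))
      · exact (card_filter_div_le _ _ ((hinv (d + 1)).2.1 e) hs i).trans hsS
  have hreach : ∀ d, Reach (n := n) (2 * (u + 1)) S ((5 * (u + 1) + 4) * S) A (d * (D + 1))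
      (held All (loc d) (ρ d)) := by
    intro d
    induction d with
    | zero =>
      rw [zero_mul]
      refine .loc ?_ ((stored_held (fun e x hx => (hlt e x hx).trans_le hpow) (hinv 0).1
        (hloc 0).2.2).mono (Nat.mul_le_mul_right _ (by omega)))
      intro i e e' h
      have key : ∀ e e' : E, A e i = A e' i → ∀ p ∈ held All (loc 0) (ρ 0) e i,
          p ∈ held All (loc 0) (ρ 0) e' i := by
        intro e e' h p hp
        obtain ⟨h1, h2, h3⟩ := mem_held.1 hp
        obtain ⟨j, hj⟩ := (hAll e _).1 h1
        have h4 := hloc₀ e j _ hj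
        change loc₀ e p.1 = i at h2
        obtain rfl : i = j := Fin.ext (h2.symm.trans h4)
        rw [h] at hj
        have h5 := hloc₀ e' i _ hj
        refine mem_held.2 ⟨(hAll e' _).2 ⟨i, hj⟩, h5, h3.trans ?_⟩
        change loc₀ e p.1 * (n + 1) ^ u + p.1 = loc₀ e' p.1 * (n + 1) ^ u + p.1
        rw [h4, h5]
      exact Finset.ext fun p => ⟨key e e' h p, key e' e h.symm p⟩
    | succ d ih =>
      rw [Nat.succ_mul d]
      exact ih.trans (reach_pass (g d) (fun e x hx => (hlt e x hx).trans_le hpow) (hinv d).1 hcard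
        (hinv d).2.1 (hloc d).2.1 (hloc d).1 (hloc d).2.2 hs hsS
        ((Nat.le_succ n).trans hFD) hF)
  have huD : 0 < u * D := Nat.mul_pos hu hD
  obtain ⟨d, hd⟩ : ∃ d, u * D = d + 1 := ⟨u * D - 1, by omega⟩
  -- All elements have at most `u * D` digits in base `F`, so after `u * D` passes the residues are
  -- the elements themselves.
  have hbig : (n + 1) ^ u ≤ F ^ (d + 1) := by
    rw [← hd, mul_comm, pow_mul]
    exact Nat.pow_le_pow_left hFD u
  have hrank : ∀ e, ∀ x ∈ All e, ρ (d + 1) e x = rank (All e) x := by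
    intro e x hx
    rw [hρs, passRank, rank]
    refine congrArg card (Finset.ext fun y => ?_)
    simp only [mem_filter]
    refine and_congr_right fun hy => ?_
    have h1 := Nat.mod_eq_of_lt ((hlt e x hx).trans_le hbig)
    have h2 := Nat.mod_eq_of_lt ((hlt e y hy).trans_le hbig)
    have key : ∀ x ∈ All e, ∀ y ∈ All e, x < y →
        g d x < g d y ∨ (g d x = g d y ∧ ρ d e x < ρ d e y) := by
      intro x hx y hy h
      have h1 := Nat.mod_eq_of_lt ((hlt e x hx).trans_le hbig)
      have h2 := Nat.mod_eq_of_lt ((hlt e y hy).trans_le hbig)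
      rw [← h1, ← h2] at h
      rcases lt_or_eq_of_mod_pow_lt h with h1 | ⟨h1, h2⟩
      · exact .inl h1
      · exact .inr ⟨Fin.ext h1, (hinv d).2.2 e x hx y hy h2⟩
    constructor
    · intro h
      by_contra hyx
      rcases (not_lt.1 hyx).lt_or_eq with h3 | h3
      · rcases key x hx y hy h3 with h4 | ⟨h4, h5⟩ <;> rcases h with h6 | ⟨h6, h7⟩
        · exact lt_asymm h4 h6
        · exact h4.ne' h6
        · exact h6.ne' h4
        · exact lt_asymm h5 h7
      · subst h3
        rcases h with h6 | ⟨h6, h7⟩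
        · exact lt_irrefl _ h6
        · exact lt_irrefl _ h7
    · exact key y hy x hx
  rw [hd]
  refine (hreach (d + 1)).det_right fun i e e' h => ?_
  have key : ∀ e e' : E, held All (loc (d + 1)) (ρ (d + 1)) e i =
      held All (loc (d + 1)) (ρ (d + 1)) e' i →
          ∀ x ∈ chunk (All e) s i, x ∈ chunk (All e') s i := by
    intro e e' h x hx
    obtain ⟨h1, h2⟩ := mem_chunk.1 hx
    rw [← hrank e x h1] at h2
    obtain ⟨h3, h4, h5⟩ := held_eq h h1 h2
    refine mem_chunk.2 ⟨h3, ?_⟩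
    rw [← hrank e' x h3]
    exact h4
  exact Finset.ext fun x => ⟨key e e' h x, key e' e h.symm x⟩


/-! ## Dictionary lookup -/

/-- The answer to a query `x` for the dictionary that associates the weights `wt` with the
keys `a`. -/
def dictSum {n : ℕ} (a wt : Fin n → ℕ) (x : ℕ) : ℕ := ∑ j with a j ≤ x, wt j

/-- Queries to a dictionary that is spread over the machines are answered by sorting the queries
together with the entries of the dictionary. -/
theorem reach_lookup {E : Type} {n F D S s u : ℕ} (a wt : E → Fin n → ℕ)
    (Q : E → Fin n → Finset (ℕ × ℕ)) (hainj : ∀ e, Function.Injective (a e))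
    (ha : ∀ e i, a e i < (n + 1) ^ u) (hwt : ∀ e, ∑ i, wt e i < (n + 1) ^ u)
    (hQ1 : ∀ e i, ∀ p ∈ Q e i, p.1 < (n + 1) ^ u) (hQ2 : ∀ e i, ∀ p ∈ Q e i, p.2 < (n + 1) ^ u)
    (hdisj : ∀ e i j p, p ∈ Q e i → p ∈ Q e j → i = j) (hQS : ∀ e i, (Q e i).card + 1 ≤ S)
    (hsS : s + 1 ≤ S) (htot : ∀ e, (univ.biUnion (Q e)).card ≤ n * s)
    (hF0 : 0 < F) (hF : 2 * F * F ≤ S) (hD : 0 < D) (hFD : n + 1 ≤ F ^ D) :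
    ∃ loc : E → ℕ × ℕ → ℕ,
      (∀ e i, ((univ.biUnion (Q e)).filter fun p => loc e p = i).card ≤ s + 1) ∧
      (∀ e, ∀ p ∈ univ.biUnion (Q e), loc e p < n) ∧
      Reach (n := n) (4 * u + 4) S ((10 * u + 14) * S) (fun e i => (a e i, wt e i, Q e i))
        ((2 * u + 1) * D * (D + 1) + D)
        fun e i => ((univ.biUnion (Q e)).filter fun p => loc e p = i).image
          fun p => (p.1, p.2, dictSum (a e) (wt e) p.1) := by
  classical
  set B := (n + 1) ^ u with hB
  have hB0 : 0 < B := Nat.pow_pos (Nat.succ_pos n)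
  have hwt1 : ∀ e i, wt e i < B := fun e i =>
    lt_of_le_of_lt (single_le_sum (fun _ _ => Nat.zero_le _) (mem_univ i)) (hwt e)
  -- An entry with key `a` and a query for `x` become numbers with leading parts `a` and `x`. The
  -- trailing part is the weight, below `B`, for an entry, and `B` plus the tag for a query. Hence a
  -- query is sorted behind all entries with the same key, and the tag keeps equal queries apart.
  let dt : E → Fin n → ℕ := fun e j => 2 * B * a e j + wt e j
  let qt : ℕ × ℕ → ℕ := fun p => 2 * B * p.1 + (B + p.2)
  have hdiv : ∀ x y, y < 2 * B → (2 * B * x + y) / (2 * B) = x := by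
    intro x y hy
    rw [Nat.mul_add_div (by omega), Nat.div_eq_of_lt hy, add_zero]
  have hmod : ∀ x y, y < 2 * B → (2 * B * x + y) % (2 * B) = y := by
    intro x y hy
    rw [Nat.mul_add_mod, Nat.mod_eq_of_lt hy]
  have hd1 : ∀ e j, dt e j / (2 * B) = a e j := fun e j =>
    hdiv _ _ (by have := hwt1 e j; omega)
  have hd2 : ∀ e j, dt e j % (2 * B) = wt e j := fun e j =>
    hmod _ _ (by have := hwt1 e j; omega)
  have hq1 : ∀ p : ℕ × ℕ, p.2 < B → qt p / (2 * B) = p.1 := fun p hp => hdiv _ _ (by omega)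
  have hq2 : ∀ p : ℕ × ℕ, p.2 < B → qt p % (2 * B) = B + p.2 := fun p hp => hmod _ _ (by omega)
  let A : E → Fin n → Finset ℕ := fun e i => insert (dt e i) ((Q e i).image qt)
  let All : E → Finset ℕ := fun e => univ.biUnion (A e)
  let AllQ : E → Finset (ℕ × ℕ) := fun e => univ.biUnion (Q e)
  have hAllQ : ∀ e p, p ∈ AllQ e ↔ ∃ i, p ∈ Q e i := fun e p => by simp [AllQ]
  have hAllQ2 : ∀ e, ∀ p ∈ AllQ e, p.2 < B := fun e p hp => by
    obtain ⟨i, hi⟩ := (hAllQ e p).1 hp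
    exact hQ2 e i p hi
  have hmemA : ∀ e i z, z ∈ A e i ↔ z = dt e i ∨ ∃ p ∈ Q e i, qt p = z := fun e i z => by
    simp [A]
  have hmemAll : ∀ e z, z ∈ All e ↔ (∃ i, z = dt e i) ∨ ∃ p ∈ AllQ e, qt p = z := by
    intro e z
    simp only [All, mem_biUnion, mem_univ, true_and, hmemA, hAllQ]
    constructor
    · rintro ⟨i, h | ⟨p, hp, h⟩⟩
      · exact .inl ⟨i, h⟩
      · exact .inr ⟨p, ⟨i, hp⟩, h⟩
    · rintro (⟨i, h⟩ | ⟨p, ⟨i, hp⟩, h⟩)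
      · exact ⟨i, .inl h⟩
      · exact ⟨i, .inr ⟨p, hp, h⟩⟩
  have hqtinj : ∀ p p' : ℕ × ℕ, p.2 < B → p'.2 < B → qt p = qt p' → p = p' := by
    intro p p' hp hp' h
    have h1 := hq1 p hp
    have h2 := hq2 p hp
    rw [h, hq1 p' hp'] at h1
    rw [h, hq2 p' hp'] at h2
    exact Prod.ext h1.symm (by omega)
  have hAdisj : ∀ e i j x, x ∈ A e i → x ∈ A e j → i = j := by
    intro e i j x hi hj
    rcases (hmemA e i x).1 hi with rfl | ⟨p, hp, rfl⟩ <;>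
      rcases (hmemA e j _).1 hj with h | ⟨p', hp', h⟩
    · have h1 := hd1 e i
      rw [h, hd1] at h1
      exact hainj e h1.symm
    · have h1 := hd2 e i
      rw [← h, hq2 p' (hQ2 e j p' hp')] at h1
      have := hwt1 e i
      omega
    · have h1 := hq2 p (hQ2 e i p hp)
      rw [h, hd2] at h1
      have := hwt1 e j
      omega
    · have := hqtinj p' p (hQ2 e j p' hp') (hQ2 e i p hp) h
      subst this
      exact hdisj e i j p' hp hp'
  have hAlt : ∀ e (i : Fin n), ∀ x ∈ A e i, x < (n + 1) ^ (2 * u + 1) := by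
    intro e i x hx
    have h1 : 2 * B * B ≤ (n + 1) ^ (2 * u + 1) := by
      have := i.pos
      rw [pow_succ, two_mul u, pow_add, ← hB]
      calc 2 * B * B = B * B * 2 := by ring
        _ ≤ _ := Nat.mul_le_mul_left _ (by omega)
    refine lt_of_lt_of_le ?_ h1
    have h2 : ∀ y, y < B → 2 * B * y + 2 * B ≤ 2 * B * B := by
      intro y hy
      rw [← Nat.mul_succ]
      exact Nat.mul_le_mul_left _ hy
    rcases (hmemA e i x).1 hx with rfl | ⟨p, hp, rfl⟩
    · have h3 := h2 _ (ha e i)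
      have h4 := hwt1 e i
      simp only [dt]; omega
    · have h3 := h2 _ (hQ1 e i p hp)
      have h4 := hQ2 e i p hp
      simp only [qt]; omega
  have hAcard : ∀ e i, (A e i).card ≤ S := by
    intro e i
    refine (card_insert_le _ _).trans (le_trans ?_ (hQS e i))
    exact Nat.add_le_add_right card_image_le 1
  have hAllcard : ∀ e, (univ.biUnion (A e)).card ≤ n * (s + 1) := by
    intro e
    have hsub : univ.biUnion (A e) ⊆ (univ.image (dt e)) ∪ (AllQ e).image qt := by
      intro z hz
      rcases (hmemAll e z).1 hz with ⟨i, rfl⟩ | ⟨p, hp, rfl⟩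
      · exact mem_union_left _ (mem_image_of_mem _ (mem_univ i))
      · exact mem_union_right _ (mem_image_of_mem _ hp)
    refine (card_le_card hsub).trans ((card_union_le _ _).trans ?_)
    have h1 : (univ.image (dt e)).card ≤ n := card_image_le.trans (by simp)
    have h2 : ((AllQ e).image qt).card ≤ n * s := card_image_le.trans (htot e)
    rw [mul_add, mul_one]
    omega
  have hsort := reach_sort A hAdisj hAlt hAcard (Nat.succ_pos s) hsS hAllcard hF0 hF hD hFD
    (by omega)
  -- The weight of a token.
  let wg : ℕ → ℕ := fun z => if z % (2 * B) < B then z % (2 * B) else 0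
  have hwgd : ∀ e j, wg (dt e j) = wt e j := fun e j => by simp [wg, hd2, hwt1]
  have hwgq : ∀ p : ℕ × ℕ, p.2 < B → wg (qt p) = 0 := fun p hp => by simp [wg, hq2 p hp]
  have hdtinj : ∀ e, Function.Injective (dt e) := fun e i j h => by
    apply hainj e
    rw [← hd1, ← hd1, h]
  have hsumAll : ∀ e (r : ℕ → Prop) [DecidablePred r],
      ∑ z ∈ All e with r z, wg z = ∑ j with r (dt e j), wt e j := by
    intro e r _
    have h1 : ∑ z ∈ (univ.filter fun j => r (dt e j)).image (dt e), wg z =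
        ∑ j with r (dt e j), wt e j := by
      rw [sum_image fun i _ j _ h => hdtinj e h]
      simp only [hwgd]
    rw [← h1]
    symm
    refine sum_subset ?_ ?_
    · intro z hz
      simp only [mem_image, mem_filter, mem_univ, true_and] at hz ⊢
      obtain ⟨j, hj, rfl⟩ := hz
      exact ⟨(hmemAll e _).2 (.inl ⟨j, rfl⟩), hj⟩
    · intro z hz hz'
      simp only [mem_image, mem_filter, mem_univ, true_and, not_exists] at hz hz'
      rcases (hmemAll e z).1 hz.1 with ⟨j, rfl⟩ | ⟨p, hp, rfl⟩
      · exact absurd ⟨hz.2, rfl⟩ (hz' j)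
      · exact hwgq p (hAllQ2 e p hp)
  -- Queries weigh nothing, so the weight in front of a query is that of the entries with key at
  -- most `x`: the answer is a prefix sum over the sorted tokens.
  have hval : ∀ e, ∀ p ∈ AllQ e,
      ∑ z ∈ All e with z < qt p, wg z = dictSum (a e) (wt e) p.1 := by
    intro e p hp
    rw [hsumAll e (fun z => z < qt p), dictSum]
    refine sum_congr (filter_congr fun j _ => ?_) fun _ _ => rfl
    have h1 := hwt1 e j
    have h2 := hAllQ2 e p hp
    simp only [dt, qt]
    constructor
    · intro h
      by_contra hlt
      have : 2 * B * (p.1 + 1) ≤ 2 * B * a e j := Nat.mul_le_mul_left _ (not_le.1 hlt)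
      rw [mul_add] at this
      omega
    · intro h
      have : 2 * B * a e j ≤ 2 * B * p.1 := Nat.mul_le_mul_left _ h
      omega
  let c : E → Fin n → Fin 1 → ℕ := fun e i _ => ∑ z ∈ chunk (All e) (s + 1) i, wg z
  have hlocn : ∀ e, ∀ z ∈ All e, rank (All e) z / (s + 1) < n := fun e z hz =>
    (Nat.div_lt_iff_lt_mul (Nat.succ_pos s)).2 ((rank_lt_card hz).trans_le (hAllcard e))
  have hsumc : ∀ e (i : ℕ), ∑ j ∈ univ.filter (fun j : Fin n => (j : ℕ) < i),
      ∑ z ∈ chunk (All e) (s + 1) j, wg z =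
      ∑ z ∈ All e with rank (All e) z / (s + 1) < i, wg z := by
    intro e i
    rw [← sum_biUnion]
    · refine sum_congr ?_ fun _ _ => rfl
      ext z
      simp only [mem_biUnion, mem_filter, mem_univ, true_and, mem_chunk]
      exact ⟨fun ⟨j, h1, h2, h3⟩ => ⟨h2, h3 ▸ h1⟩, fun ⟨h1, h2⟩ => ⟨⟨_, hlocn e z h1⟩, h2, h1, rfl⟩⟩
    · intro i _ j _ hij
      rw [Function.onFun, disjoint_left]
      intro z h1 h2
      exact hij (Fin.ext ((mem_chunk.1 h1).2.symm.trans (mem_chunk.1 h2).2))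
  have hc : ∀ e φ, ∑ i, c e i φ < (n + 1) ^ u := by
    intro e φ
    refine lt_of_le_of_lt ?_ (hwt e)
    have h1 := hsumc e n
    rw [filter_true_of_mem (fun j _ => j.2)] at h1
    simp only [c]
    rw [h1, hsumAll e (fun z => rank (All e) z / (s + 1) < n)]
    exact sum_le_sum_of_subset (filter_subset _ _)
  have hF2 : 2 * F * 1 ≤ S := by nlinarith
  have hSt : Stored (n := n) ((2 * u + 1 + 1) * S) fun e i => chunk (All e) (s + 1) i := by
    refine Stored.finset (U := {x | x < (n + 1) ^ (2 * u + 1)}) (Small.range_lt _ fun a ha => ha)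
      (fun e i => (card_chunk_le _ (Nat.succ_pos s) _).trans hsS) ?_
    intro e i x hx
    obtain ⟨j, -, hj⟩ := mem_biUnion.1 (mem_chunk.1 hx).1
    exact hAlt e j x hj
  have hscan := ((reach_scan (D := D) ((Nat.le_succ n).trans hFD) c hc hF2).frame hSt).mono
    (show u ≤ 4 * u + 4 by omega) le_rfl (show _ ≤ (10 * u + 14) * S by nlinarith)
  have hscan' := hscan.det_left (X' := fun e i => chunk (All e) (s + 1) i) (by
    intro i e e' h
    simp only [Prod.mk.injEq]
    refine ⟨funext fun φ => ?_, h⟩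
    simp only [c, h])
  refine ⟨fun e p => rank (All e) (qt p) / (s + 1), ?_, ?_, ?_⟩
  · intro e i
    have := card_chunk_le (All e) (Nat.succ_pos s) i
    refine le_trans ?_ this
    refine card_le_card_of_injOn qt ?_ ?_
    · intro p hp
      obtain ⟨h1, h2⟩ := mem_filter.1 hp
      exact mem_chunk.2 ⟨(hmemAll e _).2 (.inr ⟨p, h1, rfl⟩), h2⟩
    · intro p hp p' hp' h
      exact hqtinj p p' (hAllQ2 e p (mem_filter.1 hp).1) (hAllQ2 e p' (mem_filter.1 hp').1) h
  · intro e p hp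
    exact hlocn e _ ((hmemAll e _).2 (.inr ⟨p, hp, rfl⟩))
  · refine (((hsort.mono (by omega) le_rfl (Nat.mul_le_mul_right _ (by omega))).trans
      hscan').det_left (X' := fun e i => (a e i, wt e i, Q e i)) ?_).det_right ?_
    · intro i e e' h
      simp only [Prod.mk.injEq] at h
      simp only [A, dt, h.1, h.2.1, h.2.2]
    · have key : ∀ (i : Fin n) (e e' : E), chunk (All e) (s + 1) i = chunk (All e') (s + 1) i →
          ∑ j with j < i, c e j 0 = ∑ j with j < i, c e' j 0 →
          ∀ r ∈ ((AllQ e).filter fun p => rank (All e) (qt p) / (s + 1) = i).image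
            (fun p => (p.1, p.2, dictSum (a e) (wt e) p.1)),
          r ∈ ((AllQ e').filter fun p => rank (All e') (qt p) / (s + 1) = i).image
            (fun p => (p.1, p.2, dictSum (a e') (wt e') p.1)) := by
        intro i e e' h1 h2 r hr
        obtain ⟨p, hp, rfl⟩ := mem_image.1 hr
        obtain ⟨hp1, hp2⟩ := mem_filter.1 hp
        have h3 : qt p ∈ chunk (All e') (s + 1) i := by
          rw [← h1]
          exact mem_chunk.2 ⟨(hmemAll e _).2 (.inr ⟨p, hp1, rfl⟩), hp2⟩
        obtain ⟨h4, h5⟩ := mem_chunk.1 h3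
        have h6 : p ∈ AllQ e' := by
          rcases (hmemAll e' _).1 h4 with ⟨j, h7⟩ | ⟨p', hp', h7⟩
          · have h8 := hq2 p (hAllQ2 e p hp1)
            rw [h7, hd2] at h8
            have := hwt1 e' j
            omega
          · rwa [← hqtinj p' p (hAllQ2 e' p' hp') (hAllQ2 e p hp1) h7]
        -- The tokens in front of a query are those on earlier machines, known from the scan, and
        -- the smaller ones in the machine's own chunk.
        have hsplit : ∀ e, qt p ∈ All e → rank (All e) (qt p) / (s + 1) = i →
            ∑ z ∈ All e with z < qt p, wg z = ∑ j with j < i, c e j 0 +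
              ∑ z ∈ chunk (All e) (s + 1) i with z < qt p, wg z := by
          intro e hqA hqi
          have h9 := hsumc e i
          simp only [Fin.val_fin_lt] at h9
          simp only [c]
          rw [h9, ← sum_union]
          · refine sum_congr ?_ fun _ _ => rfl
            ext z
            simp only [mem_union, mem_filter, mem_chunk]
            constructor
            · rintro ⟨k1, k2⟩
              have k3 := Nat.div_le_div_right (c := s + 1) (rank_mono (All e) k2.le)
              rw [hqi] at k3
              rcases k3.lt_or_eq with k3 | k3
              · exact .inl ⟨k1, k3⟩
              · exact .inr ⟨⟨k1, k3⟩, k2⟩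
            · rintro (⟨k1, k2⟩ | ⟨⟨k1, -⟩, k2⟩)
              · refine ⟨k1, ?_⟩
                by_contra k3
                have k4 := Nat.div_le_div_right (c := s + 1) (rank_mono (All e) (not_lt.1 k3))
                rw [hqi] at k4
                omega
              · exact ⟨k1, k2⟩
          · rw [disjoint_left]
            intro z k1 k2
            simp only [mem_filter, mem_chunk] at k1 k2
            omega
        refine mem_image.2 ⟨p, mem_filter.2 ⟨h6, h5⟩, ?_⟩
        rw [← hval e' p h6, ← hval e p hp1, hsplit e' h4 h5,
          hsplit e ((hmemAll e _).2 (.inr ⟨p, hp1, rfl⟩)) hp2, h1, h2]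
      intro i e e' h
      simp only [Prod.mk.injEq] at h
      obtain ⟨⟨-, h2, -⟩, h3⟩ := h
      have h4 := congrFun h2 0
      exact Finset.ext fun r => ⟨key i e e' h3 h4 r, key i e' e h3.symm h4.symm r⟩


/-! ### Renaming vertices and the canonical input representation -/

namespace NCCStar

variable {n k : ℕ} {G H : SimpleGraph (Fin n)}

theorem Input.portOf_eq_some (I : Input k G) {v : Fin n} {x p : ℕ} :
    I.portOf v x = some p ↔ ∃ h : p < deg G v, (I.ident (I.ports v ⟨p, h⟩) : ℕ) = x := by
  unfold Input.portOf
  split_ifs with h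
  · rw [Option.some.injEq]
    constructor
    · rintro rfl
      exact ⟨h.choose.2, h.choose_spec⟩
    · rintro ⟨hp, h'⟩
      have h1 := I.ident.injective (Fin.ext (h.choose_spec.trans h'.symm))
      have h2 := (I.ports v).injective (Subtype.ext h1)
      rw [h2]
  · constructor
    · intro h'; cases h'
    · rintro ⟨hp, h'⟩
      exact absurd ⟨_, h'⟩ h

theorem Input.resolve_node_eq_some (I : Input k G) {v u : Fin n} {x : ℕ} :
    I.resolve v (Dest.node x) = some u ↔ (I.ident u : ℕ) = x := by
  simp only [Input.resolve]
  split_ifs with h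
  · rw [Option.some.injEq]
    constructor
    · rintro rfl
      exact h.choose_spec
    · intro h'
      exact I.ident.injective (Fin.ext (h.choose_spec.trans h'.symm))
  · constructor
    · intro h'; cases h'
    · intro h'; exact absurd ⟨_, h'⟩ h

theorem Input.resolve_port_eq_some (I : Input k G) {v u : Fin n} {p : ℕ} :
    I.resolve v (Dest.port p) = some u ↔
      ∃ h : p < deg G v, (I.ports v ⟨p, h⟩ : Fin n) = u := by
  simp only [Input.resolve]
  split_ifs with h <;> simp [h]

/-- Two input representations that differ only in the names of the vertices of the graph. -/
structure Similar (σ : Equiv.Perm (Fin n)) (J : Input k H) (I : Input k G) : Prop where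
  ident : ∀ j, I.ident (σ j) = J.ident j
  deg : ∀ j, deg G (σ j) = deg H j
  portOf : ∀ j x, I.portOf (σ j) x = J.portOf j x
  resolve : ∀ j d, I.resolve (σ j) d = (J.resolve j d).map σ

/-- The same configuration under other names of the vertices. -/
def Config.comap (σ : Equiv.Perm (Fin n)) (c : Config n) : Config n :=
  ⟨fun j => c.mem (σ j), fun j => c.inbox (σ j), fun j => c.known (σ j)⟩

section Similar

variable {σ : Equiv.Perm (Fin n)} {J : Input k H} {I : Input k G}
  (A : NCCStarAlgorithm)

theorem Similar.lookup (h : Similar σ J I) (c : Config n) (j : Fin n) :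
    lookup J (c.comap σ) j = lookup I c (σ j) := by
  funext x
  simp only [NCCStar.lookup, h.portOf]
  rfl

theorem Similar.act (h : Similar σ J I) (c : Config n) (j : Fin n) :
    act A J (c.comap σ) j = act A I c (σ j) := by
  simp only [NCCStar.act, h.lookup, h.ident, h.deg]
  rfl

theorem Similar.resolve_iff (h : Similar σ J I) (u v : Fin n) (d : Dest) :
    I.resolve (σ u) d = some (σ v) ↔ J.resolve u d = some v := by
  rw [h.resolve]
  cases J.resolve u d <;> simp

theorem Similar.delivered (h : Similar σ J I) (c : Config n) (j : Fin n) :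
    delivered A J (c.comap σ) j = delivered A I c (σ j) := by
  simp only [NCCStar.delivered]
  refine Eq.trans (sum_congr rfl fun u _ => ?_) (Equiv.sum_comp σ _)
  simp only [h.act A, h.resolve_iff, h.ident]

theorem Similar.learned (h : Similar σ J I) (c : Config n) (j : Fin n) :
    learned A J (c.comap σ) j = learned A I c (σ j) := by
  ext x
  simp only [NCCStar.learned, Set.mem_ofPred_eq]
  refine Iff.trans ?_ σ.surjective.exists.symm
  simp only [h.act A, h.resolve_iff, h.ident]
  rfl

theorem Similar.run (h : Similar σ J I) (t : ℕ) : run A J t = (run A I t).comap σ := by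
  induction t with
  | zero =>
    simp only [NCCStar.run, Function.iterate_zero, id, NCCStar.start, Config.comap, h.ident, h.deg]
  | succ t ih =>
    simp only [NCCStar.run, Function.iterate_succ_apply'] at ih ⊢
    rw [ih]
    simp only [NCCStar.next, h.act A, h.delivered A, h.learned A]
    rfl

theorem Similar.out (h : Similar σ J I) (T : ℕ) (j : Fin n) : out A J T j = out A I T (σ j) := by
  simp only [NCCStar.out, h.run A, h.lookup, h.ident, h.deg]
  rfl

theorem Similar.memoryOK (h : Similar σ J I) {κ C t : ℕ} (hm : MemoryOK κ C (NCCStar.run A I t)) :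
    MemoryOK κ C (NCCStar.run A J t) := by
  rw [h.run A]
  exact fun j => hm (σ j)

theorem Similar.roundOK (h : Similar σ J I) {κ C t : ℕ} (hm : RoundOK A I κ C (NCCStar.run A I t)) :
    RoundOK A J κ C (NCCStar.run A J t) := by
  rw [h.run A]
  intro j
  have := hm (σ j)
  simp only [h.act A, h.delivered A]
  refine ⟨this.1, fun m hmm => ?_, this.2.2⟩
  obtain ⟨h1, h2, h3, h4⟩ := this.2.1 m hmm
  refine ⟨h1, h2, ?_, h4⟩
  rw [h.resolve] at h3
  simpa using h3

end Similar

/-- The neighbours of `j`, as numbers. -/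
def nbrs (H : SimpleGraph (Fin n)) (j : Fin n) : Finset ℕ :=
  (Set.toFinite (H.neighborSet j)).toFinset.map Fin.valEmbedding

theorem mem_nbrs {j : Fin n} {x : ℕ} : x ∈ nbrs H j ↔ ∃ u : Fin n, H.Adj j u ∧ (u : ℕ) = x := by
  simp [nbrs]

theorem val_mem_nbrs {j u : Fin n} : (u : ℕ) ∈ nbrs H j ↔ H.Adj j u := by
  rw [mem_nbrs]
  exact ⟨fun ⟨v, h1, h2⟩ => Fin.ext h2 ▸ h1, fun h => ⟨u, h, rfl⟩⟩

theorem card_nbrs (j : Fin n) : (nbrs H j).card = deg H j := by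
  rw [nbrs, card_map, deg, Set.ncard_eq_toFinset_card]

/-- The ports of the canonical input representation number the neighbours in increasing order. -/
def sortedPort (H : SimpleGraph (Fin n)) (j : Fin n) (u : H.neighborSet j) : Fin (deg H j) :=
  ⟨rank (nbrs H j) (u : Fin n), by
    rw [← card_nbrs]
    exact rank_lt_card (val_mem_nbrs.2 u.2)⟩

theorem sortedPort_bijective (j : Fin n) : Function.Bijective (sortedPort H j) := by
  classical
  have hinj : Function.Injective (sortedPort H j) := by
    intro u v huv
    exact Subtype.ext (Fin.ext (rank_inj (val_mem_nbrs.2 u.2) (val_mem_nbrs.2 v.2)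
      (Fin.mk.inj huv)))
  refine (Fintype.bijective_iff_injective_and_card _).2 ⟨hinj, ?_⟩
  rw [Fintype.card_fin, deg, Set.ncard_eq_toFinset_card', Set.toFinset_card]

/-- The canonical input representation: every vertex is its own identifier, and the ports number
the neighbours in increasing order. -/
def canon (hk : 1 ≤ k) (H : SimpleGraph (Fin n)) : Input k H where
  ident := ⟨fun j => ⟨j, j.2.trans_le (by
      calc n ≤ (n + 1) ^ 1 := by simp
        _ ≤ (n + 1) ^ k := Nat.pow_le_pow_right (by omega) hk)⟩,
    fun i j h => Fin.ext (Fin.mk.inj h)⟩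
  ports j := (Equiv.ofBijective _ (sortedPort_bijective j)).symm

@[simp] theorem canon_ident (hk : 1 ≤ k) (j : Fin n) : ((canon hk H).ident j : ℕ) = j := rfl

/-- With ports in increasing order of the neighbours, port numbers are ranks in the adjacency list
and can be read off positions in a sorted array. -/
theorem canon_ports (hk : 1 ≤ k) {j u : Fin n} {p : ℕ} :
    (∃ h : p < deg H j, ((canon hk H).ports j ⟨p, h⟩ : Fin n) = u) ↔
      H.Adj j u ∧ p = rank (nbrs H j) u := by
  constructor
  · rintro ⟨h, rfl⟩
    refine ⟨((canon hk H).ports j ⟨p, h⟩).2, ?_⟩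
    have := Equiv.apply_symm_apply (Equiv.ofBijective _ (sortedPort_bijective (H := H) j)) ⟨p, h⟩
    exact (Fin.mk.inj this).symm
  · rintro ⟨h, rfl⟩
    refine ⟨(sortedPort H j ⟨u, h⟩).2, ?_⟩
    exact congrArg Subtype.val
      (Equiv.symm_apply_apply (Equiv.ofBijective _ (sortedPort_bijective (H := H) j)) ⟨u, h⟩)

theorem canon_portOf (hk : 1 ≤ k) {j : Fin n} {x p : ℕ} :
    (canon hk H).portOf j x = some p ↔ x ∈ nbrs H j ∧ p = rank (nbrs H j) x := by
  rw [Input.portOf_eq_some, mem_nbrs]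
  constructor
  · rintro ⟨h, rfl⟩
    obtain ⟨h1, h2⟩ := (canon_ports hk).1 ⟨h, rfl⟩
    exact ⟨⟨_, h1, rfl⟩, h2⟩
  · rintro ⟨⟨u, h1, rfl⟩, h2⟩
    obtain ⟨h, h3⟩ := (canon_ports hk).2 ⟨h1, h2⟩
    exact ⟨h, by rw [h3]; rfl⟩

theorem canon_resolve_port (hk : 1 ≤ k) {j u : Fin n} {p : ℕ} :
    (canon hk H).resolve j (Dest.port p) = some u ↔ H.Adj j u ∧ p = rank (nbrs H j) u := by
  rw [Input.resolve_port_eq_some, canon_ports]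

theorem canon_resolve_node (hk : 1 ≤ k) {j u : Fin n} {x : ℕ} :
    (canon hk H).resolve j (Dest.node x) = some u ↔ (u : ℕ) = x :=
  Input.resolve_node_eq_some _

/-- Every input representation can be transported along a renaming of the vertices. -/
theorem exists_similar (σ : Equiv.Perm (Fin n)) (J : Input k (G.comap σ)) :
    ∃ I : Input k G, Similar σ J I := by
  have hdeg : ∀ v, deg G v = deg (G.comap σ) (σ.symm v) := by
    intro v
    have : (G.comap σ).neighborSet (σ.symm v) = σ ⁻¹' G.neighborSet v := by
      ext u; simp
    rw [deg, deg, this, Set.ncard_preimage_of_injective_subset_range σ.injective (by simp)]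
  let e : ∀ v, (G.comap σ).neighborSet (σ.symm v) ≃ G.neighborSet v := fun v =>
    σ.subtypeEquiv fun u => by simp
  let I : Input k G :=
    { ident := ⟨fun v => J.ident (σ.symm v), J.ident.injective.comp σ.symm.injective⟩
      ports := fun v => (finCongr (hdeg v)).trans ((J.ports (σ.symm v)).trans (e v)) }
  have hports : ∀ j p (h : p < deg G (σ j)) (h' : p < deg (G.comap σ) j),
      (I.ports (σ j) ⟨p, h⟩ : Fin n) = σ (J.ports j ⟨p, h'⟩) := by
    intro j p h h'
    have hj : σ.symm (σ j) = j := σ.symm_apply_apply j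
    change σ (J.ports (σ.symm (σ j)) ⟨p, _⟩) = _
    congr 1
    have : ∀ i (hi : i = j) (h1 : p < deg (G.comap σ) i),
        (J.ports i ⟨p, h1⟩ : Fin n) = J.ports j ⟨p, h'⟩ := by
      rintro i rfl h1; rfl
    exact this _ hj _
  have hdeg' : ∀ j, deg G (σ j) = deg (G.comap σ) j := fun j => by
    rw [hdeg, σ.symm_apply_apply]
  have hid : ∀ j, I.ident (σ j) = J.ident j := fun j => by
    change J.ident (σ.symm (σ j)) = _
    rw [σ.symm_apply_apply]
  refine ⟨I, hid, hdeg', ?_, ?_⟩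
  · intro j x
    ext p
    rw [Input.portOf_eq_some, Input.portOf_eq_some]
    constructor
    · rintro ⟨h, h1⟩
      have h' : p < deg (G.comap σ) j := hdeg' j ▸ h
      rw [hports j p h h', hid] at h1
      exact ⟨h', h1⟩
    · rintro ⟨h', h1⟩
      have h : p < deg G (σ j) := (hdeg' j).symm ▸ h'
      exact ⟨h, by rw [hports j p h h', hid]; exact h1⟩
  · intro j d
    ext v
    rw [Option.map_eq_some_iff]
    cases d with
    | port p =>
      rw [Input.resolve_port_eq_some]
      constructor
      · rintro ⟨h, h1⟩
        have h' : p < deg (G.comap σ) j := hdeg' j ▸ h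
        rw [hports j p h h'] at h1
        exact ⟨_, (Input.resolve_port_eq_some J).2 ⟨h', rfl⟩, h1⟩
      · rintro ⟨u, h1, rfl⟩
        obtain ⟨h', rfl⟩ := (Input.resolve_port_eq_some J).1 h1
        exact ⟨(hdeg' j).symm ▸ h', hports j p _ h'⟩
    | node x =>
      rw [Input.resolve_node_eq_some]
      constructor
      · intro h1
        refine ⟨σ.symm v, (Input.resolve_node_eq_some J).2 ?_, σ.apply_symm_apply v⟩
        exact h1
      · rintro ⟨u, h1, rfl⟩
        rw [hid]
        exact (Input.resolve_node_eq_some J).1 h1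

end NCCStar

/-- The algorithm violates no constraint on the canonical representation of the graph `H`. -/
structure GoodRun {n k : ℕ} (hk : 1 ≤ k) (A : NCCStarAlgorithm) (κ C T : ℕ)
    (H : SimpleGraph (Fin n)) : Prop where
  memory : ∀ t ≤ T, NCCStar.MemoryOK κ C (NCCStar.run A (NCCStar.canon hk H) t)
  round : ∀ t < T, NCCStar.RoundOK A (NCCStar.canon hk H) κ C
    (NCCStar.run A (NCCStar.canon hk H) t)
  out : ∀ j, (NCCStar.out A (NCCStar.canon hk H) T j).length ≤ C ∧
    ∀ x ∈ NCCStar.out A (NCCStar.canon hk H) T j, IsWord κ n (tokenValue x)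

/-- The relabelled graph need not be an instance of the problem, so correctness is invoked for `G`
itself, on the representation obtained by transporting the canonical one along `σ`. Both runs agree
up to the names of the vertices. The solution is legal for `G` because legality ignores the
representation. -/
theorem NCCStar.Correct.goodRun {n k κ C T : ℕ} (hk : 1 ≤ k) {G : SimpleGraph (Fin n)}
    {A : NCCStarAlgorithm} {P : UnlabeledGraphProblem}
    (h : ∀ I : NCCStar.Input k G, NCCStar.Correct A κ C T P I) (σ : Equiv.Perm (Fin n)) :
    GoodRun hk A κ C T (G.comap σ) ∧ ∃ s : Solution n, P.IsLegal G s ∧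
      ∀ j, NCCStar.out A (NCCStar.canon hk (G.comap σ)) T j =
        (s (σ j)).map (Sum.map (fun v => ((σ.symm v : Fin n) : ℕ)) id) := by
  obtain ⟨I, hI⟩ := NCCStar.exists_similar σ (NCCStar.canon hk (G.comap σ))
  obtain ⟨h1, h2, h3, s, hs, h4⟩ := h I
  refine ⟨⟨fun t ht => hI.memoryOK A (h1 t ht), fun t ht => hI.roundOK A (h2 t ht), fun j => ?_⟩,
    s, hs, fun j => ?_⟩
  · rw [hI.out A]; exact h3 _
  · rw [hI.out A, h4, encode]
    congr 1
    have : ∀ v, ((I.ident v : ℕ)) = ((σ.symm v : Fin n) : ℕ) := by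
      intro v
      have := hI.ident (σ.symm v)
      rw [σ.apply_symm_apply] at this
      rw [this]; rfl
    simp only [this]


/-! ### Arboricity bounds the number of edges -/

theorem isAcyclic_fromEdgeSet_singleton {V : Type} (e : Sym2 V) :
    (SimpleGraph.fromEdgeSet {e}).IsAcyclic := by
  induction e with
  | _ u v =>
    have h := SimpleGraph.isAcyclic_sup_fromEdgeSet_iff (G := (⊥ : SimpleGraph V)) (u := u) (v := v)
    rw [bot_sup_eq] at h
    refine h.2 ⟨SimpleGraph.isAcyclic_bot, fun hr => ?_⟩
    rw [SimpleGraph.reachable_bot] at hr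
    exact Or.inl hr

/-- The infimum is attained, because the single edges form a decomposition into forests and so the
set is not empty. -/
theorem arboricity_mem {n : ℕ} (G : SimpleGraph (Fin n)) :
    ∃ F : Fin (arboricity G) → SimpleGraph (Fin n), (∀ i, (F i).IsAcyclic) ∧ ⨆ i, F i = G := by
  classical
  have hne : {k : ℕ | ∃ F : Fin k → SimpleGraph (Fin n), (∀ i, (F i).IsAcyclic) ∧
      (Pairwise fun i j => Disjoint (F i) (F j)) ∧ ⨆ i, F i = G}.Nonempty := by
    let e := G.edgeFinset.equivFin
    refine ⟨G.edgeFinset.card, fun i => SimpleGraph.fromEdgeSet {(e.symm i : Sym2 (Fin n))},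
      fun i => isAcyclic_fromEdgeSet_singleton _, ?_, ?_⟩
    · intro i j hij
      rw [SimpleGraph.fromEdgeSet_disjoint]
      rw [Set.disjoint_left]
      intro x hx hx'
      simp only [SimpleGraph.edgeSet_fromEdgeSet, Set.mem_sdiff, Set.mem_singleton_iff] at hx hx'
      exact hij (e.symm.injective (Subtype.ext (hx.symm.trans hx'.1)))
    · ext u v
      simp only [SimpleGraph.iSup_adj, SimpleGraph.fromEdgeSet_adj, Set.mem_singleton_iff]
      constructor
      · rintro ⟨i, hi, -⟩
        rw [← SimpleGraph.mem_edgeSet, ← SimpleGraph.mem_edgeFinset, hi]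
        exact (e.symm i).2
      · intro h
        refine ⟨e ⟨s(u, v), by simpa using h⟩, ?_, h.ne⟩
        rw [e.symm_apply_apply]
  obtain ⟨F, h1, -, h2⟩ := Nat.sInf_mem hne
  exact ⟨F, h1, h2⟩

open Classical in
-- A forest extends to a spanning tree of the complete graph.
theorem card_edgeFinset_le_of_isAcyclic {n : ℕ} {F : SimpleGraph (Fin n)} (h : F.IsAcyclic) :
    F.edgeFinset.card ≤ n := by
  rcases Nat.eq_zero_or_pos n with rfl | hn
  · have : F.edgeFinset = ∅ := by
      refine eq_empty_of_forall_notMem fun e _ => ?_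
      induction e with
      | _ u v => exact u.elim0
    simp [this]
  · have : Nonempty (Fin n) := ⟨⟨0, hn⟩⟩
    obtain ⟨T, hT1, hT2, hT3⟩ := SimpleGraph.Connected.exists_isTree_le_of_le_of_isAcyclic
      (G := (⊤ : SimpleGraph (Fin n))) (H := F) SimpleGraph.connected_top le_top h
    have h1 := hT3.card_edgeFinset
    have h2 : F.edgeFinset.card ≤ T.edgeFinset.card :=
      card_le_card (SimpleGraph.edgeFinset_mono hT1)
    rw [Fintype.card_fin] at h1
    omega

/-- Handshake lemma, after the observation that relabelling permutes the degrees. -/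
theorem sum_card_nbrs_le {n : ℕ} (G : SimpleGraph (Fin n)) (σ : Equiv.Perm (Fin n)) :
    ∑ j, (NCCStar.nbrs (G.comap σ) j).card ≤ 2 * arboricity G * n := by
  classical
  obtain ⟨F, h1, h2⟩ := arboricity_mem G
  have h3 : ∑ j, (NCCStar.nbrs (G.comap σ) j).card = 2 * G.edgeFinset.card := by
    rw [← G.sum_degrees_eq_twice_card_edges]
    refine Eq.trans (sum_congr rfl fun j _ => ?_) (Equiv.sum_comp σ _)
    rw [NCCStar.nbrs, card_map, ← SimpleGraph.card_neighborFinset_eq_degree]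
    refine card_bij (fun u _ => σ u) ?_ (fun u _ v _ h => σ.injective h) ?_
    · intro u hu; simpa using hu
    · intro v hv
      exact ⟨σ.symm v, by simpa using hv, by simp⟩
  have h4 : G.edgeFinset ⊆ univ.biUnion fun i => (F i).edgeFinset := by
    intro e he
    induction e with
    | _ u v =>
      rw [SimpleGraph.mem_edgeFinset, SimpleGraph.mem_edgeSet, ← h2, SimpleGraph.iSup_adj] at he
      obtain ⟨i, hi⟩ := he
      exact mem_biUnion.2 ⟨i, mem_univ i, by simpa using hi⟩
  have h5 : G.edgeFinset.card ≤ arboricity G * n := by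
    refine (card_le_card h4).trans (card_biUnion_le.trans ?_)
    refine (sum_le_sum fun i _ => card_edgeFinset_le_of_isAcyclic (h1 i)).trans ?_
    simp
  rw [h3, mul_assoc]
  exact Nat.mul_le_mul_left 2 h5


/-! ## Sorting the vertices and the edges -/

variable {E : Type} {n : ℕ}

/-- The form of `Reach.frame` in which the input of the computation and the data kept aside are both
obtained from the same initial data. -/
theorem Reach.keep {α α' β δ : Type} {w S b b' L : ℕ} {X : E → Fin n → α} {X' : E → Fin n → α'}
    {Y : E → Fin n → β} {R : E → Fin n → δ} (h : Reach w S b X L Y) (hR : Stored b' R)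
    (hX : Det X' X) (hXR : Det X' R) :
    Reach w S (b + b') X' L fun e i => (Y e i, R e i) :=
  (h.frame hR).det_left fun i e e' h' => Prod.ext (hX i e e' h') (hXR i e e' h')

/-- Idle rounds; they allow round numbers to be rounded up to convenient expressions. -/
theorem Reach.pad {α β : Type} {w S b L L' : ℕ} {X : E → Fin n → α} {Y : E → Fin n → β}
    (h : Reach w S b X L Y) (hL : L ≤ L') : Reach w S b X L' Y := by
  induction L', hL using Nat.le_induction with
  | base => exact h
  | succ L' _ ih =>
    refine .round (μ := ℕ) (M := fun _ _ _ => []) ih ⟨?_, fun _ _ _ _ => rfl, ?_, ?_⟩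
      (fun i e e' h => (Prod.mk.inj h).1) h.stored
    · exact Small.range_lt _ fun a ⟨_, _, _, ha⟩ => absurd ha List.not_mem_nil
    · simp
    · simp

theorem rank_image {f : Fin n → ℕ} (hf : StrictMono f) (i : Fin n) :
    rank (univ.image f) (f i) = i := by
  have : (univ.image f).filter (· < f i) = (Iio i).image f := by
    ext x
    simp only [mem_filter, mem_image, mem_univ, true_and, mem_Iio]
    constructor
    · rintro ⟨⟨j, rfl⟩, h⟩
      exact ⟨j, hf.lt_iff_lt.1 h, rfl⟩
    · rintro ⟨j, h, rfl⟩
      exact ⟨⟨j, rfl⟩, hf h⟩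
  rw [rank, this, card_image_of_injective _ hf.injective, Fin.card_Iio]

theorem image_rank (B : Finset ℕ) : B.image (rank B) = range B.card := by
  refine eq_of_subset_of_card_le ?_ ?_
  · intro x hx
    obtain ⟨y, hy, rfl⟩ := mem_image.1 hx
    exact mem_range.2 (rank_lt_card hy)
  · rw [card_range, card_image_of_injOn fun x hx y hy h => rank_inj hx hy h]

theorem card_filter_rank_lt {B : Finset ℕ} {m : ℕ} (hm : m ≤ B.card) :
    (B.filter fun y => rank B y < m).card = m := by
  have h : (B.filter fun y => rank B y < m).image (rank B) = range m := by
    ext x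
    simp only [mem_image, mem_filter, mem_range]
    constructor
    · rintro ⟨y, ⟨-, h⟩, rfl⟩; exact h
    · intro hx
      have : x ∈ B.image (rank B) := by
        rw [image_rank]; exact mem_range.2 (hx.trans_le hm)
      obtain ⟨y, hy, rfl⟩ := mem_image.1 this
      exact ⟨y, ⟨hy, hx⟩, rfl⟩
  have h2 : ((B.filter fun y => rank B y < m).image (rank B)).card =
      (B.filter fun y => rank B y < m).card := card_image_of_injOn fun x hx y hy h =>
    rank_inj (mem_filter.1 hx).1 (mem_filter.1 hy).1 h
  rw [← h2, h, card_range]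

/-- Exactly `s * i` elements lie in front of a non-empty chunk `i`. So a machine computes the global
ranks of its elements without communication. -/
theorem rank_eq_of_mem_chunk {B : Finset ℕ} {s i x : ℕ} (hs : 0 < s) (hx : x ∈ chunk B s i) :
    rank B x = s * i + rank (chunk B s i) x := by
  obtain ⟨h1, h2⟩ := mem_chunk.1 hx
  have h3 : s * i ≤ rank B x := by rw [← h2]; exact Nat.mul_div_le _ _
  rw [← card_filter_rank_lt (h3.trans (rank_lt_card h1).le)]
  unfold rank at h3
  change (B.filter fun y => y < x).card = (B.filter fun y => rank B y < s * i).card +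
    ((chunk B s i).filter fun y => y < x).card
  rw [← card_union_of_disjoint]
  · congr 1
    ext y
    simp only [mem_filter, mem_union, mem_chunk]
    constructor
    · rintro ⟨h4, h5⟩
      have h6 := Nat.div_le_div_right (c := s) (rank_mono B h5.le)
      rw [h2] at h6
      rcases h6.lt_or_eq with h6 | h6
      · left
        exact ⟨h4, by rw [mul_comm]; exact (Nat.div_lt_iff_lt_mul hs).1 h6⟩
      · exact .inr ⟨⟨h4, h6⟩, h5⟩
    · rintro (⟨h4, h5⟩ | ⟨⟨h4, -⟩, h5⟩)
      · refine ⟨h4, ?_⟩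
        by_contra h6
        have := rank_mono B (not_lt.1 h6)
        change s * i ≤ rank B x at h3
        omega
      · exact ⟨h4, h5⟩
  · rw [disjoint_left]
    intro y h4 h5
    simp only [mem_filter, mem_chunk] at h4 h5
    change y ∈ B ∧ rank B y < s * i at h4
    change (y ∈ B ∧ rank B y / s = i) ∧ y < x at h5
    have h6 := h5.1.2
    have h7 : rank B y / s < i := (Nat.div_lt_iff_lt_mul hs).2 (by rw [mul_comm]; exact h4.2)
    omega

/-- The differences of consecutive values. -/
def gap (f : Fin n → ℕ) (i : Fin n) : ℕ :=
  f i - if h : 0 < (i : ℕ) then f ⟨i - 1, by omega⟩ else 0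

/-- The sum telescopes. Weights that are consecutive differences turn the prefix sums of a
dictionary query into plain access to the array `f`. -/
theorem dictSum_gap {f : Fin n → ℕ} (hf : Monotone f) (x : ℕ) (hx : x < n) :
    dictSum (fun j : Fin n => (j : ℕ)) (gap f) x = f ⟨x, hx⟩ := by
  induction x with
  | zero =>
    have : (univ.filter fun j : Fin n => (j : ℕ) ≤ 0) = {⟨0, hx⟩} := by
      ext j; simp [Fin.ext_iff]
    rw [dictSum, this, sum_singleton]
    simp [gap]
  | succ x ih =>
    have h1 := ih (by omega)
    have : (univ.filter fun j : Fin n => (j : ℕ) ≤ x + 1) =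
        insert ⟨x + 1, hx⟩ (univ.filter fun j : Fin n => (j : ℕ) ≤ x) := by
      ext j
      simp only [mem_filter, mem_univ, true_and, mem_insert, Fin.ext_iff]
      omega
    rw [dictSum, this, sum_insert (by simp)]
    rw [dictSum] at h1
    rw [h1]
    simp only [gap, Nat.add_sub_cancel, Nat.succ_pos, dif_pos]
    have := hf (show (⟨x, by omega⟩ : Fin n) ≤ ⟨x + 1, hx⟩ from Fin.mk_le_mk.2 (by omega))
    omega

theorem sum_gap_lt {f : Fin n → ℕ} (hf : Monotone f) {B : ℕ} (hB : ∀ i, f i < B) (hB0 : 0 < B) :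
    ∑ i, gap f i < B := by
  rcases Nat.eq_zero_or_pos n with rfl | hn
  · simpa using hB0
  · have h := dictSum_gap hf (n - 1) (by omega)
    rw [dictSum, filter_true_of_mem (fun j _ => by have := j.2; omega)] at h
    rw [h]
    exact hB _

/-- With unit weights a dictionary query translates an identifier into its rank, increased by one.
-/
theorem dictSum_one {f : Fin n → ℕ} (hf : StrictMono f) (i : Fin n) :
    dictSum f (fun _ => 1) (f i) = i + 1 := by
  have : (univ.filter fun j => f j ≤ f i) = Iic i := by
    ext j
    simp [hf.le_iff_le]
  rw [dictSum, this, sum_const, smul_eq_mul, mul_one, Fin.card_Iic]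

theorem Reach.gap {α : Type} {w S b L u : ℕ} {X : E → Fin n → α} {f : E → Fin n → ℕ}
    (h : Reach w S b X L f) (hf : ∀ e i, f e i < (n + 1) ^ u) (hw : u + 1 ≤ w) (hS : 1 ≤ S)
    (hb : 2 * u ≤ b) :
    Reach w S b X (L + 1) fun e i => (f e i, CliqueSim.gap (f e) i) := by
  have hst : Stored b fun e (i : Fin n) => (f e i, CliqueSim.gap (f e) i) :=
    ((Stored.nat hf).prod (Stored.nat fun e i =>
      (Nat.sub_le _ _).trans_lt (hf e i))).mono (by omega)
  have hone : ∀ e (p : ℕ × ℕ → ℕ) (hp : ∀ i i' : Fin n, p ((i : ℕ), f e i) = p ((i' : ℕ), f e i') →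
      i = i') (j : ℕ),
      ((univ.image fun i : Fin n => ((i : ℕ), f e i)).filter fun y => p y = j).card ≤ S := by
    intro e p hp j
    refine le_trans (card_le_one.2 ?_) hS
    intro y hy y' hy'
    simp only [mem_filter, mem_image, mem_univ, true_and] at hy hy'
    obtain ⟨⟨i, rfl⟩, h1⟩ := hy
    obtain ⟨⟨i', rfl⟩, h2⟩ := hy'
    rw [hp i i' (h1.trans h2.symm)]
  -- Every machine sends its value to the next one; the item of the last machine is addressed to
  -- nobody.
  refine h.move (fun e => univ.image fun i : Fin n => ((i : ℕ), f e i)) (fun _ y => y.1)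
    (fun _ y => y.1 + 1) ?_ ?_ ?_ ?_ ?_ ?_ hst
  · have h1 : Small ({x | x < (n + 1) ^ 1} ×ˢ {x | x < (n + 1) ^ u}) ((n + 1) ^ 1 * (n + 1) ^ u) :=
      (Small.range_lt _ fun _ h => h).prod (Small.range_lt _ fun _ h => h)
    refine h1.mono ?_ ?_
    · rintro y ⟨e, hy⟩
      obtain ⟨i, -, rfl⟩ := mem_image.1 hy
      refine ⟨?_, hf e i⟩
      have := i.2
      simp only [Set.mem_ofPred_eq, pow_one]
      omega
    · rw [← pow_add]
      exact Nat.pow_le_pow_right (by omega) (by omega)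
  · intro j e e' hY y hy hs
    obtain ⟨i, -, rfl⟩ := mem_image.1 hy
    obtain rfl := Fin.ext hs
    exact ⟨mem_image.2 ⟨i, mem_univ _, by rw [hY]⟩, rfl, rfl⟩
  · intro e y hy
    obtain ⟨i, -, rfl⟩ := mem_image.1 hy
    exact i.2
  · intro e j
    exact hone e (fun y => y.1) (fun i i' h => Fin.ext h) j
  · intro e j
    exact hone e (fun y => y.1 + 1) (fun i i' h => Fin.ext (Nat.succ_injective h)) j
  · intro i e e' hY
    simp only [Prod.mk.injEq] at hY ⊢
    obtain ⟨h1, h2⟩ := hY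
    refine ⟨h1, ?_⟩
    simp only [CliqueSim.gap, h1]
    by_cases hi : 0 < (i : ℕ)
    · simp only [hi, dif_pos]
      have h3 : ((i : ℕ) - 1, f e ⟨i - 1, by omega⟩) ∈
          (univ.image fun i : Fin n => ((i : ℕ), f e i)).filter fun y => y.1 + 1 = (i : ℕ) :=
        mem_filter.2 ⟨mem_image.2 ⟨⟨i - 1, by omega⟩, mem_univ _, rfl⟩, by simp only; omega⟩
      rw [h2] at h3
      obtain ⟨j, -, hj⟩ := mem_image.1 (mem_filter.1 h3).1
      simp only [Prod.mk.injEq] at hj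
      have : j = ⟨i - 1, by omega⟩ := Fin.ext hj.1
      rw [← hj.2, this]
    · simp only [hi, dif_neg, not_false_eq_true]

section Setup

variable {k S : ℕ} {P : UnlabeledGraphProblem}

/-- The vertices in the order of their identifiers. -/
def vert (e : Instance k n S P) : Equiv.Perm (Fin n) :=
  Tuple.sort fun v => (e.1.2.ident v : ℕ)

/-- The identifiers of the vertices in increasing order. -/
def orig (e : Instance k n S P) (j : Fin n) : ℕ := e.1.2.ident (vert e j)

/-- The input graph, with the vertices named by the ranks of their identifiers. -/
def relabel (e : Instance k n S P) : SimpleGraph (Fin n) := e.1.1.comap (vert e)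

theorem orig_strictMono (e : Instance k n S P) : StrictMono (orig e) := by
  have h : Monotone (orig e) := Tuple.monotone_sort fun v => (e.1.2.ident v : ℕ)
  refine h.strictMono_of_injective fun i j hij => ?_
  exact (vert e).injective (e.1.2.ident.injective (Fin.ext hij))

theorem orig_lt (e : Instance k n S P) (j : Fin n) : orig e j < (n + 1) ^ k :=
  (e.1.2.ident (vert e j)).2

theorem orig_symm (e : Instance k n S P) (v : Fin n) :
    orig e ((vert e).symm v) = e.1.2.ident v := by
  rw [orig, Equiv.apply_symm_apply]

theorem biUnion_vertices (e : Instance k n S P) :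
    univ.biUnion (fun i => e.1.2.vertices i) = univ.image (orig e) := by
  classical
  ext x
  simp only [mem_biUnion, mem_univ, true_and, MPC.Input.vertices, mem_image, mem_filter]
  constructor
  · rintro ⟨i, v, -, rfl⟩
    exact ⟨(vert e).symm v, orig_symm e v⟩
  · rintro ⟨j, rfl⟩
    exact ⟨_, vert e j, rfl, rfl⟩

/-- Sorting with one element per machine brings the identifier of rank `i` to machine `i`, which
thereby becomes the host of that vertex. -/
theorem reach_orig {F D : ℕ} (hS : 1 ≤ S) (hF0 : 0 < F) (hF : 2 * F * F ≤ S) (hD : 0 < D)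
    (hFD : n + 1 ≤ F ^ D) (hk : 0 < k) :
    Reach (2 * (k + 1)) S ((5 * (k + 1) + 4) * S) (placed (k := k) (n := n) (S := S) (P := P))
      (k * D * (D + 1)) orig := by
  classical
  have hsort := reach_sort (S := S) (s := 1) (u := k)
    (fun (e : Instance k n S P) i => e.1.2.vertices i) ?_ ?_ ?_ one_pos hS ?_ hF0 hF hD hFD hk
  · refine (hsort.det_left fun i e e' h => (Prod.mk.inj h).1).det_right ?_
    intro i e e' h
    simp only [biUnion_vertices] at h
    have hmem : orig e i ∈ chunk (univ.image (orig e)) 1 i :=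
      mem_chunk.2 ⟨mem_image_of_mem _ (mem_univ i), by
        rw [rank_image (orig_strictMono e), Nat.div_one]⟩
    rw [h, mem_chunk, Nat.div_one] at hmem
    obtain ⟨h1, h2⟩ := hmem
    obtain ⟨j, -, hj⟩ := mem_image.1 h1
    rw [← hj, rank_image (orig_strictMono e')] at h2
    rw [← hj, Fin.ext h2]
  · intro e i j x hi hj
    simp only [MPC.Input.vertices, mem_image, mem_filter, mem_univ, true_and] at hi hj
    obtain ⟨v, rfl, rfl⟩ := hi
    obtain ⟨v', rfl, h⟩ := hj
    rw [e.1.2.ident.injective (Fin.ext h)]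
  · intro e i x hx
    simp only [MPC.Input.vertices, mem_image] at hx
    obtain ⟨v, -, rfl⟩ := hx
    exact (e.1.2.ident v).2
  · intro e i
    have := e.2.2 i
    omega
  · intro e
    rw [biUnion_vertices]
    exact card_image_le.trans (by simp)

/-- The edges on a machine, as pairs of identifiers. -/
def edgePairs (e : Instance k n S P) (i : Fin n) : Finset (ℕ × ℕ) := by
  classical exact (e.1.2.edges i).image fun z => (z.inf, z.sup)

/-- Since `orig` is increasing, ordering the endpoints by identifier and by rank is the same. -/
theorem mem_edgePairs {e : Instance k n S P} {i : Fin n} {p : ℕ × ℕ} :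
    p ∈ edgePairs e i ↔ ∃ a b, a < b ∧ (relabel e).Adj a b ∧ p = (orig e a, orig e b) ∧
      e.1.2.edgeLoc s(vert e a, vert e b) = i := by
  classical
  simp only [edgePairs, MPC.Input.edges, mem_image, mem_filter, mem_univ, true_and]
  constructor
  · rintro ⟨_, ⟨z, ⟨h1, h2⟩, rfl⟩, rfl⟩
    obtain ⟨a, b, rfl⟩ : ∃ a b, z = s(vert e a, vert e b) := by
      induction z with
      | _ u v => exact ⟨(vert e).symm u, (vert e).symm v, by simp⟩
    rcases lt_trichotomy a b with h | rfl | h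
    · refine ⟨a, b, h, h1, ?_, h2⟩
      have := orig_strictMono e h
      simp only [Sym2.map_mk, Sym2.inf_mk, Sym2.sup_mk]
      exact Prod.ext (min_eq_left this.le) (max_eq_right this.le)
    · exact absurd h1 (SimpleGraph.irrefl _)
    · refine ⟨b, a, h, h1.symm, ?_, by rw [Sym2.eq_swap]; exact h2⟩
      have := orig_strictMono e h
      simp only [Sym2.map_mk, Sym2.inf_mk, Sym2.sup_mk]
      exact Prod.ext (min_eq_right this.le) (max_eq_left this.le)
  · rintro ⟨a, b, h, h1, rfl, h2⟩
    refine ⟨_, ⟨s(vert e a, vert e b), ⟨h1, h2⟩, rfl⟩, ?_⟩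
    have := orig_strictMono e h
    simp only [Sym2.map_mk, Sym2.inf_mk, Sym2.sup_mk]
    exact Prod.ext (min_eq_left this.le) (max_eq_right this.le)

theorem two_mul_card_edgePairs_le (e : Instance k n S P) (i : Fin n) :
    2 * (edgePairs e i).card ≤ S := by
  classical
  have h1 := e.2.2 i
  have h2 : (edgePairs e i).card ≤ (e.1.2.edges i).card := by
    unfold edgePairs
    exact card_image_le
  omega

end Setup


/-! ## The sorted array of all adjacency lists -/

variable {E : Type} {n : ℕ}

/-- The number that stands for the entry `y` of block `j`. -/
def key (n j y : ℕ) : ℕ := (n + 2) * j + y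

theorem key_div {n y : ℕ} (j : ℕ) (hy : y < n + 2) : key n j y / (n + 2) = j := by
  rw [key, Nat.mul_add_div (by omega), Nat.div_eq_of_lt hy, add_zero]

theorem key_mod {n y : ℕ} (j : ℕ) (hy : y < n + 2) : key n j y % (n + 2) = y := by
  rw [key, Nat.mul_add_mod, Nat.mod_eq_of_lt hy]

theorem key_inj {n j j' y y' : ℕ} (hy : y < n + 2) (hy' : y' < n + 2)
    (h : key n j y = key n j' y') : j = j' ∧ y = y' := by
  refine ⟨?_, ?_⟩
  · rw [← key_div j hy, h, key_div j' hy']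
  · rw [← key_mod j hy, h, key_mod j' hy']

theorem key_lt_key_iff {n j j' y y' : ℕ} (hy : y < n + 2) (hy' : y' < n + 2) :
    key n j y < key n j' y' ↔ j < j' ∨ j = j' ∧ y < y' := by
  have aux : ∀ {j j' y y' : ℕ}, y < n + 2 → j < j' → key n j y < key n j' y' := by
    intro j j' y y' hy h
    have := Nat.mul_le_mul_left (n + 2) (Nat.succ_le_of_lt h)
    unfold key
    rw [Nat.mul_succ] at this
    omega
  rcases lt_trichotomy j j' with h | rfl | h
  · simp [aux hy h, h]
  · simp [key]
  · have := aux (y' := y) hy' h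
    have h1 : ¬ j < j' := by omega
    have h2 : j ≠ j' := by omega
    simp only [h1, h2, false_and, or_false, iff_false]
    omega

theorem key_lt {n j y : ℕ} (hj : j < n) (hy : y < n + 2) : key n j y < (n + 1) ^ 2 := by
  have := Nat.mul_le_mul_left (n + 2) (Nat.succ_le_of_lt hj)
  rw [Nat.mul_succ] at this
  unfold key
  nlinarith

/-- The adjacency list of `j` between two markers. -/
def block (H : SimpleGraph (Fin n)) (j : Fin n) : Finset ℕ :=
  insert (key n j 0) (insert (key n j (n + 1)) ((NCCStar.nbrs H j).image fun x => key n j (x + 1)))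

/-- The adjacency lists of all vertices. -/
def arr (H : SimpleGraph (Fin n)) : Finset ℕ := univ.biUnion (block H)

theorem lt_of_mem_nbrs {H : SimpleGraph (Fin n)} {j : Fin n} {x : ℕ}
    (h : x ∈ NCCStar.nbrs H j) : x < n := by
  obtain ⟨u, -, rfl⟩ := NCCStar.mem_nbrs.1 h
  exact u.2

theorem mem_block {H : SimpleGraph (Fin n)} {j : Fin n} {z : ℕ} :
    z ∈ block H j ↔ z = key n j 0 ∨ z = key n j (n + 1) ∨
      ∃ x ∈ NCCStar.nbrs H j, key n j (x + 1) = z := by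
  simp [block]

theorem mem_arr {H : SimpleGraph (Fin n)} {z : ℕ} : z ∈ arr H ↔ ∃ j, z ∈ block H j := by
  simp [arr]

theorem div_of_mem_block {H : SimpleGraph (Fin n)} {j : Fin n} {z : ℕ} (h : z ∈ block H j) :
    z / (n + 2) = j := by
  rcases mem_block.1 h with rfl | rfl | ⟨x, hx, rfl⟩
  · exact key_div _ (by omega)
  · exact key_div _ (by omega)
  · exact key_div _ (by have := lt_of_mem_nbrs hx; omega)

theorem key_zero_mem_arr (H : SimpleGraph (Fin n)) (j : Fin n) : key n j 0 ∈ arr H :=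
  mem_arr.2 ⟨j, mem_block.2 (.inl rfl)⟩

theorem key_last_mem_arr (H : SimpleGraph (Fin n)) (j : Fin n) : key n j (n + 1) ∈ arr H :=
  mem_arr.2 ⟨j, mem_block.2 (.inr (.inl rfl))⟩

theorem key_succ_mem_arr {H : SimpleGraph (Fin n)} {j : Fin n} {x : ℕ} (hx : x < n) :
    key n j (x + 1) ∈ arr H ↔ x ∈ NCCStar.nbrs H j := by
  rw [mem_arr]
  constructor
  · rintro ⟨j', h⟩
    have hd := div_of_mem_block h
    rw [key_div _ (by omega)] at hd
    obtain rfl := Fin.ext hd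
    rcases mem_block.1 h with h | h | ⟨y, hy, h⟩
    · have := (key_inj (by omega) (by omega) h).2; omega
    · have := (key_inj (by omega) (by omega) h).2; omega
    · have := (key_inj (by have := lt_of_mem_nbrs hy; omega) (by omega) h).2
      rwa [← Nat.succ_injective this]
  · intro h
    exact ⟨j, mem_block.2 (.inr (.inr ⟨x, h, rfl⟩))⟩

theorem lt_of_mem_arr {H : SimpleGraph (Fin n)} {z : ℕ} (h : z ∈ arr H) : z < (n + 1) ^ 2 := by
  obtain ⟨j, hj⟩ := mem_arr.1 h
  rcases mem_block.1 hj with rfl | rfl | ⟨x, hx, rfl⟩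
  · exact key_lt j.2 (by omega)
  · exact key_lt j.2 (by omega)
  · exact key_lt j.2 (by have := lt_of_mem_nbrs hx; omega)

/-- There are `2n` markers and at most `2an` adjacency entries, together at most `4an` as `a ≥ 1`.
-/
theorem card_arr_le {H : SimpleGraph (Fin n)} {a : ℕ} (ha : 1 ≤ a)
    (h : ∑ j, (NCCStar.nbrs H j).card ≤ 2 * a * n) : (arr H).card ≤ n * (4 * a) := by
  refine card_biUnion_le.trans ?_
  have h1 : ∀ j, (block H j).card ≤ 2 + (NCCStar.nbrs H j).card := by
    intro j
    refine (card_insert_le _ _).trans ?_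
    have h2 := card_insert_le (key n j (n + 1))
      ((NCCStar.nbrs H j).image fun x => key n j (x + 1))
    have h3 : ((NCCStar.nbrs H j).image fun x => key n j (x + 1)).card ≤ _ := card_image_le
    omega
  refine (sum_le_sum fun j _ => h1 j).trans ?_
  rw [sum_add_distrib]
  simp only [sum_const, card_univ, Fintype.card_fin, smul_eq_mul]
  nlinarith

/-- The position of the block of `j` in the array. -/
def pos (H : SimpleGraph (Fin n)) (j : Fin n) : ℕ := rank (arr H) (key n j 0)

/-- In front of the entry lie everything before the block of `j`, the first marker of the block, and
the smaller neighbours. Thus the position of a neighbour is its port number plus `pos H j + 1`. -/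
theorem rank_arr_key (H : SimpleGraph (Fin n)) (j : Fin n) {x : ℕ} (hx : x ≤ n) :
    rank (arr H) (key n j (x + 1)) = pos H j + 1 + rank (NCCStar.nbrs H j) x := by
  have h1 : (arr H).filter (· < key n j (x + 1)) =
      insert (key n j 0) ((arr H).filter (· < key n j 0)) ∪
        ((NCCStar.nbrs H j).filter (· < x)).image fun y => key n j (y + 1) := by
    ext z
    simp only [mem_union, mem_insert, mem_filter, mem_image]
    constructor
    · rintro ⟨h1, h2⟩
      obtain ⟨j', h3⟩ := mem_arr.1 h1
      rcases lt_trichotomy (j' : ℕ) j with h4 | h4 | h4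
      · refine .inl (.inr ⟨h1, ?_⟩)
        rcases mem_block.1 h3 with rfl | rfl | ⟨y, hy, rfl⟩
        · exact (key_lt_key_iff (by omega) (by omega)).2 (.inl h4)
        · exact (key_lt_key_iff (by omega) (by omega)).2 (.inl h4)
        · exact (key_lt_key_iff (by have := lt_of_mem_nbrs hy; omega) (by omega)).2 (.inl h4)
      · obtain rfl := Fin.ext h4
        rcases mem_block.1 h3 with rfl | rfl | ⟨y, hy, rfl⟩
        · exact .inl (.inl rfl)
        · rw [key_lt_key_iff (by omega) (by omega)] at h2
          omega
        · rw [key_lt_key_iff (by have := lt_of_mem_nbrs hy; omega) (by omega)] at h2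
          exact .inr ⟨y, ⟨hy, by omega⟩, rfl⟩
      · exfalso
        rcases mem_block.1 h3 with rfl | rfl | ⟨y, hy, rfl⟩
        · rw [key_lt_key_iff (by omega) (by omega)] at h2; omega
        · rw [key_lt_key_iff (by omega) (by omega)] at h2; omega
        · rw [key_lt_key_iff (by have := lt_of_mem_nbrs hy; omega) (by omega)] at h2; omega
    · rintro ((rfl | ⟨h1, h2⟩) | ⟨y, ⟨h1, h2⟩, rfl⟩)
      · exact ⟨key_zero_mem_arr H j, (key_lt_key_iff (by omega) (by omega)).2 (.inr ⟨rfl, by omega⟩)⟩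
      · exact ⟨h1, h2.trans ((key_lt_key_iff (by omega) (by omega)).2 (.inr ⟨rfl, by omega⟩))⟩
      · have := lt_of_mem_nbrs h1
        exact ⟨(key_succ_mem_arr this).2 h1,
          (key_lt_key_iff (by omega) (by omega)).2 (.inr ⟨rfl, by omega⟩)⟩
  rw [rank, h1, card_union_of_disjoint, card_insert_of_notMem (by simp), card_image_of_injOn]
  · rfl
  · intro y hy y' hy' h
    have h2 := lt_of_mem_nbrs (mem_filter.1 hy).1
    have h3 := lt_of_mem_nbrs (mem_filter.1 hy').1
    exact Nat.succ_injective (key_inj (by omega) (by omega) h).2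
  · rw [disjoint_left]
    intro z hz hz'
    obtain ⟨y, hy, rfl⟩ := mem_image.1 hz'
    have h2 := lt_of_mem_nbrs (mem_filter.1 hy).1
    rcases mem_insert.1 hz with h | h
    · have := (key_inj (by omega) (by omega) h).2; omega
    · have := (mem_filter.1 h).2
      rw [key_lt_key_iff (by omega) (by omega)] at this
      omega

/-- The second marker makes the degree visible as a difference of two ranks, even if the block is
spread over many machines. -/
theorem rank_arr_last (H : SimpleGraph (Fin n)) (j : Fin n) :
    rank (arr H) (key n j (n + 1)) = pos H j + 1 + NCCStar.deg H j := by
  rw [rank_arr_key H j le_rfl, rank, filter_true_of_mem fun x hx => lt_of_mem_nbrs hx,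
    NCCStar.card_nbrs]

/-- Two dictionary queries per edge replace its two identifiers by ranks. Then each edge is written
down in both directions, markers are added, and everything is sorted. -/
theorem reach_arr {F D S k a : ℕ} (H : E → SimpleGraph (Fin n)) (o : E → Fin n → ℕ)
    (Q : E → Fin n → Finset (ℕ × ℕ)) (ho : ∀ e, StrictMono (o e))
    (ho' : ∀ e i, o e i < (n + 1) ^ k)
    (hQ : ∀ e i, ∀ p ∈ Q e i, ∃ x y, x < y ∧ (H e).Adj x y ∧ p = (o e x, o e y))
    (hQ' : ∀ e x y, x < y → (H e).Adj x y → ∃ i, (o e x, o e y) ∈ Q e i)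
    (hdisj : ∀ e i j p, p ∈ Q e i → p ∈ Q e j → i = j) (hQS : ∀ e i, 2 * (Q e i).card ≤ S)
    (harb : ∀ e, ∑ j, (NCCStar.nbrs (H e) j).card ≤ 2 * a * n)
    (hk : 1 ≤ k) (ha : 1 ≤ a) (haS : 8 * a ≤ S)
    (hF0 : 0 < F) (hF : 2 * F * F ≤ S) (hD : 0 < D) (hFD : n + 1 ≤ F ^ D) :
    Reach (4 * k + 4) S ((11 * k + 14) * S) (fun e i => (o e i, Q e i))
      ((4 * k + 6) * D * (D + 1)) fun e (i : Fin n) => chunk (arr (H e)) (4 * a) i := by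
  classical
  have hnk : n < (n + 1) ^ k :=
    lt_of_lt_of_le (Nat.lt_succ_self n) (Nat.le_self_pow (by omega) _)
  let one : E → Fin n → ℕ := fun _ _ => 1
  have hone : ∀ e, ∑ i, one e i < (n + 1) ^ k := fun e => by simpa [one] using hnk
  have hdict : ∀ e x, dictSum (o e) (one e) (o e x) = x + 1 := fun e x => dictSum_one (ho e) x
  let B₁ : E → Finset (ℕ × ℕ) := fun e => univ.biUnion (Q e)
  have hB₁ : ∀ e p, p ∈ B₁ e ↔ ∃ x y, x < y ∧ (H e).Adj x y ∧ p = (o e x, o e y) := by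
    intro e p
    simp only [B₁, mem_biUnion, mem_univ, true_and]
    constructor
    · rintro ⟨i, hi⟩; exact hQ e i p hi
    · rintro ⟨x, y, h1, h2, rfl⟩; exact hQ' e x y h1 h2
  have hpairs : ∀ e, (univ.filter fun q : Fin n × Fin n => q.1 < q.2 ∧ (H e).Adj q.1 q.2).card
      ≤ n * (2 * a) := by
    intro e
    refine le_trans ?_ ((harb e).trans_eq (mul_comm _ _))
    rw [← card_sigma]
    refine card_le_card_of_injOn (fun q => ⟨q.1, (q.2 : ℕ)⟩) ?_ ?_
    · intro q hq
      have hq' := (mem_filter.1 hq).2.2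
      exact mem_sigma.2 ⟨mem_univ _, NCCStar.val_mem_nbrs.2 hq'⟩
    · intro q _ q' _ h
      simp only [Sigma.mk.injEq] at h
      exact Prod.ext h.1 (Fin.ext (eq_of_heq h.2))
  have hcard₁ : ∀ e, (B₁ e).card ≤ n * (2 * a) := by
    intro e
    refine le_trans ?_ (hpairs e)
    refine (card_le_card (t := (univ.filter fun q : Fin n × Fin n => q.1 < q.2 ∧
      (H e).Adj q.1 q.2).image fun q => (o e q.1, o e q.2)) ?_).trans card_image_le
    intro p hp
    obtain ⟨x, y, h1, h2, rfl⟩ := (hB₁ e p).1 hp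
    exact mem_image.2 ⟨(x, y), by simp [h1, h2], rfl⟩
  obtain ⟨l₁, hl₁, l₁n, hr₁⟩ := reach_lookup o one Q (fun e => (ho e).injective) ho' hone
    (fun e i p hp => by obtain ⟨x, y, -, -, rfl⟩ := hQ e i p hp; exact ho' e x)
    (fun e i p hp => by obtain ⟨x, y, -, -, rfl⟩ := hQ e i p hp; exact ho' e y)
    hdisj (fun e i => by have := hQS e i; omega) (show 2 * a + 1 ≤ S by omega) hcard₁ hF0 hF hD hFD
  -- The second round of queries asks for the rank of the larger endpoint. The answer of the first
  -- round serves as the tag, so it is carried along and keeps the queries distinct.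
  let Q₂ : E → Fin n → Finset (ℕ × ℕ) := fun e i =>
    ((B₁ e).filter fun p => l₁ e p = i).image fun p => (p.2, dictSum (o e) (one e) p.1)
  have hQ₂ : ∀ e i p, p ∈ Q₂ e i ↔ ∃ x y : Fin n, x < y ∧ (H e).Adj x y ∧
      p = (o e y, (x : ℕ) + 1) ∧ l₁ e (o e x, o e y) = i := by
    intro e i p
    simp only [Q₂, mem_image, mem_filter, hB₁]
    constructor
    · rintro ⟨_, ⟨⟨x, y, h1, h2, rfl⟩, h3⟩, rfl⟩
      exact ⟨x, y, h1, h2, by rw [hdict], h3⟩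
    · rintro ⟨x, y, h1, h2, rfl, h3⟩
      exact ⟨_, ⟨⟨x, y, h1, h2, rfl⟩, h3⟩, by rw [hdict]⟩
  have hinj₂ : ∀ e (x y x' y' : Fin n), (o e y, (x : ℕ) + 1) = (o e y', (x' : ℕ) + 1) →
      x = x' ∧ y = y' := by
    intro e x y x' y' h
    rw [Prod.mk.injEq] at h
    exact ⟨Fin.ext (Nat.succ_injective h.2), (ho e).injective h.1⟩
  let B₂ : E → Finset (ℕ × ℕ) := fun e => univ.biUnion (Q₂ e)
  have hB₂' : ∀ e p, p ∈ B₂ e → ∃ x y : Fin n, x < y ∧ (H e).Adj x y ∧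
      p = (o e y, (x : ℕ) + 1) := by
    intro e p hp
    obtain ⟨i, -, hi⟩ := mem_biUnion.1 hp
    obtain ⟨x, y, h1, h2, h3, -⟩ := (hQ₂ e i p).1 hi
    exact ⟨x, y, h1, h2, h3⟩
  have hcard₂ : ∀ e, (B₂ e).card ≤ n * (2 * a) := by
    intro e
    refine le_trans ?_ (hpairs e)
    refine (card_le_card (t := (univ.filter fun q : Fin n × Fin n => q.1 < q.2 ∧
      (H e).Adj q.1 q.2).image fun q => (o e q.2, (q.1 : ℕ) + 1)) ?_).trans card_image_le
    intro p hp
    obtain ⟨x, y, h1, h2, rfl⟩ := hB₂' e p hp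
    exact mem_image.2 ⟨(x, y), by simp [h1, h2], rfl⟩
  obtain ⟨l₂, hl₂, hl₂n, hr₂⟩ := reach_lookup o one Q₂ (fun e => (ho e).injective) ho' hone
    (fun e i p hp => by obtain ⟨x, y, -, -, rfl, -⟩ := (hQ₂ e i p).1 hp; exact ho' e y)
    (fun e i p hp => by
      obtain ⟨x, y, -, -, rfl, -⟩ := (hQ₂ e i p).1 hp
      have := x.2; simp only; omega)
    (fun e i j p hi hj => by
      obtain ⟨x, y, -, -, rfl, h1⟩ := (hQ₂ e i p).1 hi
      obtain ⟨x', y', -, -, h, h2⟩ := (hQ₂ e j _).1 hj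
      obtain ⟨rfl, rfl⟩ := hinj₂ e _ _ _ _ h
      exact Fin.ext (h1.symm.trans h2))
    (fun e i => by
      have : (Q₂ e i).card ≤ 2 * a + 1 := card_image_le.trans (hl₁ e i)
      omega)
    (show 2 * a + 1 ≤ S by omega) hcard₂ hF0 hF hD hFD
  have hB₂ : ∀ e p, p ∈ B₂ e ↔ ∃ x y : Fin n, x < y ∧ (H e).Adj x y ∧
      p = (o e y, (x : ℕ) + 1) := by
    intro e p
    refine ⟨hB₂' e p, ?_⟩
    rintro ⟨x, y, h1, h2, rfl⟩
    have h3 := l₁n e _ ((hB₁ e _).2 ⟨x, y, h1, h2, rfl⟩)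
    exact mem_biUnion.2 ⟨⟨_, h3⟩, mem_univ _, (hQ₂ e _ _).2 ⟨x, y, h1, h2, rfl, rfl⟩⟩
  let T₂ : E → Fin n → Finset (ℕ × ℕ × ℕ) := fun e i =>
    ((B₂ e).filter fun p => l₂ e p = i).image fun p => (p.1, p.2, dictSum (o e) (one e) p.1)
  -- The looked-up numbers are ranks plus one. The block number needs the rank, hence the
  -- subtraction. The entry inside a block is shifted by one anyway, because 0 is the first marker.
  let A : E → Fin n → Finset ℕ := fun e i => insert (key n i 0) (insert (key n i (n + 1))
    (((T₂ e i).image fun t => key n (t.2.1 - 1) t.2.2) ∪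
      (T₂ e i).image fun t => key n (t.2.2 - 1) t.2.1))
  have hT₂ : ∀ e i t, t ∈ T₂ e i ↔ ∃ x y : Fin n, x < y ∧ (H e).Adj x y ∧
      t = (o e y, (x : ℕ) + 1, (y : ℕ) + 1) ∧ l₂ e (o e y, (x : ℕ) + 1) = i := by
    intro e i t
    simp only [T₂, mem_image, mem_filter, hB₂]
    constructor
    · rintro ⟨_, ⟨⟨x, y, h1, h2, rfl⟩, h3⟩, rfl⟩
      exact ⟨x, y, h1, h2, by rw [hdict], h3⟩
    · rintro ⟨x, y, h1, h2, rfl, h3⟩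
      exact ⟨_, ⟨⟨x, y, h1, h2, rfl⟩, h3⟩, by rw [hdict]⟩
  have hA : ∀ e i z, z ∈ A e i ↔ z = key n i 0 ∨ z = key n i (n + 1) ∨ ∃ x y : Fin n, x < y ∧
      (H e).Adj x y ∧ l₂ e (o e y, (x : ℕ) + 1) = i ∧
        (z = key n x (y + 1) ∨ z = key n y (x + 1)) := by
    intro e i z
    simp only [A, mem_insert, mem_union, mem_image, hT₂]
    refine or_congr Iff.rfl (or_congr Iff.rfl ?_)
    constructor
    · rintro (⟨_, ⟨x, y, h1, h2, rfl, h3⟩, rfl⟩ | ⟨_, ⟨x, y, h1, h2, rfl, h3⟩, rfl⟩)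
      · exact ⟨x, y, h1, h2, h3, .inl (by simp)⟩
      · exact ⟨x, y, h1, h2, h3, .inr (by simp)⟩
    · rintro ⟨x, y, h1, h2, h3, rfl | rfl⟩
      · exact .inl ⟨_, ⟨x, y, h1, h2, rfl, h3⟩, by simp⟩
      · exact .inr ⟨_, ⟨x, y, h1, h2, rfl, h3⟩, by simp⟩
  have hAarr : ∀ e, univ.biUnion (A e) = arr (H e) := by
    intro e
    ext z
    simp only [mem_biUnion, mem_univ, true_and, hA, mem_arr, mem_block, NCCStar.mem_nbrs]
    constructor
    · rintro ⟨i, h | h | ⟨x, y, h1, h2, h3, h | h⟩⟩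
      · exact ⟨i, .inl h⟩
      · exact ⟨i, .inr (.inl h)⟩
      · exact ⟨x, .inr (.inr ⟨y, ⟨y, h2, rfl⟩, h.symm⟩)⟩
      · exact ⟨y, .inr (.inr ⟨x, ⟨x, h2.symm, rfl⟩, h.symm⟩)⟩
    · rintro ⟨i, h | h | ⟨_, ⟨y, h, rfl⟩, rfl⟩⟩
      · exact ⟨i, .inl h⟩
      · exact ⟨i, .inr (.inl h)⟩
      · rcases lt_trichotomy i y with h1 | rfl | h1
        · have := hl₂n e _ ((hB₂ e _).2 ⟨i, y, h1, h, rfl⟩)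
          exact ⟨⟨_, this⟩, .inr (.inr ⟨i, y, h1, h, rfl, .inl rfl⟩)⟩
        · exact absurd h (SimpleGraph.irrefl _)
        · have := hl₂n e _ ((hB₂ e _).2 ⟨y, i, h1, h.symm, rfl⟩)
          exact ⟨⟨_, this⟩, .inr (.inr ⟨y, i, h1, h.symm, rfl, .inr rfl⟩)⟩
  have hAdisj : ∀ e i j z, z ∈ A e i → z ∈ A e j → i = j := by
    intro e i j z hi hj
    rcases (hA e i z).1 hi with rfl | rfl | ⟨x, y, h1, h2, h3, h4⟩ <;>
      rcases (hA e j _).1 hj with h' | h' | ⟨x', y', h1', h2', h3', h4'⟩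
    · exact Fin.ext (key_inj (by omega) (by omega) h').1
    · have := (key_inj (by omega) (by omega) h').2; omega
    · rcases h4' with h' | h' <;>
        · have := (key_inj (by omega) (by omega) h').2
          omega
    · have := (key_inj (by omega) (by omega) h').2; omega
    · exact Fin.ext (key_inj (by omega) (by omega) h').1
    · rcases h4' with h' | h' <;>
        · have := (key_inj (by omega) (by omega) h').2
          omega
    · rcases h4 with h4 | h4 <;> subst h4 <;>
        · have := (key_inj (by omega) (by omega) h').2
          omega
    · rcases h4 with h4 | h4 <;> subst h4 <;>
        · have := (key_inj (by omega) (by omega) h').2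
          omega
    · have hxy : x = x' ∧ y = y' := by
        have h1 : (x : ℕ) < y := h1
        have h1' : (x' : ℕ) < y' := h1'
        have : (x : ℕ) = x' ∧ (y : ℕ) = y' := by
          rcases h4 with h4 | h4 <;> rcases h4' with h4' | h4' <;>
          · obtain ⟨h5, h6⟩ := key_inj (by omega) (by omega) (h4.symm.trans h4')
            omega
        exact ⟨Fin.ext this.1, Fin.ext this.2⟩
      obtain ⟨rfl, rfl⟩ := hxy
      exact Fin.ext (h3.symm.trans h3')
  have hAS : ∀ e i, (A e i).card ≤ S := by
    intro e i
    have h1 : (T₂ e i).card ≤ 2 * a + 1 := card_image_le.trans (hl₂ e i)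
    have h2 := card_union_le ((T₂ e i).image fun t => key n (t.2.1 - 1) t.2.2)
      ((T₂ e i).image fun t => key n (t.2.2 - 1) t.2.1)
    have h3 : ((T₂ e i).image fun t => key n (t.2.1 - 1) t.2.2).card ≤ _ := card_image_le
    have h4 : ((T₂ e i).image fun t => key n (t.2.2 - 1) t.2.1).card ≤ _ := card_image_le
    have h5 := card_insert_le (key n i 0) (insert (key n i (n + 1))
      (((T₂ e i).image fun t => key n (t.2.1 - 1) t.2.2) ∪
        (T₂ e i).image fun t => key n (t.2.2 - 1) t.2.1))
    have h6 := card_insert_le (key n i (n + 1))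
      (((T₂ e i).image fun t => key n (t.2.1 - 1) t.2.2) ∪
        (T₂ e i).image fun t => key n (t.2.2 - 1) t.2.1)
    change (A e i).card ≤ _ at h5
    omega
  have hsort := reach_sort (s := 4 * a) (u := 2) A hAdisj
    (fun e i z hz => lt_of_mem_arr (H := H e)
      (hAarr e ▸ mem_biUnion.2 ⟨i, mem_univ _, hz⟩)) hAS (by omega) (by omega)
    (fun e => by rw [hAarr]; exact card_arr_le ha (harb e)) hF0 hF hD hFD two_pos
  simp only [hAarr] at hsort
  have hone' : ∀ {β : Type} {Z : E → Fin n → β}, Det Z one := fun _ _ _ _ => rfl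
  have s1 := (hr₁.keep (R := o) (b' := k) (X' := fun e i => (o e i, Q e i)) (Stored.nat ho')
    (by intro i e e' h; simp only [Prod.mk.injEq] at h ⊢; exact ⟨h.1, rfl, h.2⟩)
    (by intro i e e' h; exact (Prod.mk.inj h).1)).det_right
    (Z := fun e i => (o e i, one e i, Q₂ e i)) (by
      intro i e e' h
      simp only [Prod.mk.injEq] at h ⊢
      refine ⟨h.2, rfl, ?_⟩
      have := congrArg (Finset.image fun t : ℕ × ℕ × ℕ => (t.2.1, t.2.2)) h.1
      rw [image_image, image_image] at this
      exact this)
  have s2 := (s1.mono le_rfl le_rfl (show _ ≤ (11 * k + 14) * S by nlinarith)).trans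
    (hr₂.mono le_rfl le_rfl (show _ ≤ (11 * k + 14) * S by nlinarith))
  have s3 := (s2.det_right (Z := A) (by
      intro i e e' h
      have h' : T₂ e i = T₂ e' i := h
      simp only [A, h'])).trans
    (hsort.mono (show _ ≤ 4 * k + 4 by omega) le_rfl (show _ ≤ (11 * k + 14) * S by nlinarith))
  refine s3.pad ?_
  nlinarith [Nat.zero_le (k * D * (D + 1))]


/-! ### Positions, degrees and the data prepared for the simulation -/

variable {E : Type} {n : ℕ}

theorem rank_arr_lt {H : SimpleGraph (Fin n)} {z : ℕ} (hz : z ∈ arr H) :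
    rank (arr H) z < (n + 1) ^ 2 := by
  refine (rank_lt_card hz).trans_le ?_
  have : arr H ⊆ range ((n + 1) ^ 2) := fun z hz => mem_range.2 (lt_of_mem_arr hz)
  simpa using card_le_card this

theorem stored_chunk_arr {S s : ℕ} (H : E → SimpleGraph (Fin n)) (hs : 0 < s) (hsS : s ≤ S) :
    Stored (3 * S) fun e (i : Fin n) => chunk (arr (H e)) s i :=
  Stored.finset (U := {x | x < (n + 1) ^ 2}) (Small.range_lt _ fun _ h => h)
    (fun _ _ => (card_chunk_le _ hs _).trans hsS)
    fun _ _ _ hx => lt_of_mem_arr (mem_chunk.1 hx).1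

/-- The machine that holds a marker knows its rank and reads the number of the host off the marker.
Each host receives its two markers only, and their ranks give the position of its block and its
degree. -/
theorem Reach.pos {α : Type} {w S b L s : ℕ} {X : E → Fin n → α} {H : E → SimpleGraph (Fin n)}
    (h : Reach w S b X L fun e (i : Fin n) => chunk (arr (H e)) s i) (hs : 0 < s) (hsS : s ≤ S)
    (hcard : ∀ e, (arr (H e)).card ≤ n * s) (hw : 4 ≤ w) (hS : 2 ≤ S) (hb : 6 * S ≤ b) :
    Reach w S b X (L + 1) fun e i => (CliqueSim.pos (H e) i, NCCStar.deg (H e) i,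
      chunk (arr (H e)) s i) := by
  classical
  have hst : Stored b fun e (i : Fin n) => (CliqueSim.pos (H e) i, NCCStar.deg (H e) i,
      chunk (arr (H e)) s i) := by
    refine ((Stored.nat (u := 2) fun e i => rank_arr_lt (key_zero_mem_arr (H e) i)).prod
      ((Stored.nat (u := 1) fun e i => ?_).prod (stored_chunk_arr H hs hsS))).mono (by omega)
    rw [← NCCStar.card_nbrs, pow_one]
    have : NCCStar.nbrs (H e) i ⊆ range n := fun x hx => mem_range.2 (lt_of_mem_nbrs hx)
    have := card_le_card this
    rw [card_range] at this
    omega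
  let items : E → Finset (ℕ × ℕ) := fun e =>
    ((arr (H e)).filter fun z => z % (n + 2) = 0 ∨ z % (n + 2) = n + 1).image
      fun z => (z, rank (arr (H e)) z)
  have hitems : ∀ e y, y ∈ items e ↔ (y.1 ∈ arr (H e) ∧
      (y.1 % (n + 2) = 0 ∨ y.1 % (n + 2) = n + 1)) ∧ y.2 = rank (arr (H e)) y.1 := by
    intro e y
    simp only [items, mem_image, mem_filter]
    constructor
    · rintro ⟨z, h, rfl⟩; exact ⟨h, rfl⟩
    · rintro ⟨h, h'⟩; exact ⟨y.1, h, Prod.ext rfl h'.symm⟩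
  refine h.move items (fun _ y => y.2 / s) (fun _ y => y.1 / (n + 2)) ?_ ?_ ?_ ?_ ?_ ?_ hst
  · have h1 : Small ({x | x < (n + 1) ^ 2} ×ˢ {x | x < (n + 1) ^ 2}) ((n + 1) ^ 2 * (n + 1) ^ 2) :=
      (Small.range_lt _ fun _ h => h).prod (Small.range_lt _ fun _ h => h)
    refine h1.mono ?_ ?_
    · rintro y ⟨e, hy⟩
      obtain ⟨⟨h1, -⟩, h2⟩ := (hitems e y).1 hy
      exact ⟨lt_of_mem_arr h1, by rw [Set.mem_ofPred_eq, h2]; exact rank_arr_lt h1⟩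
    · rw [← pow_add]
      exact Nat.pow_le_pow_right (by omega) (by omega)
  · intro j e e' hY y hy hj
    obtain ⟨⟨h1, h2⟩, h3⟩ := (hitems e y).1 hy
    have h4 : y.1 ∈ chunk (arr (H e)) s j := mem_chunk.2 ⟨h1, by rw [← h3]; exact hj⟩
    have h5 : y.1 ∈ chunk (arr (H e')) s j := hY ▸ h4
    refine ⟨(hitems e' y).2 ⟨⟨(mem_chunk.1 h5).1, h2⟩, ?_⟩, hj, rfl⟩
    rw [h3, rank_eq_of_mem_chunk hs h4, rank_eq_of_mem_chunk hs h5, hY]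
  · intro e y hy
    obtain ⟨⟨h1, h2⟩, h3⟩ := (hitems e y).1 hy
    rw [h3]
    exact (Nat.div_lt_iff_lt_mul hs).2 ((rank_lt_card h1).trans_le (hcard e))
  · intro e j
    refine le_trans ?_ ((card_chunk_le (arr (H e)) hs j).trans hsS)
    refine card_le_card_of_injOn Prod.fst ?_ ?_
    · intro y hy
      obtain ⟨h0, h4⟩ := mem_filter.1 hy
      obtain ⟨⟨h1, -⟩, h3⟩ := (hitems e y).1 h0
      exact mem_chunk.2 ⟨h1, by rw [← h3]; exact h4⟩
    · intro y hy y' hy' hyy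
      have h1 := ((hitems e y).1 (mem_filter.1 hy).1).2
      have h2 := ((hitems e y').1 (mem_filter.1 hy').1).2
      exact Prod.ext hyy (by rw [h1, h2, hyy])
  · intro e j
    refine le_trans ?_ hS
    have : (items e).filter (fun y => y.1 / (n + 2) = j) ⊆
        ({(key n j 0, rank (arr (H e)) (key n j 0)),
          (key n j (n + 1), rank (arr (H e)) (key n j (n + 1)))} : Finset (ℕ × ℕ)) := by
      intro y hy
      obtain ⟨h0, h4⟩ := mem_filter.1 hy
      obtain ⟨⟨h1, h2⟩, h3⟩ := (hitems e y).1 h0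
      have h5 := Nat.div_add_mod y.1 (n + 2)
      rw [h4] at h5
      rcases h2 with h2 | h2
      · have h6 : y.1 = key n j 0 := by rw [key, ← h2, h5]
        exact mem_insert.2 (.inl (Prod.ext h6 (by rw [h3, h6])))
      · have h6 : y.1 = key n j (n + 1) := by rw [key, ← h2, h5]
        exact mem_insert.2 (.inr (mem_singleton.2 (Prod.ext h6 (by rw [h3, h6]))))
    exact (card_le_card this).trans card_le_two
  · intro i e e' hY
    simp only [Prod.mk.injEq] at hY ⊢
    obtain ⟨h1, h2⟩ := hY
    have key' : ∀ y, y < n + 2 → key n i y ∈ arr (H e) → y = 0 ∨ y = n + 1 →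
        rank (arr (H e)) (key n i y) = rank (arr (H e')) (key n i y) := by
      intro y hy hmem hy'
      have h3 : (key n i y, rank (arr (H e)) (key n i y)) ∈
          (items e).filter fun y => y.1 / (n + 2) = i :=
        mem_filter.2 ⟨(hitems e _).2 ⟨⟨hmem, by rw [key_mod _ hy]; exact hy'⟩, rfl⟩,
          key_div _ hy⟩
      rw [h2] at h3
      exact ((hitems e' _).1 (mem_filter.1 h3).1).2
    have h3 := key' 0 (by omega) (key_zero_mem_arr _ i) (.inl rfl)
    have h4 := key' (n + 1) (by omega) (key_last_mem_arr _ i) (.inr rfl)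
    rw [rank_arr_last, rank_arr_last] at h4
    have h5 : CliqueSim.pos (H e) i = CliqueSim.pos (H e') i := h3
    exact ⟨h5, by omega, h1⟩

/-- The data that the machines prepare before the simulation. -/
def static (s : ℕ) (H : SimpleGraph (Fin n)) (o : Fin n → ℕ) (i : Fin n) :
    (ℕ × ℕ) × ℕ × ℕ × Finset ℕ :=
  ((o i, gap o i), pos H i, NCCStar.deg H i, chunk (arr H) s i)

theorem reach_static {k S F D a : ℕ} {P : UnlabeledGraphProblem}
    (harb : ∀ G : SimpleGraph (Fin n), P.IsInstance G → arboricity G ≤ a)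
    (hk : 1 ≤ k) (ha : 1 ≤ a) (haS : 8 * a ≤ S)
    (hF0 : 0 < F) (hF : 2 * F * F ≤ S) (hD : 0 < D) (hFD : n + 1 ≤ F ^ D) :
    Reach (4 * k + 4) S ((18 * k + 20) * S) (placed (k := k) (n := n) (S := S) (P := P))
      ((5 * k + 7) * D * (D + 1)) fun e => static (4 * a) (relabel e) (orig e) := by
  classical
  have hsum : ∀ e : Instance k n S P,
      ∑ j, (NCCStar.nbrs (relabel e) j).card ≤ 2 * a * n := fun e =>
    (sum_card_nbrs_le e.1.1 (vert e)).trans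
      (Nat.mul_le_mul_right _ (Nat.mul_le_mul_left _ (harb _ e.2.1)))
  have hpairs : Stored ((2 * k + 1) * S) (edgePairs (k := k) (n := n) (S := S) (P := P)) := by
    have h1 : Small ({x | x < (n + 1) ^ k} ×ˢ {x | x < (n + 1) ^ k})
        ((n + 1) ^ (2 * k)) := by
      rw [two_mul, pow_add]
      exact (Small.range_lt _ fun _ h => h).prod (Small.range_lt _ fun _ h => h)
    refine Stored.finset h1 (fun e i => ?_) fun e i p hp => ?_
    · have := two_mul_card_edgePairs_le e i; omega
    · obtain ⟨x, y, -, -, rfl, -⟩ := mem_edgePairs.1 hp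
      exact ⟨orig_lt e x, orig_lt e y⟩
  have hdpairs : Det (placed (k := k) (n := n) (S := S) (P := P)) edgePairs := by
    intro i e e' h
    have h1 := (Prod.mk.inj h).2
    unfold edgePairs
    rw [h1]
  have s1 := (reach_orig (P := P) (S := S) (by omega) hF0 hF hD hFD hk).gap
    (fun e i => orig_lt e i) (by omega) (by omega) (by nlinarith)
  have s2 := (s1.keep hpairs (Det.refl _) hdpairs).mono
    (show _ ≤ 4 * k + 4 by omega) le_rfl (show _ ≤ (18 * k + 20) * S by nlinarith)
  have s3 := (reach_arr (fun e => relabel e) (fun e : Instance k n S P => orig e) edgePairs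
    orig_strictMono orig_lt ?_ ?_ ?_ two_mul_card_edgePairs_le hsum hk ha haS hF0 hF hD hFD).pos
    (b := (11 * k + 14) * S) (by omega) (by omega) (fun e => card_arr_le ha (hsum e)) (by omega)
    (by omega) (by nlinarith)
  · have hst : Stored (2 * k) fun (e : Instance k n S P) i => (orig e i, gap (orig e) i) :=
      ((Stored.nat orig_lt).prod (Stored.nat fun e i =>
        (Nat.sub_le _ _).trans_lt (orig_lt e i))).mono (by omega)
    have s4 := (s3.keep hst
      (X' := fun e i => ((orig e i, gap (orig e) i), edgePairs e i)) ?_ ?_).mono le_rfl le_rfl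
      (show _ ≤ (18 * k + 20) * S by nlinarith)
    · refine ((s2.trans s4).det_right ?_).pad ?_
      · intro i e e' h
        exact Prod.ext (Prod.mk.inj h).2 (Prod.mk.inj h).1
      · have : 2 ≤ D * (D + 1) := by nlinarith
        nlinarith
    · intro i e e' h
      simp only [Prod.mk.injEq] at h ⊢
      exact ⟨h.1.1, h.2⟩
    · intro i e e' h
      exact (Prod.mk.inj h).1
  · intro e i p hp
    obtain ⟨x, y, h1, h2, h3, -⟩ := mem_edgePairs.1 hp
    exact ⟨x, y, h1, h2, h3⟩
  · intro e x y h1 h2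
    exact ⟨_, mem_edgePairs.2 ⟨x, y, h1, h2, rfl, rfl⟩⟩
  · intro e i j p hi hj
    obtain ⟨x, y, -, -, rfl, h1⟩ := mem_edgePairs.1 hi
    obtain ⟨x', y', -, -, h, h2⟩ := mem_edgePairs.1 hj
    rw [Prod.mk.injEq] at h
    obtain rfl := (orig_strictMono e).injective h.1
    obtain rfl := (orig_strictMono e).injective h.2
    exact h1.symm.trans h2


/-! ## Searching in the array -/

variable {E : Type} {n : ℕ}

theorem exists_rank_eq {B : Finset ℕ} {r : ℕ} (hr : r < B.card) : ∃ z ∈ B, rank B z = r := by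
  have : r ∈ B.image (rank B) := by rw [image_rank]; exact mem_range.2 hr
  exact mem_image.1 this

theorem lt_of_rank_lt {B : Finset ℕ} {x y : ℕ} (h : rank B x < rank B y) : x < y := by
  by_contra h'
  have := rank_mono B (not_lt.1 h')
  omega

theorem rank_le_card (B : Finset ℕ) (x : ℕ) : rank B x ≤ B.card := card_filter_le _ _

/-- The key that is searched for in order to find the entry `q.2` of the list of `q.1`. -/
def skey (n : ℕ) (q : ℕ × ℕ) : ℕ := key n q.1 (q.2 + 1)

/-- The machine that holds the predecessor of the key. -/
def goal (s : ℕ) (H : SimpleGraph (Fin n)) (q : ℕ × ℕ) : ℕ := (rank (arr H) (skey n q + 1) - 1) / s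

/-- The machine at which the search starts. -/
def origin (s : ℕ) (H : SimpleGraph (Fin n)) (q : ℕ × ℕ) : ℕ := rank (arr H) (key n q.1 0) / s

/-- The machine at which the search is when there are `t` further levels. -/
def whereabouts (s F t : ℕ) (H : SimpleGraph (Fin n)) (q : ℕ × ℕ) : ℕ :=
  origin s H q + (goal s H q - origin s H q) / F ^ t * F ^ t

section Search

variable {H : SimpleGraph (Fin n)} {q : ℕ × ℕ} {s F t : ℕ}

theorem rank_key_lt_rank_skey (hq : q.1 < n) :
    rank (arr H) (key n q.1 0) < rank (arr H) (skey n q + 1) :=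
  rank_lt_rank (key_zero_mem_arr H ⟨q.1, hq⟩) (by unfold skey key; omega)

theorem origin_le_goal (hq : q.1 < n) : origin s H q ≤ goal s H q :=
  Nat.div_le_div_right (by have := rank_key_lt_rank_skey (H := H) hq; omega)

theorem goal_lt (hq : q.1 < n) (hs : 0 < s) (hcard : (arr H).card ≤ n * s) : goal s H q < n := by
  have h1 := rank_key_lt_rank_skey (H := H) hq
  have h2 := rank_le_card (arr H) (skey n q + 1)
  exact (Nat.div_lt_iff_lt_mul hs).2 (by omega)

/-- Whether a search has to go as far as machine `m` is decided by the smallest element of the chunk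
of `m`, so one word of information per machine is enough. -/
theorem le_goal_iff (hq : q.1 < n) (hs : 0 < s) (m : ℕ) :
    m ≤ goal s H q ↔ ∃ z ∈ chunk (arr H) s m, z ≤ skey n q := by
  have h1 := rank_key_lt_rank_skey (H := H) hq
  have h2 := rank_le_card (arr H) (skey n q + 1)
  constructor
  · intro h
    have h3 : s * m ≤ rank (arr H) (skey n q + 1) - 1 := by
      rw [mul_comm]; exact (Nat.le_div_iff_mul_le hs).1 h
    obtain ⟨z, hz, hr⟩ := exists_rank_eq (B := arr H) (r := s * m) (by omega)
    refine ⟨z, mem_chunk.2 ⟨hz, by rw [hr, Nat.mul_div_cancel_left _ hs]⟩, ?_⟩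
    have : z < skey n q + 1 := lt_of_rank_lt (B := arr H) (by rw [hr]; omega)
    omega
  · rintro ⟨z, hz, hle⟩
    obtain ⟨h3, rfl⟩ := mem_chunk.1 hz
    have : rank (arr H) z < rank (arr H) (skey n q + 1) :=
      rank_lt_rank h3 (Nat.lt_succ_of_le hle)
    exact Nat.div_le_div_right (by omega)

theorem le_whereabouts : origin s H q ≤ whereabouts s F t H q := Nat.le_add_right _ _

theorem whereabouts_le (hq : q.1 < n) : whereabouts s F t H q ≤ goal s H q := by
  have h1 := origin_le_goal (s := s) (H := H) hq
  have h2 := Nat.div_mul_le_self (goal s H q - origin s H q) (F ^ t)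
  unfold whereabouts
  omega

theorem whereabouts_zero (hq : q.1 < n) : whereabouts s F 0 H q = goal s H q := by
  have h1 := origin_le_goal (s := s) (H := H) hq
  simp only [whereabouts, pow_zero, Nat.div_one, mul_one]
  omega

theorem whereabouts_top (hg : goal s H q < F ^ t) : whereabouts s F t H q = origin s H q := by
  rw [whereabouts, Nat.div_eq_of_lt (by omega), zero_mul, add_zero]

theorem goal_sub_whereabouts (hq : q.1 < n) : goal s H q - whereabouts s F t H q =
    (goal s H q - origin s H q) % F ^ t := by
  have h1 := origin_le_goal (s := s) (H := H) hq
  have h2 := Nat.div_add_mod' (goal s H q - origin s H q) (F ^ t)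
  unfold whereabouts
  generalize (goal s H q - origin s H q) / F ^ t * F ^ t = x at *
  generalize (goal s H q - origin s H q) % F ^ t = y at *
  omega

/-- The distance from `origin` to `goal` is written in base `F`, and each level of the search
advances by its next digit, the highest digit first. -/
theorem whereabouts_succ (hF : 0 < F) (hq : q.1 < n) : whereabouts s F t H q =
    whereabouts s F (t + 1) H q +
      (goal s H q - whereabouts s F (t + 1) H q) / F ^ t * F ^ t := by
  rw [goal_sub_whereabouts hq]
  unfold whereabouts
  rw [add_assoc]
  congr 1
  generalize goal s H q - origin s H q = x
  have h0 : 0 < F ^ t := Nat.pow_pos hF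
  conv_lhs => rw [← Nat.div_add_mod' x (F ^ (t + 1))]
  rw [pow_succ, mul_comm (F ^ t) F, ← mul_assoc, add_comm, Nat.add_mul_div_right _ _ h0, add_mul,
    add_comm]

/-- The searched key and the first marker belong to the same block, and blocks are contiguous. So
all machines between `origin` and `goal` hold a part of this block, which bounds the number of hosts
whose searches can meet at one machine. -/
theorem exists_mem_chunk {m : ℕ} (hq : q.1 < n) (hq2 : q.2 < n) (hs : 0 < s)
    (h1 : origin s H q ≤ m) (h2 : m ≤ goal s H q) :
    ∃ z ∈ chunk (arr H) s m, z / (n + 2) = q.1 := by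
  have h3 := rank_key_lt_rank_skey (H := H) hq
  have h4 := rank_le_card (arr H) (skey n q + 1)
  have h5 : m * s ≤ rank (arr H) (skey n q + 1) - 1 := (Nat.le_div_iff_mul_le hs).1 h2
  have h6 : rank (arr H) (key n q.1 0) < (m + 1) * s :=
    (Nat.div_lt_iff_lt_mul hs).1 (Nat.lt_succ_of_le h1)
  rw [add_mul, one_mul] at h6
  obtain ⟨z, hz, hr⟩ := exists_rank_eq (B := arr H)
    (r := max (rank (arr H) (key n q.1 0)) (m * s)) (by omega)
  refine ⟨z, mem_chunk.2 ⟨hz, ?_⟩, ?_⟩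
  · rw [hr]
    refine Nat.div_eq_of_lt_le (le_max_right _ _) ?_
    rw [add_mul, one_mul]
    omega
  · have h7 : z < skey n q + 1 := lt_of_rank_lt (B := arr H) (by omega)
    have h8 : key n q.1 0 ≤ z := by
      by_contra h
      have := rank_lt_rank hz (not_le.1 h)
      omega
    unfold skey key at h7
    unfold key at h8
    refine Nat.div_eq_of_lt_le ?_ ?_
    · rw [mul_comm]; omega
    · rw [mul_comm, Nat.mul_succ]; omega

/-- A digit in base `F` is determined by `F` threshold tests. -/
theorem div_eq_div_of_le_iff {a b d F : ℕ} (hd : 0 < d) (ha : a < F * d) (hb : b < F * d)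
    (h : ∀ r < F, r * d ≤ a ↔ r * d ≤ b) : a / d = b / d := by
  have h1 := (h (a / d) ((Nat.div_lt_iff_lt_mul hd).2 ha)).1 (Nat.div_mul_le_self a d)
  have h2 := (h (b / d) ((Nat.div_lt_iff_lt_mul hd).2 hb)).2 (Nat.div_mul_le_self b d)
  exact le_antisymm ((Nat.le_div_iff_mul_le hd).2 h1) ((Nat.le_div_iff_mul_le hd).2 h2)

end Search

/-- The smallest element of a set, if there is one. -/
def minList (B : Finset ℕ) : List ℕ := if h : B.Nonempty then [B.min' h] else []

theorem length_minList_le (B : Finset ℕ) : (minList B).length ≤ 1 := by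
  unfold minList
  split_ifs <;> simp

theorem mem_of_mem_minList {B : Finset ℕ} {z : ℕ} (h : z ∈ minList B) : z ∈ B := by
  unfold minList at h
  split_ifs at h with hB
  · rw [List.mem_singleton.1 h]; exact min'_mem _ _
  · simp at h

theorem exists_mem_minList_iff {B : Finset ℕ} {x : ℕ} :
    (∃ z ∈ minList B, z ≤ x) ↔ ∃ z ∈ B, z ≤ x := by
  constructor
  · rintro ⟨z, hz, h⟩; exact ⟨z, mem_of_mem_minList hz, h⟩
  · rintro ⟨z, hz, h⟩
    have hB : B.Nonempty := ⟨z, hz⟩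
    exact ⟨B.min' hB, by simp [minList, hB], (min'_le _ _ hz).trans h⟩

-- All searches run in parallel. One round sends them to the first machine of the respective block,
-- each of the `D` levels takes two rounds, and one round returns the answers. The load of a machine
-- is at most `s * r`, since it meets at most `s` blocks and each host starts at most `r` searches.
set_option maxHeartbeats 1000000 in
theorem reach_ports {α : Type} {S F D s r b k : ℕ} (hk : 1 ≤ k) {X : E → Fin n → α}
    (H : E → SimpleGraph (Fin n))
    (Q : E → Fin n → Finset ℕ) (hQ : ∀ e j, ∀ x ∈ Q e j, x < n) (hQr : ∀ e j, (Q e j).card ≤ r)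
    (hdc : Det X fun e (i : Fin n) => chunk (arr (H e)) s i) (hdp : Det X fun e => pos (H e))
    (hdQ : Det X Q) (hX : Stored b X) (hs : 0 < s) (hcard : ∀ e, (arr (H e)).card ≤ n * s)
    (hsr : s * r ≤ S) (hr : 0 < r) (hF : 0 < F) (hFS : F ≤ S) (hFD : n ≤ F ^ D) :
    Reach 4 S (b + 5 * S) X (2 * D + 2) fun e j =>
      (X e j, fun x => if x ∈ Q e j then (NCCStar.canon hk (H e)).portOf j x else none) := by
  classical
  have hrS : r ≤ S := le_trans (Nat.le_mul_of_pos_left r hs) hsr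
  have hsS : s ≤ S := le_trans (Nat.le_mul_of_pos_right s hr) hsr
  let All : E → Finset (ℕ × ℕ) := fun e =>
    univ.biUnion fun j => (Q e j).image fun x => ((j : ℕ), x)
  have hAll : ∀ e q, q ∈ All e ↔ ∃ j : Fin n, ∃ x ∈ Q e j, ((j : ℕ), x) = q := by
    intro e q
    simp [All]
  have hmem : ∀ e (j : Fin n) x, ((j : ℕ), x) ∈ All e ↔ x ∈ Q e j := by
    intro e j x
    rw [hAll]
    constructor
    · rintro ⟨j', x', hx', h⟩
      rw [Prod.mk.injEq] at h
      obtain rfl := Fin.ext h.1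
      rw [← h.2]; exact hx'
    · intro h; exact ⟨j, x, h, rfl⟩
  have hAll1 : ∀ e, ∀ q ∈ All e, q.1 < n := by
    intro e q hq
    obtain ⟨j, x, -, rfl⟩ := (hAll e q).1 hq
    exact j.2
  have hAll2 : ∀ e, ∀ q ∈ All e, q.2 < n := by
    intro e q hq
    obtain ⟨j, x, hx, rfl⟩ := (hAll e q).1 hq
    exact hQ e j x hx
  have hnn : n < (n + 1) ^ 1 := by rw [pow_one]; omega
  have hsmall : Small {q : ℕ × ℕ | q.1 < n ∧ q.2 < n} ((n + 1) ^ 2) := by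
    have h1 : Small ({x | x < (n + 1) ^ 1} ×ˢ {x | x < (n + 1) ^ 1}) ((n + 1) ^ 1 * (n + 1) ^ 1) :=
      (Small.range_lt _ fun _ h => h).prod (Small.range_lt _ fun _ h => h)
    rw [← pow_add] at h1
    exact h1.mono (fun q hq => ⟨hq.1.trans hnn, hq.2.trans hnn⟩) le_rfl
  -- The number of searches of one home, and the number of searches at one machine.
  have hhome : ∀ e (j : Fin n), ((All e).filter fun q : ℕ × ℕ => q.1 = j).card ≤ r := by
    intro e j
    refine le_trans (card_le_card_of_injOn Prod.snd ?_ ?_) (hQr e j)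
    · intro q hq
      obtain ⟨h1, h2⟩ := mem_filter.1 hq
      obtain ⟨j', x, hx, rfl⟩ := (hAll e q).1 h1
      obtain rfl := Fin.ext h2
      exact hx
    · intro q hq q' hq' h
      exact Prod.ext ((mem_filter.1 hq).2.trans (mem_filter.1 hq').2.symm) h
  have hload : ∀ e t (m : Fin n),
      ((All e).filter fun q => whereabouts s F t (H e) q = m).card ≤ S := by
    intro e t m
    refine le_trans ?_ hsr
    -- The hosts whose blocks meet the chunk of `m`; no other search can be at `m`.
    let J := (chunk (arr (H e)) s m).image fun z => z / (n + 2)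
    have hJ : J.card ≤ s := card_image_le.trans (card_chunk_le _ hs _)
    have hsub : (All e).filter (fun q => whereabouts s F t (H e) q = m) ⊆
        J.biUnion fun j => (All e).filter fun q : ℕ × ℕ => q.1 = j := by
      intro q hq
      obtain ⟨h1, h2⟩ := mem_filter.1 hq
      obtain ⟨z, hz, hzj⟩ := exists_mem_chunk (H := H e) (m := m) (hAll1 e q h1) (hAll2 e q h1) hs
        (h2 ▸ le_whereabouts) (h2 ▸ whereabouts_le (hAll1 e q h1))
      exact mem_biUnion.2 ⟨q.1, mem_image.2 ⟨z, hz, hzj⟩, mem_filter.2 ⟨h1, rfl⟩⟩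
    refine (card_le_card hsub).trans (card_biUnion_le.trans ?_)
    refine (sum_le_card_nsmul J _ r ?_).trans ?_
    · intro j hj
      by_cases hjn : j < n
      · exact hhome e ⟨j, hjn⟩
      · have : (All e).filter (fun q : ℕ × ℕ => q.1 = j) = ∅ := by
          ext q
          simp only [mem_filter, notMem_empty, iff_false, not_and]
          intro h1 h2
          exact hjn (h2 ▸ hAll1 e q h1)
        simp [this]
    · rw [smul_eq_mul]; exact Nat.mul_le_mul_right _ hJ
  let at' : ℕ → E → Fin n → Finset (ℕ × ℕ) := fun t e m =>
    (All e).filter fun q => whereabouts s F t (H e) q = m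
  have hgoal : ∀ e, ∀ q ∈ All e, goal s (H e) q < n := fun e q hq =>
    goal_lt (hAll1 e q hq) hs (hcard e)
  have hlt : ∀ t e, ∀ q ∈ All e, whereabouts s F t (H e) q < n := fun t e q hq =>
    (whereabouts_le (hAll1 e q hq)).trans_lt (hgoal e q hq)
  have hat : ∀ t, Stored (3 * S) (at' t) := fun t =>
    Stored.finset hsmall (fun e m => hload e t m) fun e m q hq =>
      ⟨hAll1 e q (mem_filter.1 hq).1, hAll2 e q (mem_filter.1 hq).1⟩
  have hstart : Reach 4 S (b + 5 * S) X 1 fun e i => (X e i, at' D e i) := by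
    refine (Reach.loc (Det.refl X) (hX.mono (by omega))).move All (fun _ q => q.1)
      (fun e q => whereabouts s F D (H e) q) ?_ ?_ hAll1 ?_ (fun e => hload e D) (Det.refl _)
      ((hX.prod (hat D)).mono (by omega))
    · refine hsmall.mono ?_ (Nat.pow_le_pow_right (by omega) (by omega))
      rintro q ⟨e, hq⟩
      exact ⟨hAll1 e q hq, hAll2 e q hq⟩
    · intro j e e' hY q hq hqj
      obtain ⟨j', x, hx, rfl⟩ := (hAll e q).1 hq
      obtain rfl := Fin.ext hqj
      have hq' : ((j' : ℕ), x) ∈ All e' := (hmem e' j' x).2 (hdQ j' e e' hY ▸ hx)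
      refine ⟨hq', rfl, ?_⟩
      rw [whereabouts_top ((hgoal e _ hq).trans_le hFD),
        whereabouts_top ((hgoal e' _ hq').trans_le hFD)]
      have := hdp j' e e' hY
      unfold origin
      exact congrArg (· / s) this.symm
    · intro e j
      exact (hhome e j).trans hrS
  have hlevel : ∀ t, Reach 4 S (b + 5 * S) (fun e i => (X e i, at' (t + 1) e i)) 2
      fun e i => (X e i, at' t e i) := by
    intro t
    have hFt : 0 < F ^ t := Nat.pow_pos hF
    -- Every search together with its next stop, which the current machine can compute once it knows
    -- the smallest elements at the possible stops.
    let next : E → Fin n → Finset ((ℕ × ℕ) × ℕ) := fun e i =>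
      (at' (t + 1) e i).image fun q => (q, whereabouts s F t (H e) q)
    have hnext : Stored (4 * S) next := by
      have h1 : Small ({q : ℕ × ℕ | q.1 < n ∧ q.2 < n} ×ˢ {x | x < (n + 1) ^ 1})
          ((n + 1) ^ 3) := by
        rw [pow_succ _ 2]
        refine hsmall.prod ?_
        rw [pow_one]
        exact Small.range_lt _ fun _ h => h
      refine Stored.finset h1 (fun e m => card_image_le.trans (hload e _ m)) fun e m y hy => ?_
      obtain ⟨q, hq, rfl⟩ := mem_image.1 hy
      have hq := (mem_filter.1 hq).1
      exact ⟨⟨hAll1 e q hq, hAll2 e q hq⟩, (hlt t e q hq).trans hnn⟩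
    have hdiff : ∀ m : Fin n, ∀ p : Fin n → Fin n → Prop, (∀ j i, p j i → ∃ c < F,
        (j : ℕ) = i + c * F ^ t) → (univ.filter fun j => p j m).card ≤ F ∧
        (univ.filter fun i => p m i).card ≤ F := by
      intro m p hp
      constructor
      · rw [← card_range F]
        refine card_le_card_of_injOn (fun j => ((j : ℕ) - m) / F ^ t) ?_ ?_
        · intro j hj
          obtain ⟨c, hc, h⟩ := hp j m (mem_filter.1 hj).2
          simp only [h, Nat.add_sub_cancel_left, Nat.mul_div_cancel _ hFt]
          exact mem_range.2 hc
        · intro j hj j' hj' hjj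
          obtain ⟨c, hc, h⟩ := hp j m (mem_filter.1 hj).2
          obtain ⟨c', hc', h'⟩ := hp j' m (mem_filter.1 hj').2
          simp only [h, h', Nat.add_sub_cancel_left, Nat.mul_div_cancel _ hFt] at hjj
          exact Fin.ext (by rw [h, h', hjj])
      · rw [← card_range F]
        refine card_le_card_of_injOn (fun i => ((m : ℕ) - i) / F ^ t) ?_ ?_
        · intro i hi
          obtain ⟨c, hc, h⟩ := hp m i (mem_filter.1 hi).2
          simp only [h, Nat.add_sub_cancel_left, Nat.mul_div_cancel _ hFt]
          exact mem_range.2 hc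
        · intro i hi i' hi' hii
          obtain ⟨c, hc, h⟩ := hp m i (mem_filter.1 hi).2
          obtain ⟨c', hc', h'⟩ := hp m i' (mem_filter.1 hi').2
          have e1 : (m : ℕ) - i = c * F ^ t := by omega
          have e2 : (m : ℕ) - i' = c' * F ^ t := by omega
          simp only [e1, e2, Nat.mul_div_cancel _ hFt] at hii
          subst hii
          exact Fin.ext (by omega)
    obtain ⟨near, hnear⟩ : ∃ near : Fin n → Fin n → Prop, ∀ j i, near j i ↔
      ∃ c < F, (j : ℕ) = i + c * F ^ t := ⟨_, fun _ _ => Iff.rfl⟩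
    have hsum : ∀ (p : Fin n → Prop) (f : Fin n → Finset ℕ),
        ∑ j, (if p j then minList (f j) else []).length ≤ (univ.filter p).card := by
      intro p f
      rw [card_filter]
      refine sum_le_sum fun j _ => ?_
      by_cases hp : p j
      · simpa [hp] using length_minList_le (f j)
      · simp [hp]
    -- The pattern of communication does not depend on the searches: every machine sends the minimum
    -- of its chunk to the at most `F` machines from which a search can jump to it at this level.
    have hfence : Reach 4 S (b + 5 * S) (fun e i => (X e i, at' (t + 1) e i)) 1
        fun e i => (X e i, next e i) := by
      refine .round (.loc (Det.refl _) ((hX.prod (hat _)).mono (by omega)))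
        (M := fun e j i => if near j i then minList (chunk (arr (H e)) s j) else [])
        ⟨?_, ?_, ?_, ?_⟩ ?_ ((hX.prod hnext).mono (by omega))
      · refine Small.mono (m := (n + 1) ^ 2) (Small.range_lt {x | x < (n + 1) ^ 2} fun _ h => h) ?_
          (Nat.pow_le_pow_right (by omega) (by omega))
        rintro z ⟨e, j, i, hz⟩
        split_ifs at hz
        · exact lt_of_mem_arr (mem_chunk.1 (mem_of_mem_minList hz)).1
        · simp at hz
      · intro j e e' h
        have := hdc j e e' (Prod.mk.inj h).1
        simp only at this
        simp only [this]
      · intro e j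
        exact (hsum _ _).trans ((hdiff j near fun _ _ => (hnear _ _).1).2.trans hFS)
      · intro e i
        exact (hsum (fun j => near j i) _).trans ((hdiff i near fun _ _ => (hnear _ _).1).1.trans hFS)
      · intro i e e' h
        simp only [Prod.mk.injEq] at h ⊢
        obtain ⟨⟨h1, h2⟩, h3⟩ := h
        refine ⟨h1, ?_⟩
        simp only [next]
        rw [h2]
        refine image_congr fun q hq' => ?_
        have hqe' := mem_filter.1 hq'
        have hqe := mem_filter.1 (h2 ▸ hq' : q ∈ at' (t + 1) e i)
        have hq1 := hAll1 e q hqe.1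
        refine Prod.ext rfl ?_
        simp only
        rw [whereabouts_succ (H := H e) (t := t) hF hq1, whereabouts_succ (H := H e') (t := t) hF hq1,
          hqe.2, hqe'.2]
        have a1 := goal_sub_whereabouts (H := H e) (s := s) (F := F) (t := t + 1) hq1
        have a2 := goal_sub_whereabouts (H := H e') (s := s) (F := F) (t := t + 1) hq1
        have a3 := whereabouts_le (H := H e) (s := s) (F := F) (t := t + 1) hq1
        have a4 := whereabouts_le (H := H e') (s := s) (F := F) (t := t + 1) hq1
        rw [hqe.2] at a1 a3
        rw [hqe'.2] at a2 a4
        have hpow : 0 < F ^ (t + 1) := Nat.pow_pos hF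
        have b1 := Nat.mod_lt (goal s (H e) q - origin s (H e) q) hpow
        have b2 := Nat.mod_lt (goal s (H e') q - origin s (H e') q) hpow
        rw [← a1, pow_succ, mul_comm] at b1
        rw [← a2, pow_succ, mul_comm] at b2
        congr 2
        refine div_eq_div_of_le_iff hFt b1 b2 fun c hc => ?_
        have c1 : c * F ^ t ≤ goal s (H e) q - i ↔ i + c * F ^ t ≤ goal s (H e) q := by omega
        have c2 : c * F ^ t ≤ goal s (H e') q - i ↔ i + c * F ^ t ≤ goal s (H e') q := by omega
        rw [c1, c2]
        by_cases hm : i + c * F ^ t < n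
        · have h4 := congrFun h3 ⟨_, hm⟩
          have h5 : near ⟨i + c * F ^ t, hm⟩ i := (hnear _ _).2 ⟨c, hc, rfl⟩
          simp only [h5, if_true] at h4
          rw [le_goal_iff hq1 hs, le_goal_iff hq1 hs, ← exists_mem_minList_iff,
            ← exists_mem_minList_iff, h4]
        -- The candidate is not a machine, while both goals are, so the test fails on both sides.
        · have d1 := hgoal e q hqe.1
          have d2 := hgoal e' q hqe'.1
          constructor <;> intro <;> omega
    refine hfence.move All (fun e q => whereabouts s F (t + 1) (H e) q)
      (fun e q => whereabouts s F t (H e) q) ?_ ?_ (hlt (t + 1)) (fun e => hload e _)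
      (fun e => hload e _) ?_ ((hX.prod (hat t)).mono (by omega))
    · refine hsmall.mono ?_ (Nat.pow_le_pow_right (by omega) (by omega))
      rintro q ⟨e, hq⟩
      exact ⟨hAll1 e q hq, hAll2 e q hq⟩
    · intro j e e' hY q hq hqj
      have h1 : (q, whereabouts s F t (H e) q) ∈ next e j :=
        mem_image.2 ⟨q, mem_filter.2 ⟨hq, hqj⟩, rfl⟩
      rw [(Prod.mk.inj hY).2] at h1
      obtain ⟨q', hq', h2⟩ := mem_image.1 h1
      rw [Prod.mk.injEq] at h2
      obtain ⟨rfl, h2⟩ := h2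
      exact ⟨(mem_filter.1 hq').1, (mem_filter.1 hq').2, h2⟩
    · intro i e e' h
      simp only [Prod.mk.injEq] at h ⊢
      exact ⟨h.1.1, h.2⟩
  have hsearch : ∀ t ≤ D, Reach 4 S (b + 5 * S) X (1 + 2 * t)
      fun e i => (X e i, at' (D - t) e i) := by
    intro t
    induction t with
    | zero => intro _; exact hstart
    | succ t ih =>
      intro ht
      have h1 := hlevel (D - (t + 1))
      rw [show D - (t + 1) + 1 = D - t by omega] at h1
      exact (ih (by omega)).trans h1
  have hfound := hsearch D le_rfl
  rw [Nat.sub_self] at hfound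
  -- The answers are sent back.
  let val : E → ℕ × ℕ → ℕ := fun e q =>
    if skey n q ∈ arr (H e) then rank (arr (H e)) (skey n q) else 0
  have hval : ∀ e q, val e q < (n + 1) ^ 2 := by
    intro e q
    simp only [val]
    split_ifs with h
    · exact rank_arr_lt h
    · exact Nat.pow_pos (by omega)
  let ans : E → Finset ((ℕ × ℕ) × ℕ) := fun e => (All e).image fun q => (q, val e q)
  have hans : ∀ e y, y ∈ ans e ↔ y.1 ∈ All e ∧ y.2 = val e y.1 := by
    intro e y
    simp only [ans, mem_image]
    constructor
    · rintro ⟨q, hq, rfl⟩; exact ⟨hq, rfl⟩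
    · rintro ⟨h1, h2⟩; exact ⟨_, h1, Prod.ext rfl h2.symm⟩
  have hansinj : ∀ e, Set.InjOn Prod.fst (ans e : Set ((ℕ × ℕ) × ℕ)) := by
    intro e y hy y' hy' h
    exact Prod.ext h (by rw [((hans e y).1 hy).2, ((hans e y').1 hy').2, h])
  have hsmall' : Small {y : (ℕ × ℕ) × ℕ | (y.1.1 < n ∧ y.1.2 < n) ∧ y.2 < (n + 1) ^ 2}
      ((n + 1) ^ 4) := by
    have h1 := hsmall.prod (Small.range_lt {x | x < (n + 1) ^ 2} fun _ h => h)
    rw [← pow_add] at h1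
    exact h1.mono (fun y hy => ⟨hy.1, hy.2⟩) le_rfl
  have hanssmall : ∀ e, ∀ y ∈ ans e, (y.1.1 < n ∧ y.1.2 < n) ∧ y.2 < (n + 1) ^ 2 := by
    intro e y hy
    obtain ⟨h1, h2⟩ := (hans e y).1 hy
    exact ⟨⟨hAll1 e _ h1, hAll2 e _ h1⟩, h2 ▸ hval e _⟩
  have hhome' : ∀ e (j : Fin n), ((ans e).filter fun y : (ℕ × ℕ) × ℕ => y.1.1 = j).card ≤ S := by
    intro e j
    refine le_trans (card_le_card_of_injOn Prod.fst ?_ ?_) ((hhome e j).trans hrS)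
    · intro y hy
      obtain ⟨h1, h2⟩ := mem_filter.1 hy
      exact mem_filter.2 ⟨((hans e y).1 h1).1, h2⟩
    · exact (hansinj e).mono (by intro y hy; exact (mem_filter.1 hy).1)
  have hfst : Stored (5 * S) fun e (j : Fin n) => (ans e).filter fun y : (ℕ × ℕ) × ℕ => y.1.1 = j :=
    Stored.finset hsmall' hhome' fun e j y hy => hanssmall e y (mem_filter.1 hy).1
  have hfinal : Reach 4 S (b + 5 * S) X (1 + 2 * D + 1)
      fun e (j : Fin n) => (X e j, (ans e).filter fun y : (ℕ × ℕ) × ℕ => y.1.1 = j) := by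
    refine hfound.move ans (fun e y => whereabouts s F 0 (H e) y.1) (fun _ y => y.1.1) ?_ ?_ ?_ ?_
      hhome' ?_ (hX.prod hfst)
    · refine hsmall'.mono ?_ le_rfl
      rintro y ⟨e, hy⟩
      exact hanssmall e y hy
    · intro j e e' hY y hy hyj
      obtain ⟨h1, h2⟩ := (hans e y).1 hy
      simp only [Prod.mk.injEq] at hY
      have h3 : y.1 ∈ at' 0 e' j := hY.2 ▸ mem_filter.2 ⟨h1, hyj⟩
      obtain ⟨h4, h5⟩ := mem_filter.1 h3
      refine ⟨(hans e' y).2 ⟨h4, ?_⟩, h5, rfl⟩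
      have hch := hdc j e e' hY.1
      simp only at hch
      -- A key that is present is its own predecessor, so it lies at the machine where the search
      -- ends. Membership in the array is therefore a local test.
      have hin : ∀ e, whereabouts s F 0 (H e) y.1 = j →
          (skey n y.1 ∈ arr (H e) ↔ skey n y.1 ∈ chunk (arr (H e)) s j) := by
        intro e he
        refine ⟨fun h => mem_chunk.2 ⟨h, ?_⟩, fun h => (mem_chunk.1 h).1⟩
        rw [whereabouts_zero (hAll1 _ _ h4)] at he
        rw [← he, goal]
        congr 1
        have : (arr (H e)).filter (· < skey n y.1 + 1) =
            insert (skey n y.1) ((arr (H e)).filter (· < skey n y.1)) := by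
          ext z
          simp only [mem_filter, mem_insert]
          constructor
          · rintro ⟨h1, h2⟩
            rcases (Nat.lt_succ_iff_lt_or_eq.1 h2) with h2 | h2
            · exact .inr ⟨h1, h2⟩
            · exact .inl h2
          · rintro (rfl | ⟨h1, h2⟩)
            · exact ⟨h, Nat.lt_succ_self _⟩
            · exact ⟨h1, h2.trans (Nat.lt_succ_self _)⟩
        unfold rank
        rw [this, card_insert_of_notMem (by simp), Nat.add_sub_cancel]
      rw [h2]
      simp only [val]
      by_cases hc : skey n y.1 ∈ chunk (arr (H e)) s j
      · have hc' : skey n y.1 ∈ chunk (arr (H e')) s j := hch ▸ hc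
        rw [if_pos ((hin e hyj).2 hc), if_pos ((hin e' h5).2 hc'), rank_eq_of_mem_chunk hs hc,
          rank_eq_of_mem_chunk hs hc', hch]
      · have hc' : skey n y.1 ∉ chunk (arr (H e')) s j := hch ▸ hc
        rw [if_neg (mt (hin e hyj).1 hc), if_neg (mt (hin e' h5).1 hc')]
    · intro e y hy
      exact hlt 0 e _ ((hans e y).1 hy).1
    · intro e j
      refine le_trans (card_le_card_of_injOn Prod.fst ?_ ?_) (hload e 0 j)
      · intro y hy
        obtain ⟨h1, h2⟩ := mem_filter.1 hy
        exact mem_filter.2 ⟨((hans e y).1 h1).1, h2⟩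
      · exact (hansinj e).mono (by intro y hy; exact (mem_filter.1 hy).1)
    · intro i e e' h
      simp only [Prod.mk.injEq] at h ⊢
      exact ⟨h.1.1, h.2⟩
  refine (hfinal.det_right ?_).pad (by omega)
  intro j e e' h
  simp only [Prod.mk.injEq] at h ⊢
  obtain ⟨h1, h2⟩ := h
  refine ⟨h1, funext fun x => ?_⟩
  rw [hdQ j e e' h1]
  split_ifs with hx
  · have hx0 : x ∈ Q e j := hdQ j e e' h1 ▸ hx
    have h3 : (((j : ℕ), x), val e (j, x)) ∈ (ans e).filter fun y : (ℕ × ℕ) × ℕ => y.1.1 = j :=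
      mem_filter.2 ⟨(hans e _).2 ⟨(hmem e j x).2 hx0, rfl⟩, rfl⟩
    rw [h2] at h3
    have h4 : val e (j, x) = val e' (j, x) := ((hans e' _).1 (mem_filter.1 h3).1).2
    have hp := hdp j e e' h1
    have hxn := hQ e j x hx0
    -- The value 0 can stand for absence, because the first marker precedes every neighbour entry,
    -- which therefore has positive rank. The port is the rank relative to the block, minus one for
    -- the marker.
    have hport : ∀ e, (NCCStar.canon hk (H e)).portOf j x =
        if val e (j, x) = 0 then none else some (val e (j, x) - pos (H e) j - 1) := by
      intro e
      ext p
      rw [NCCStar.canon_portOf, ← key_succ_mem_arr (H := H e) hxn]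
      simp only [val, skey]
      by_cases hm : key n j (x + 1) ∈ arr (H e)
      · have h5 := rank_arr_key (H e) j hxn.le
        simp only [hm, true_and, if_true, h5]
        rw [if_neg (by omega), Option.some.injEq]
        omega
      · simp [hm]
    rw [hport, hport, h4]
    simp only at hp
    rw [hp]
  · rfl


/-! ## Lists of messages as lists of words -/

/-- A list with a mark at its first entry. -/
def marked {α : Type} : List α → List (α × Bool)
  | [] => []
  | w :: l => (w, true) :: l.map fun x => (x, false)

/-- Several lists in a row. -/
def flat {α : Type} (ps : List (List α)) : List (α × Bool) := ps.flatMap marked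

/-- The inverse of `flat`, together with the entries in front of the first mark. -/
def unflat {α : Type} : List (α × Bool) → List α × List (List α)
  | [] => ([], [])
  | (w, false) :: l => (w :: (unflat l).1, (unflat l).2)
  | (w, true) :: l => ([], (w :: (unflat l).1) :: (unflat l).2)

/-- The marks show where the lists begin. Empty lists leave no trace, hence the assumption, which
holds for messages. -/
theorem unflat_flat {α : Type} (ps : List (List α)) (h : ∀ p ∈ ps, p ≠ []) :
    unflat (flat ps) = ([], ps) := by
  induction ps with
  | nil => rfl
  | cons p ps ih =>
    rcases p with _ | ⟨w, l⟩
    · exact absurd rfl (h [] (by simp))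
    · have h1 := ih fun q hq => h q (by simp [hq])
      have h2 : ∀ l : List α, unflat ((l.map fun x => (x, false)) ++ flat ps) = (l, ps) := by
        intro l
        induction l with
        | nil => exact h1
        | cons x l ih' => simp only [List.map_cons, List.cons_append, unflat, ih']
      simp only [flat, List.flatMap_cons, marked, List.cons_append, unflat]
      rw [show List.flatMap marked ps = flat ps from rfl, h2]

theorem length_flat {α : Type} (ps : List (List α)) :
    (flat ps).length = (ps.map List.length).sum := by
  rw [flat, List.length_flatMap]
  congr 2
  funext l
  cases l <;> simp [marked]

theorem mem_flat {α : Type} {ps : List (List α)} {y : α × Bool} (h : y ∈ flat ps) :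
    ∃ p ∈ ps, y.1 ∈ p := by
  obtain ⟨p, hp, hy⟩ := List.mem_flatMap.1 h
  refine ⟨p, hp, ?_⟩
  cases p with
  | nil => simp [marked] at hy
  | cons w l =>
    simp only [marked, List.mem_cons, List.mem_map] at hy
    rcases hy with rfl | ⟨x, hx, rfl⟩
    · simp
    · simp [hx]

/-- An inbox that holds at most `C` words, in messages of `n` nodes. -/
structure InboxOK (κ C n : ℕ) (I : Inbox) : Prop where
  words : I.words ≤ C
  sender : ∀ m ∈ I, m.1 < n
  ne_nil : ∀ m ∈ I, m.2 ≠ []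
  word : ∀ m ∈ I, ∀ x ∈ m.2, IsWord κ n x

/-- An inbox is recovered from a list of at most `C` triples of a sender, a word and a mark. Such a
triple has at most `(n + 1) ^ (κ + 2)` values, and the bound for lists adds one more to the
exponent. -/
theorem small_inbox {κ C n : ℕ} (hn : 0 < n) :
    Small {I | InboxOK κ C n I} ((n + 1) ^ ((κ + 3) * C)) := by
  have h1 : Small (({x : ℕ | x < n} ×ˢ {x | x < (n + 1) ^ κ}) ×ˢ (Set.univ : Set Bool))
      ((n + 1) ^ (κ + 2)) := by
    refine (((Small.range_lt _ fun _ h => h).prod (Small.range_lt _ fun _ h => h)).prod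
      (m' := 2) ?_).mono subset_rfl ?_
    · exact Small.of_code (fun b => b.toNat) (by intro a _ b _ h; cases a <;> cases b <;> simp_all)
        (by intro b _; cases b <;> simp)
    · have := Nat.one_le_pow κ (n + 1) (by omega)
      rw [pow_add, mul_comm n, mul_assoc]
      exact Nat.mul_le_mul_left _ (by nlinarith)
  have h2 := ((h1.list C).image fun l => (((unflat l).2.map fun q =>
    ((q.head?.getD (0, 0)).1, q.map Prod.snd) : List (ℕ × List ℕ)) : Inbox)).le_pow hn le_rfl
  refine h2.mono ?_ le_rfl
  intro I hI
  induction I using Quotient.inductionOn with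
  | _ l =>
    have hl : ∀ m ∈ l, m ∈ ((l : Multiset (ℕ × List ℕ)) : Inbox) := fun m hm => hm
    let ps : List (List (ℕ × ℕ)) := l.map fun m => m.2.map fun x => (m.1, x)
    have hps : ∀ p ∈ ps, p ≠ [] := by
      intro p hp
      obtain ⟨m, hm, rfl⟩ := List.mem_map.1 hp
      simpa using hI.ne_nil m (hl m hm)
    refine ⟨flat ps, ⟨?_, ?_⟩, ?_⟩
    · have h3 := hI.words
      rw [length_flat, List.map_map]
      refine le_trans (le_of_eq ?_) h3
      simp only [Inbox.words, Multiset.quot_mk_to_coe, Multiset.map_coe, Multiset.sum_coe]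
      congr 2
      funext m
      simp
    · intro y hy
      obtain ⟨p, hp, hyp⟩ := mem_flat hy
      obtain ⟨m, hm, rfl⟩ := List.mem_map.1 hp
      obtain ⟨x, hx, hxy⟩ := List.mem_map.1 hyp
      refine ⟨⟨?_, ?_⟩, Set.mem_univ _⟩
      · rw [← hxy]; exact hI.sender m (hl m hm)
      · rw [← hxy]; exact hI.word m (hl m hm) x hx
    · simp only [unflat_flat ps hps, ps, List.map_map]
      refine congrArg _ ?_
      refine (List.map_congr_left ?_).trans (List.map_id l)
      intro m hm
      have h3 := hI.ne_nil m (hl m hm)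
      obtain ⟨w, t, h4⟩ := List.exists_cons_of_ne_nil h3
      refine Prod.ext ?_ ?_
      · simp [h4]
      · simp [Function.comp_def]

/-! ### The identifiers present at a node -/

section Ncc

open NCCStar

variable {n k : ℕ}

/-- The possible identifiers that are present at a node. -/
def present (c : NCCStar.Config n) (j : Fin n) : Finset ℕ :=
  ((c.mem j).toFinset ∪ (c.inbox j).toFinset.biUnion fun m => insert m.1 m.2.toFinset).filter
    (· < n)

/-- The memory contributes at most `C`. The inbox contributes at most `C` words and, as messages are
not empty, at most `C` senders. -/
theorem card_present_le {c : NCCStar.Config n} {j : Fin n} {κ C : ℕ} (hc : MemoryOK κ C c)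
    (hi : InboxOK κ C n (c.inbox j)) : (present c j).card ≤ 3 * C := by
  have h1 : ∀ I : Inbox, (∀ m ∈ I, m.2 ≠ []) →
      (I.toFinset.biUnion fun m => insert m.1 m.2.toFinset).card ≤ 2 * Inbox.words I := by
    intro I
    induction I using Multiset.induction_on with
    | empty => intro _; simp
    | cons m I ih =>
      intro h
      have h2 := ih fun m' hm' => h m' (Multiset.mem_cons_of_mem hm')
      have h3 : 1 ≤ m.2.length := List.length_pos_iff.2 (h m (Multiset.mem_cons_self _ _))
      rw [Multiset.toFinset_cons, biUnion_insert]
      refine (card_union_le _ _).trans ?_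
      have h4 : (insert m.1 m.2.toFinset).card ≤ m.2.length + 1 :=
        (card_insert_le _ _).trans (Nat.add_le_add_right (List.toFinset_card_le _) 1)
      have h5 : Inbox.words (m ::ₘ I) = m.2.length + Inbox.words I := by simp [Inbox.words]
      rw [h5]
      omega
  refine (card_filter_le _ _).trans ((card_union_le _ _).trans ?_)
  have h2 := h1 (c.inbox j) hi.ne_nil
  have h3 := (List.toFinset_card_le (c.mem j)).trans (hc j).1
  have h4 := hi.words
  omega

/-- In the canonical representation numbers from `n` on are not identifiers, so nothing is lost by
restricting the queries to numbers below `n`. -/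
theorem lookup_canon (hk : 1 ≤ k) (H : SimpleGraph (Fin n)) (c : NCCStar.Config n) (j : Fin n) :
    lookup (canon hk H) c j =
      fun x => if x ∈ present c j then (canon hk H).portOf j x else none := by
  funext x
  unfold lookup
  by_cases h1 : x ∈ present c j
  · rw [if_pos h1, if_pos]
    simp only [present, mem_filter, mem_union, mem_biUnion, List.mem_toFinset,
      Multiset.mem_toFinset, mem_insert] at h1
    exact h1.1
  · rw [if_neg h1]
    split_ifs with h2
    · by_cases hx : x < n
      · refine absurd ?_ h1
        simp only [present, mem_filter, mem_union, mem_biUnion, List.mem_toFinset,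
          Multiset.mem_toFinset, mem_insert]
        exact ⟨h2, hx⟩
      · rw [Option.eq_none_iff_forall_ne_some]
        intro p hp
        exact hx (lt_of_mem_nbrs ((canon_portOf hk).1 hp).1)
    · rfl

theorem inboxOK_next (hk : 1 ≤ k) {H : SimpleGraph (Fin n)} {A : NCCStarAlgorithm} {κ C : ℕ}
    {c : NCCStar.Config n} (h : RoundOK A (canon hk H) κ C c) (j : Fin n) :
    InboxOK κ C n ((NCCStar.next A (canon hk H) c).inbox j) := by
  have hmem : ∀ m ∈ delivered A (canon hk H) c j, ∃ u : Fin n, ∃ m' ∈ (act A (canon hk H) c u).2,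
      m = ((u : ℕ), m'.2) := by
    intro m hm
    rw [delivered, Multiset.mem_sum] at hm
    obtain ⟨u, -, hu⟩ := hm
    rw [Multiset.mem_coe, List.mem_map] at hu
    obtain ⟨m', hm', rfl⟩ := hu
    exact ⟨u, m', (List.mem_filter.1 hm').1, rfl⟩
  refine ⟨(h j).2.2, ?_, ?_, ?_⟩
  · intro m hm
    obtain ⟨u, m', -, rfl⟩ := hmem m hm
    exact u.2
  · intro m hm
    obtain ⟨u, m', hm', rfl⟩ := hmem m hm
    exact ((h u).2.1 m' hm').1
  · intro m hm
    obtain ⟨u, m', hm', rfl⟩ := hmem m hm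
    exact ((h u).2.1 m' hm').2.1

end Ncc


/-! ## Simulating a round -/

section Simulation

open NCCStar

variable {E : Type} {n k κ C S F D s : ℕ}

/-- The data of a machine in the simulation of a configuration. -/
def simState (s : ℕ) (H : SimpleGraph (Fin n)) (o : Fin n → ℕ) (c : NCCStar.Config n) (j : Fin n) :
    ((ℕ × ℕ) × ℕ × ℕ × Finset ℕ) × List ℕ × Inbox :=
  (static s H o j, c.mem j, c.inbox j)

theorem stored_static (H : E → SimpleGraph (Fin n)) (o : E → Fin n → ℕ)
    (ho : ∀ e j, o e j < (n + 1) ^ k) (hs : 0 < s) (hsS : s ≤ S) :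
    Stored ((2 * k + 6) * S) fun e => static s (H e) (o e) := by
  have h1 : Stored 1 fun e (i : Fin n) => NCCStar.deg (H e) i := Stored.nat fun e i => by
    rw [← NCCStar.card_nbrs, pow_one]
    have : NCCStar.nbrs (H e) i ⊆ range n := fun x hx => mem_range.2 (lt_of_mem_nbrs hx)
    have := card_le_card this
    rw [card_range] at this
    omega
  exact (((Stored.nat ho).prod (Stored.nat fun e i =>
    (Nat.sub_le _ _).trans_lt (ho e i))).prod ((Stored.nat (u := 2) fun e i =>
      rank_arr_lt (key_zero_mem_arr (H e) i)).prod (h1.prod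
        (stored_chunk_arr H hs hsS)))).mono (by nlinarith)

theorem stored_simState (H : E → SimpleGraph (Fin n)) (o : E → Fin n → ℕ)
    (c : E → NCCStar.Config n) (ho : ∀ e j, o e j < (n + 1) ^ k) (hs : 0 < s) (hsS : s ≤ S)
    (hCS : C ≤ S) (hc : ∀ e, MemoryOK κ C (c e)) (hi : ∀ e j, InboxOK κ C n ((c e).inbox j)) :
    Stored ((2 * k + 2 * κ + 10) * S) fun e => simState s (H e) (o e) (c e) := by
  have h2 : Stored ((κ + 1) * C) fun e (j : Fin n) => (c e).mem j :=
    Stored.list (U := {x | x < (n + 1) ^ κ}) (Small.range_lt _ fun _ h => h)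
      (fun e j => (hc e j).1) fun e j => (hc e j).2
  have h3 : Stored ((κ + 3) * C) fun e (j : Fin n) => (c e).inbox j := fun j =>
    (small_inbox (κ := κ) (C := C) j.pos).mono (by rintro _ ⟨e, rfl⟩; exact hi e j) le_rfl
  exact ((stored_static H o ho hs hsS).prod (h2.prod h3)).mono (by nlinarith)

theorem det_present {H : E → SimpleGraph (Fin n)} {o : E → Fin n → ℕ}
    {c : E → NCCStar.Config n} :
    Det (fun e => simState s (H e) (o e) (c e)) fun e => present (c e) := by
  intro j e e' h
  simp only [simState, Prod.mk.injEq] at h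
  change present (c e) j = present (c e') j
  unfold present
  rw [h.2.1, h.2.2]

/-- The program may evaluate the lookup function wherever it likes, so it is computed in advance at
all identifiers that are present. -/
theorem reach_portOf (hk : 1 ≤ k) (H : E → SimpleGraph (Fin n)) (o : E → Fin n → ℕ)
    (c : E → NCCStar.Config n) (ho : ∀ e j, o e j < (n + 1) ^ k) (hs : 0 < s)
    (hC : 0 < C) (hsC : s * (3 * C) ≤ S) (hcard : ∀ e, (arr (H e)).card ≤ n * s)
    (hF : 0 < F) (hFS : F ≤ S) (hFD : n ≤ F ^ D)
    (hc : ∀ e, MemoryOK κ C (c e)) (hi : ∀ e j, InboxOK κ C n ((c e).inbox j)) :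
    Reach 4 S ((2 * k + 2 * κ + 15) * S) (fun e => simState s (H e) (o e) (c e)) (2 * D + 2)
      fun e j => (simState s (H e) (o e) (c e) j, lookup (canon hk (H e)) (c e) j) := by
  have h1 : 3 * C ≤ S := (Nat.le_mul_of_pos_left _ hs).trans hsC
  have h2 : s ≤ S := (Nat.le_mul_of_pos_right s (by omega)).trans hsC
  have h := reach_ports (S := S) (D := D) hk H (fun e => present (c e))
    (X := fun e => simState s (H e) (o e) (c e))
    (fun e j x hx => (mem_filter.1 hx).2) (fun e j => card_present_le (hc e) (hi e j))
    (fun j e e' h => by simp only [simState, static, Prod.mk.injEq] at h; exact h.1.2.2.2)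
    (fun j e e' h => by simp only [simState, static, Prod.mk.injEq] at h; exact h.1.2.1)
    det_present (stored_simState H o c ho hs h2 (by omega) hc hi) hs hcard hsC (by omega) hF hFS hFD
  refine (h.mono le_rfl le_rfl (by nlinarith)).det_right ?_
  intro j e e' h'
  simp only [lookup_canon]
  exact h'

/-- The ports that are used in a round. -/
def usedPorts (A : NCCStarAlgorithm) (hk : 1 ≤ k) (H : SimpleGraph (Fin n))
    (c : NCCStar.Config n) (j : Fin n) : Finset ℕ :=
  ((act A (canon hk H) c j).2.filterMap fun m => match m.1 with
    | .port p => some p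
    | .node _ => none).toFinset

theorem mem_usedPorts {A : NCCStarAlgorithm} {hk : 1 ≤ k} {H : SimpleGraph (Fin n)}
    {c : NCCStar.Config n} {j : Fin n} {p : ℕ} :
    p ∈ usedPorts A hk H c j ↔ ∃ m ∈ (act A (canon hk H) c j).2, m.1 = .port p := by
  simp only [usedPorts, List.mem_toFinset, List.mem_filterMap]
  refine exists_congr fun m => and_congr_right fun _ => ?_
  cases m.1 <;> simp

/-- Messages are not empty, so there are at most as many as words sent. -/
theorem card_usedPorts_le {A : NCCStarAlgorithm} {hk : 1 ≤ k} {H : SimpleGraph (Fin n)}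
    {c : NCCStar.Config n} (h : RoundOK A (canon hk H) κ C c) (j : Fin n) :
    (usedPorts A hk H c j).card ≤ C := by
  refine (List.toFinset_card_le _).trans ((List.length_filterMap_le _ _).trans ?_)
  refine le_trans ?_ (h j).1
  have : ∀ l : List (Dest × List ℕ), (∀ m ∈ l, m.2 ≠ []) →
      l.length ≤ (l.map fun m => m.2.length).sum := by
    intro l
    induction l with
    | nil => simp
    | cons m l ih =>
      intro h
      have h1 := ih fun m' hm' => h m' (by simp [hm'])
      have h2 : 1 ≤ m.2.length := List.length_pos_iff.2 (h m (by simp))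
      simp only [List.length_cons, List.map_cons, List.sum_cons]
      omega
  exact this _ fun m hm => ((h j).2.1 m hm).1

/-- The payloads that `u` sends to `v`. -/
def payloads (A : NCCStarAlgorithm) (hk : 1 ≤ k) (H : SimpleGraph (Fin n))
    (c : NCCStar.Config n) (u v : Fin n) : List (List ℕ) :=
  ((act A (canon hk H) c u).2.filter fun m => (canon hk H).resolve u m.1 = some v).map Prod.snd

theorem sum_length_payloads_le (A : NCCStarAlgorithm) (hk : 1 ≤ k) (H : SimpleGraph (Fin n))
    (c : NCCStar.Config n) (u : Fin n) :
    ∑ v, (flat (payloads A hk H c u v)).length ≤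
      ((act A (canon hk H) c u).2.map fun m => m.2.length).sum := by
  simp only [length_flat, payloads, List.map_map]
  induction (act A (canon hk H) c u).2 with
  | nil => simp
  | cons m l ih =>
    have h1 : ∀ v, ((List.filter (fun m => decide ((canon hk H).resolve u m.1 = some v))
        (m :: l)).map (List.length ∘ Prod.snd)).sum =
        (if (canon hk H).resolve u m.1 = some v then m.2.length else 0) +
        ((List.filter (fun m => decide ((canon hk H).resolve u m.1 = some v)) l).map
          (List.length ∘ Prod.snd)).sum := by
      intro v
      by_cases h : (canon hk H).resolve u m.1 = some v <;> simp [h]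
    simp only [h1, sum_add_distrib, List.map_cons, List.sum_cons]
    refine add_le_add ?_ ih
    rcases (canon hk H).resolve u m.1 with _ | w
    · simp
    · simp [Option.some.injEq]

theorem delivered_eq (A : NCCStarAlgorithm) (hk : 1 ≤ k) (H : SimpleGraph (Fin n))
    (c : NCCStar.Config n) (v : Fin n) : delivered A (canon hk H) c v =
      ∑ u : Fin n, (((payloads A hk H c u v).map fun p => ((u : ℕ), p) :
        List (ℕ × List ℕ)) : Inbox) := by
  simp only [delivered, payloads, List.map_map, canon_ident]
  rfl

theorem sum_length_payloads_eq (A : NCCStarAlgorithm) (hk : 1 ≤ k) (H : SimpleGraph (Fin n))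
    (c : NCCStar.Config n) (v : Fin n) :
    ∑ u, (flat (payloads A hk H c u v)).length = (delivered A (canon hk H) c v).words := by
  rw [delivered_eq]
  unfold Inbox.words
  induction (univ : Finset (Fin n)) using Finset.induction_on with
  | empty => simp
  | insert a t ha ih =>
    rw [sum_insert ha, sum_insert ha, Multiset.map_add, Multiset.sum_add, ih, length_flat]
    congr 1
    simp [Function.comp_def]

-- The lookup function takes `2 * D + 2` rounds. Then one round asks for the neighbours behind the
-- used ports, one round answers, and one round delivers the messages. Addresses that are
-- identifiers need no translation, because in the canonical representation they are machine
-- numbers.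
set_option maxHeartbeats 1000000 in
theorem reach_next (hk : 1 ≤ k) (A : NCCStarAlgorithm) (H : E → SimpleGraph (Fin n))
    (o : E → Fin n → ℕ) (c : E → NCCStar.Config n) (ho : ∀ e j, o e j < (n + 1) ^ k) (hs : 0 < s)
    (hC : 0 < C) (hsC : s * (3 * C) ≤ S) (hcard : ∀ e, (arr (H e)).card ≤ n * s)
    (hF : 0 < F) (hFS : F ≤ S) (hFD : n ≤ F ^ D)
    (hc : ∀ e, MemoryOK κ C (c e)) (hi : ∀ e j, InboxOK κ C n ((c e).inbox j))
    (hround : ∀ e, RoundOK A (canon hk (H e)) κ C (c e))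
    (hc' : ∀ e, MemoryOK κ C (next A (canon hk (H e)) (c e))) :
    Reach (κ + 5) S ((2 * k + 2 * κ + 20) * S) (fun e => simState s (H e) (o e) (c e))
      (2 * D + 5) fun e => simState s (H e) (o e) (next A (canon hk (H e)) (c e)) := by
  classical
  have hCS : 3 * C ≤ S := (Nat.le_mul_of_pos_left _ hs).trans hsC
  have hsS : s ≤ S := (Nat.le_mul_of_pos_right s (by omega)).trans hsC
  set X₁ := fun e (j : Fin n) =>
    (simState s (H e) (o e) (c e) j, lookup (canon hk (H e)) (c e) j) with hX₁
  have hr₁ := reach_portOf hk H o c ho hs hC hsC hcard hF hFS hFD hc hi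
  have hst₁ : Stored ((2 * k + 2 * κ + 15) * S) X₁ := hr₁.stored
  have hdact : Det X₁ fun e => act A (canon hk (H e)) (c e) := by
    intro j e e' h
    simp only [hX₁, simState, static, Prod.mk.injEq] at h
    change act A (canon hk (H e)) (c e) j = act A (canon hk (H e')) (c e') j
    unfold act
    rw [h.1.2.1, h.1.2.2, h.2, h.1.1.2.2.1]
    rfl
  have hdports : Det X₁ fun e => usedPorts A hk (H e) (c e) := by
    intro j e e' h
    have h1 : act A (canon hk (H e)) (c e) j = act A (canon hk (H e')) (c e') j :=
      hdact j e e' h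
    change usedPorts A hk (H e) (c e) j = usedPorts A hk (H e') (c e') j
    unfold usedPorts
    rw [h1]
  have hdpos : Det X₁ fun e => pos (H e) := by
    intro j e e' h
    simp only [hX₁, simState, static, Prod.mk.injEq] at h
    exact h.1.1.2.1
  have hdchunk : Det X₁ fun e (i : Fin n) => chunk (arr (H e)) s i := by
    intro j e e' h
    simp only [hX₁, simState, static, Prod.mk.injEq] at h
    exact h.1.1.2.2.2
  -- The receivers behind the used ports.
  have hnbr : ∀ e j, ∀ p ∈ usedPorts A hk (H e) (c e) j, ∃ u : Fin n,
      (canon hk (H e)).resolve j (.port p) = some u ∧ key n j (u + 1) ∈ arr (H e) ∧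
      rank (arr (H e)) (key n j (u + 1)) = pos (H e) j + 1 + p := by
    intro e j p hp
    obtain ⟨m, hm, hmp⟩ := mem_usedPorts.1 hp
    obtain ⟨u, hu⟩ := Option.isSome_iff_exists.1 ((hround e j).2.1 m hm).2.2.1
    rw [hmp] at hu
    obtain ⟨h1, h2⟩ := (canon_resolve_port hk).1 hu
    refine ⟨u, hu, (key_succ_mem_arr u.2).2 (val_mem_nbrs.2 h1), ?_⟩
    rw [rank_arr_key _ _ u.2.le, h2]
  -- A question consists of the host and the position of the entry in the array; by `rank_arr_key`
  -- the host computes this position from the port.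
  let asks : E → Finset (ℕ × ℕ) := fun e => univ.biUnion fun j =>
    (usedPorts A hk (H e) (c e) j).image fun p => ((j : ℕ), pos (H e) j + 1 + p)
  have hasks : ∀ e y, y ∈ asks e ↔ ∃ j : Fin n, ∃ p ∈ usedPorts A hk (H e) (c e) j,
      ((j : ℕ), pos (H e) j + 1 + p) = y := by
    intro e y
    simp [asks]
  have hasks' : ∀ e, ∀ y ∈ asks e, ∃ z ∈ arr (H e),
      z / (n + 2) = y.1 ∧ rank (arr (H e)) z = y.2 := by
    intro e y hy
    obtain ⟨j, p, hp, rfl⟩ := (hasks e y).1 hy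
    obtain ⟨u, -, h2, h3⟩ := hnbr e j p hp
    exact ⟨_, h2, key_div _ (by omega), h3⟩
  have hasks1 : ∀ e, ∀ y ∈ asks e, y.1 < n := by
    intro e y hy
    obtain ⟨j, p, -, rfl⟩ := (hasks e y).1 hy
    exact j.2
  have hasks2 : ∀ e, ∀ y ∈ asks e, y.2 < (n + 1) ^ 2 := by
    intro e y hy
    obtain ⟨z, hz, -, h2⟩ := hasks' e y hy
    exact h2 ▸ rank_arr_lt hz
  have hnn : ∀ x, x < n → x < (n + 1) ^ 1 := fun x hx => by rw [pow_one]; omega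
  have hsmall₁ : Small {y : ℕ × ℕ | y.1 < n ∧ y.2 < (n + 1) ^ 2} ((n + 1) ^ 3) := by
    have h1 : Small ({x | x < (n + 1) ^ 1} ×ˢ {x | x < (n + 1) ^ 2}) ((n + 1) ^ 1 * (n + 1) ^ 2) :=
      (Small.range_lt _ fun _ h => h).prod (Small.range_lt _ fun _ h => h)
    rw [← pow_add] at h1
    exact h1.mono (fun y hy => ⟨hnn _ hy.1, hy.2⟩) le_rfl
  -- Distinct questions concern distinct entries, because the block of an entry names the only host
  -- that can ask for it. So a machine gets at most one question per stored entry.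
  have hload₁ : ∀ e (m : Fin n), ((asks e).filter fun y => y.2 / s = m).card ≤ S := by
    intro e m
    refine le_trans ?_ ((card_chunk_le (arr (H e)) hs m).trans hsS)
    choose! z hz hz1 hz2 using hasks' e
    refine card_le_card_of_injOn z ?_ ?_
    · intro y hy
      obtain ⟨h1, h2⟩ := mem_filter.1 hy
      exact mem_chunk.2 ⟨hz y h1, by rw [hz2 y h1]; exact h2⟩
    · intro y hy y' hy' h
      have h1 := (mem_filter.1 hy).1
      have h1' := (mem_filter.1 hy').1
      exact Prod.ext (by rw [← hz1 y h1, h, hz1 y' h1']) (by rw [← hz2 y h1, h, hz2 y' h1'])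
  have hhome₁ : ∀ e (j : Fin n), ((asks e).filter fun y : ℕ × ℕ => y.1 = j).card ≤ S := by
    intro e j
    refine le_trans ?_ ((card_usedPorts_le (hround e) j).trans (by omega))
    refine (card_le_card (t := (usedPorts A hk (H e) (c e) j).image fun p =>
      ((j : ℕ), pos (H e) j + 1 + p)) ?_).trans card_image_le
    intro y hy
    obtain ⟨h1, h2⟩ := mem_filter.1 hy
    obtain ⟨j', p, hp, rfl⟩ := (hasks e y).1 h1
    obtain rfl := Fin.ext h2
    exact mem_image_of_mem _ hp
  have hst₂ : Stored (4 * S) fun e (m : Fin n) => (asks e).filter fun y => y.2 / s = m :=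
    Stored.finset hsmall₁ hload₁ fun e m y hy =>
      ⟨hasks1 e y (mem_filter.1 hy).1, hasks2 e y (mem_filter.1 hy).1⟩
  have hr₂ : Reach (κ + 5) S ((2 * k + 2 * κ + 20) * S)
      (fun e => simState s (H e) (o e) (c e)) (2 * D + 2 + 1)
      fun e (m : Fin n) => (X₁ e m, (asks e).filter fun y => y.2 / s = m) := by
    refine (hr₁.mono (by omega) le_rfl (Nat.mul_le_mul_right _ (by omega))).move asks
      (fun _ y => y.1) (fun _ y => y.2 / s) ?_ ?_ hasks1 hhome₁ hload₁ (Det.refl _)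
      ((hst₁.prod hst₂).mono (by nlinarith))
    · refine hsmall₁.mono ?_ (Nat.pow_le_pow_right (by omega) (by omega))
      rintro y ⟨e, hy⟩
      exact ⟨hasks1 e y hy, hasks2 e y hy⟩
    · intro j e e' hY y hy hyj
      obtain ⟨j', p, hp, rfl⟩ := (hasks e y).1 hy
      obtain rfl := Fin.ext hyj
      refine ⟨(hasks e' _).2 ⟨j', p, ?_, ?_⟩, rfl, rfl⟩
      · rw [show usedPorts A hk (H e) (c e) j' = usedPorts A hk (H e') (c e') j' from
          hdports j' e e' hY] at hp
        exact hp
      · exact Prod.ext rfl (by simp only; rw [show pos (H e) j' = pos (H e') j' from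
          hdpos j' e e' hY])
  -- The answer is the entry itself together with its position; its block number is the address of
  -- the host.
  let ans : E → Finset (ℕ × ℕ) := fun e => ((arr (H e)).filter fun z =>
    (z / (n + 2), rank (arr (H e)) z) ∈ asks e).image fun z => (z, rank (arr (H e)) z)
  have hans : ∀ e y, y ∈ ans e ↔ (y.1 ∈ arr (H e) ∧ (y.1 / (n + 2), y.2) ∈ asks e) ∧
      y.2 = rank (arr (H e)) y.1 := by
    intro e y
    simp only [ans, mem_image, mem_filter]
    constructor
    · rintro ⟨z, h, rfl⟩; exact ⟨h, rfl⟩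
    · rintro ⟨⟨h1, h2⟩, h3⟩
      exact ⟨y.1, ⟨h1, h3 ▸ h2⟩, Prod.ext rfl h3.symm⟩
  have hsmall₂ : Small {y : ℕ × ℕ | y.1 < (n + 1) ^ 2 ∧ y.2 < (n + 1) ^ 2} ((n + 1) ^ 4) := by
    have h1 : Small ({x | x < (n + 1) ^ 2} ×ˢ {x | x < (n + 1) ^ 2}) ((n + 1) ^ 2 * (n + 1) ^ 2) :=
      (Small.range_lt _ fun _ h => h).prod (Small.range_lt _ fun _ h => h)
    rw [← pow_add] at h1
    exact h1.mono (fun y hy => ⟨hy.1, hy.2⟩) le_rfl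
  have hanssmall : ∀ e, ∀ y ∈ ans e, y.1 < (n + 1) ^ 2 ∧ y.2 < (n + 1) ^ 2 := by
    intro e y hy
    obtain ⟨⟨h1, h2⟩, h3⟩ := (hans e y).1 hy
    exact ⟨lt_of_mem_arr h1, h3 ▸ rank_arr_lt h1⟩
  have hansinj : ∀ e, Set.InjOn (fun y : ℕ × ℕ => (y.1 / (n + 2), y.2)) (ans e : Set (ℕ × ℕ)) := by
    intro e y hy y' hy' h
    obtain ⟨⟨h1, -⟩, h2⟩ := (hans e y).1 hy
    obtain ⟨⟨h1', -⟩, h2'⟩ := (hans e y').1 hy'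
    have h3 : y.2 = y'.2 := (Prod.mk.inj h).2
    exact Prod.ext (rank_inj h1 h1' (by rw [← h2, ← h2', h3])) h3
  have hhome₂ : ∀ e (j : Fin n),
      ((ans e).filter fun y : ℕ × ℕ => y.1 / (n + 2) = j).card ≤ C := by
    intro e j
    refine le_trans ?_ (card_usedPorts_le (hround e) j)
    refine le_trans (card_le_card_of_injOn (t := (usedPorts A hk (H e) (c e) j).image fun p =>
      ((j : ℕ), pos (H e) j + 1 + p)) (fun y : ℕ × ℕ => (y.1 / (n + 2), y.2)) ?_ ?_) card_image_le
    · intro y hy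
      obtain ⟨h1, h2⟩ := mem_filter.1 hy
      obtain ⟨⟨-, h3⟩, -⟩ := (hans e y).1 h1
      obtain ⟨j', p, hp, h4⟩ := (hasks e _).1 h3
      obtain rfl : j' = j := Fin.ext ((Prod.mk.inj h4).1.trans h2)
      exact mem_image.2 ⟨p, hp, h4⟩
    · exact (hansinj e).mono fun y hy => (mem_filter.1 hy).1
  have hst₃ : Stored (4 * S + C) fun e (j : Fin n) =>
      (ans e).filter fun y : ℕ × ℕ => y.1 / (n + 2) = j :=
    (Stored.finset hsmall₂ hhome₂ fun e j y hy =>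
      hanssmall e y (mem_filter.1 hy).1).mono (by omega)
  have hr₃ : Reach (κ + 5) S ((2 * k + 2 * κ + 20) * S)
      (fun e => simState s (H e) (o e) (c e)) (2 * D + 2 + 1 + 1)
      fun e (j : Fin n) => (X₁ e j, (ans e).filter fun y : ℕ × ℕ => y.1 / (n + 2) = j) := by
    refine (hr₂.mono le_rfl le_rfl (Nat.mul_le_mul_right _ (by omega))).move ans
      (fun _ y => y.2 / s) (fun _ y => y.1 / (n + 2)) ?_ ?_ ?_ ?_
      (fun e j => (hhome₂ e j).trans (by omega)) ?_ ((hst₁.prod hst₃).mono (by nlinarith))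
    · refine hsmall₂.mono ?_ (Nat.pow_le_pow_right (by omega) (by omega))
      rintro y ⟨e, hy⟩
      exact hanssmall e y hy
    · intro m e e' hY y hy hym
      obtain ⟨⟨h1, h2⟩, h3⟩ := (hans e y).1 hy
      simp only [Prod.mk.injEq] at hY
      have hch := hdchunk m e e' hY.1
      simp only at hch
      have h4 : y.1 ∈ chunk (arr (H e)) s m := mem_chunk.2 ⟨h1, by rw [← h3]; exact hym⟩
      have h5 : y.1 ∈ chunk (arr (H e')) s m := hch ▸ h4
      have h6 : (y.1 / (n + 2), y.2) ∈ (asks e').filter fun y => y.2 / s = m :=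
        hY.2 ▸ mem_filter.2 ⟨h2, hym⟩
      refine ⟨(hans e' y).2 ⟨⟨(mem_chunk.1 h5).1, (mem_filter.1 h6).1⟩, ?_⟩, hym, rfl⟩
      rw [h3, rank_eq_of_mem_chunk hs h4, rank_eq_of_mem_chunk hs h5, hch]
    · intro e y hy
      obtain ⟨⟨h1, h2⟩, h3⟩ := (hans e y).1 hy
      rw [h3]
      exact (Nat.div_lt_iff_lt_mul hs).2 ((rank_lt_card h1).trans_le (hcard e))
    · intro e m
      refine le_trans (card_le_card_of_injOn _ ?_ ((hansinj e).mono fun y hy =>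
        (mem_filter.1 hy).1)) (hload₁ e m)
      intro y hy
      obtain ⟨h1, h2⟩ := mem_filter.1 hy
      exact mem_filter.2 ⟨((hans e y).1 h1).1.2, h2⟩
    · intro i e e' h
      simp only [Prod.mk.injEq] at h ⊢
      exact ⟨h.1.1, h.2⟩
  have hdsend : Det (fun e (j : Fin n) =>
      (X₁ e j, (ans e).filter fun y : ℕ × ℕ => y.1 / (n + 2) = j))
      fun e u v => payloads A hk (H e) (c e) u v := by
    intro j e e' h
    simp only [Prod.mk.injEq] at h
    obtain ⟨h1, h2⟩ := h
    have hact : act A (canon hk (H e)) (c e) j = act A (canon hk (H e')) (c e') j :=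
      hdact j e e' h1
    have hport : usedPorts A hk (H e) (c e) j = usedPorts A hk (H e') (c e') j :=
      hdports j e e' h1
    have hpos : pos (H e) j = pos (H e') j := hdpos j e e' h1
    funext v
    change payloads A hk (H e) (c e) j v = payloads A hk (H e') (c e') j v
    unfold payloads
    rw [hact]
    congr 1
    refine List.filter_congr fun m hm => ?_
    have hres : (canon hk (H e)).resolve j m.1 = (canon hk (H e')).resolve j m.1 := by
      cases hd : m.1 with
      | node x =>
        ext u
        rw [canon_resolve_node, canon_resolve_node]
      | port p =>
        have hp' : p ∈ usedPorts A hk (H e') (c e') j := mem_usedPorts.2 ⟨m, hm, hd⟩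
        have hp : p ∈ usedPorts A hk (H e) (c e) j := hport ▸ hp'
        obtain ⟨u, hu, hu1, hu2⟩ := hnbr e j p hp
        rw [hu]
        have h3 : (key n j (u + 1), pos (H e) j + 1 + p) ∈
            (ans e).filter fun y : ℕ × ℕ => y.1 / (n + 2) = j := by
          refine mem_filter.2 ⟨(hans e _).2 ⟨⟨hu1, ?_⟩, hu2.symm⟩, key_div _ (by omega)⟩
          simp only [key_div (n := n) (y := (u : ℕ) + 1) (j : ℕ) (by omega)]
          exact (hasks e _).2 ⟨j, p, hp, rfl⟩
        rw [h2] at h3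
        obtain ⟨⟨h4, -⟩, h5⟩ := (hans e' _).1 (mem_filter.1 h3).1
        simp only at h4 h5
        rw [rank_arr_key _ _ u.2.le, hpos] at h5
        exact ((canon_resolve_port hk).2 ⟨val_mem_nbrs.1 ((key_succ_mem_arr u.2).1 h4),
          by omega⟩).symm
    rw [hres]
  have hne : ∀ e u v, ∀ p ∈ payloads A hk (H e) (c e) u v, p ≠ [] := by
    intro e u v p hp
    obtain ⟨m, hm, rfl⟩ := List.mem_map.1 hp
    exact ((hround e u).2.1 m (List.mem_filter.1 hm).1).1
  -- All payloads from `u` to `v` are joined into a single marked list. The mark costs one bit per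
  -- word.
  refine .round (M := fun e u v => flat (payloads A hk (H e) (c e) u v)) hr₃
    ⟨?_, ?_, ?_, ?_⟩ ?_ ?_
  · have h1 : Small ({x | x < (n + 1) ^ κ} ×ˢ (Set.univ : Set Bool)) ((n + 1) ^ κ * 2) := by
      refine (Small.range_lt _ fun _ h => h).prod ?_
      exact Small.of_code (fun b => b.toNat)
        (by intro a _ b _ h; cases a <;> cases b <;> simp_all)
        (by intro b _; cases b <;> simp)
    rcases Nat.eq_zero_or_pos n with rfl | hn
    · refine (Small.range_lt (m := 0) ∅ (by simp)).image (fun _ => (0, true)) |>.mono ?_ (by simp)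
      rintro y ⟨e, u, -⟩
      exact u.elim0
    · refine h1.mono ?_ ?_
      · rintro y ⟨e, u, v, hy⟩
        obtain ⟨p, hp, hyp⟩ := mem_flat hy
        obtain ⟨m, hm, rfl⟩ := List.mem_map.1 hp
        exact ⟨((hround e u).2.1 m (List.mem_filter.1 hm).1).2.1 _ hyp, Set.mem_univ _⟩
      · refine le_trans ?_ (Nat.pow_le_pow_right (by omega) (show κ + 1 ≤ κ + 5 by omega))
        rw [pow_succ]
        exact Nat.mul_le_mul_left _ (by omega)
  · intro u e e' h
    have := hdsend u e e' h
    funext v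
    exact congrArg flat (congrFun this v)
  · intro e u
    have h1 := (hround e u).1
    exact (sum_length_payloads_le A hk (H e) (c e) u).trans (h1.trans (by omega))
  · intro e v
    rw [sum_length_payloads_eq]
    exact ((hround e v).2.2).trans (by omega)
  · intro j e e' h
    simp only [Prod.mk.injEq] at h
    obtain ⟨⟨h1, -⟩, h2⟩ := h
    have hact : act A (canon hk (H e)) (c e) j = act A (canon hk (H e')) (c e') j :=
      hdact j e e' h1
    refine Prod.ext ?_ (Prod.ext ?_ ?_)
    · exact (Prod.mk.inj (Prod.mk.inj h1).1).1
    · change (act A (canon hk (H e)) (c e) j).1 = (act A (canon hk (H e')) (c e') j).1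
      rw [hact]
    · change delivered A (canon hk (H e)) (c e) j = delivered A (canon hk (H e')) (c e') j
      rw [delivered_eq, delivered_eq]
      refine sum_congr rfl fun u _ => ?_
      have h3 := congrArg (fun l => (unflat l).2) (congrFun h2 u)
      simp only [unflat_flat _ (hne _ _ _)] at h3
      rw [h3]
  · exact (stored_simState H o _ ho hs hsS (by omega) hc' fun e =>
      inboxOK_next hk (hround e)).mono (Nat.mul_le_mul_right _ (by omega))

end Simulation


/-! ### Labels in terms of the input identifiers -/

section Output

open NCCStar

variable {E : Type} {n k κ C S F D s : ℕ}

open Classical in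
/-- The label that a node would output now, if it is acceptable. -/
def label (A : NCCStarAlgorithm) (hk : 1 ≤ k) (κ C : ℕ) (H : SimpleGraph (Fin n))
    (c : NCCStar.Config n) (j : Fin n) : List (ℕ ⊕ ℕ) :=
  let l := A.output j (deg H j) (lookup (canon hk H) c j) (c.mem j) (c.inbox j)
  -- Labels are computed also at intermediate times, when the algorithm promises nothing about its
  -- output. The default keeps the bounds valid.
  if l.length ≤ C ∧ ∀ x ∈ l, IsWord κ n (tokenValue x) then l else []

theorem label_spec (A : NCCStarAlgorithm) (hk : 1 ≤ k) (κ C : ℕ) (H : SimpleGraph (Fin n))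
    (c : NCCStar.Config n) (j : Fin n) : (label A hk κ C H c j).length ≤ C ∧
      ∀ x ∈ label A hk κ C H c j, IsWord κ n (tokenValue x) := by
  unfold label
  simp only
  split_ifs with h
  · exact h
  · simp

/-- The name `f x` of a vertex `x`. -/
def rename (f : Fin n → ℕ) (x : ℕ) : ℕ := if h : x < n then f ⟨x, h⟩ else 0

/-- The label with the identifiers of the input. -/
def finalLabel (A : NCCStarAlgorithm) (hk : 1 ≤ k) (κ C : ℕ) (H : SimpleGraph (Fin n))
    (o : Fin n → ℕ) (c : NCCStar.Config n) (j : Fin n) : List (ℕ ⊕ ℕ) :=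
  (label A hk κ C H c j).map (Sum.map (rename o) id)

/-- The vertices that occur in a label. -/
def refs (n : ℕ) (l : List (ℕ ⊕ ℕ)) : Finset ℕ :=
  ((l.filterMap Sum.getLeft?).toFinset).filter (· < n)

theorem mem_refs {l : List (ℕ ⊕ ℕ)} {x : ℕ} : x ∈ refs n l ↔ Sum.inl x ∈ l ∧ x < n := by
  simp [refs]

theorem card_refs_le (n : ℕ) (l : List (ℕ ⊕ ℕ)) : (refs n l).card ≤ l.length :=
  (card_filter_le _ _).trans ((List.toFinset_card_le _).trans (List.length_filterMap_le _ _))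

theorem stored_labels {X : E → Fin n → List (ℕ ⊕ ℕ)} (h : ∀ e j, (X e j).length ≤ C ∧
    ∀ x ∈ X e j, IsWord κ n (tokenValue x)) : Stored ((κ + 2) * C) X := by
  intro j
  have hn := j.pos
  have h1 : Small {x : ℕ ⊕ ℕ | tokenValue x < (n + 1) ^ κ} ((n + 1) ^ (κ + 1)) := by
    refine Small.of_code (fun x => match x with
      | .inl y => 2 * y
      | .inr y => 2 * y + 1) ?_ ?_
    · rintro (x | x) _ (y | y) _ h <;> simp only at h
      · congr 1; omega
      · omega
      · omega
      · congr 1; omega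
    · have h2 : 2 * (n + 1) ^ κ ≤ (n + 1) ^ (κ + 1) := by
        rw [pow_succ, mul_comm]
        exact Nat.mul_le_mul_left _ (by omega)
      rintro (x | x) hx <;>
      · simp only [Set.mem_ofPred_eq, tokenValue] at hx ⊢
        omega
  exact Stored.list h1 (fun e j => (h e j).1) (fun e j => (h e j).2) j

/-- References in a label of the canonical run are ranks. They are translated by a dictionary with
keys `0, …, n - 1` and the differences of consecutive identifiers as weights, and the answers return
to the host. The simulated configuration is kept, so that the simulation can go on afterwards. -/
theorem reach_finalLabel (hk : 1 ≤ k) (hkκ : k ≤ κ) (A : NCCStarAlgorithm)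
    (H : E → SimpleGraph (Fin n))
    (o : E → Fin n → ℕ) (c : E → NCCStar.Config n) (hom : ∀ e, StrictMono (o e))
    (ho : ∀ e j, o e j < (n + 1) ^ k) (hs : 0 < s)
    (hC : 0 < C) (hsC : s * (3 * C) ≤ S) (hcard : ∀ e, (arr (H e)).card ≤ n * s)
    (hF : 0 < F) (hFS : 2 * F * F ≤ S) (hD : 0 < D) (hFD : n + 1 ≤ F ^ D)
    (hc : ∀ e, MemoryOK κ C (c e)) (hi : ∀ e j, InboxOK κ C n ((c e).inbox j)) :
    Reach (4 * k + 4) S ((12 * k + 3 * κ + 26) * S) (fun e => simState s (H e) (o e) (c e))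
      ((2 * k + 1) * D * (D + 1) + 3 * D + 3) fun e j => (simState s (H e) (o e) (c e) j,
        finalLabel A hk κ C (H e) (o e) (c e) j) := by
  classical
  have hCS : 3 * C ≤ S := (Nat.le_mul_of_pos_left _ hs).trans hsC
  have hsS : s ≤ S := (Nat.le_mul_of_pos_right s (by omega)).trans hsC
  have hnk : n < (n + 1) ^ k :=
    lt_of_lt_of_le (Nat.lt_succ_self n) (Nat.le_self_pow (by omega) _)
  have hr₁ := reach_portOf hk H o c ho hs hC hsC hcard hF (by nlinarith) ((Nat.le_succ n).trans hFD)
    hc hi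
  set X := fun e => simState s (H e) (o e) (c e) with hX
  set lab := fun e => label A hk κ C (H e) (c e) with hlab
  have hst : Stored ((2 * k + 2 * κ + 10) * S) X :=
    stored_simState H o c ho hs hsS (by omega) hc hi
  have hstl : Stored ((κ + 2) * C) lab := stored_labels fun e j => label_spec A hk κ C (H e) (c e) j
  have hr₂ : Reach (4 * k + 4) S ((12 * k + 3 * κ + 26) * S) X (2 * D + 2)
      fun e j => (X e j, lab e j) := by
    refine (hr₁.mono (by omega) le_rfl (Nat.mul_le_mul_right _ (by omega))).det_right ?_
    intro j e e' h
    refine Prod.ext (Prod.mk.inj h).1 ?_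
    simp only [simState, static, Prod.mk.injEq] at h
    change label A hk κ C (H e) (c e) j = label A hk κ C (H e') (c e') j
    unfold label
    rw [h.1.2.1, h.1.2.2, h.2, h.1.1.2.2.1]
  -- The tag of a query is its host: it separates queries for the same vertex and tells where the
  -- answer belongs.
  let Q : E → Fin n → Finset (ℕ × ℕ) := fun e j => (refs n (lab e j)).image fun x => (x, (j : ℕ))
  have hQ : ∀ e j p, p ∈ Q e j ↔ p.1 ∈ refs n (lab e j) ∧ p.2 = j := by
    intro e j p
    simp only [Q, mem_image]
    constructor
    · rintro ⟨x, hx, rfl⟩; exact ⟨hx, rfl⟩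
    · rintro ⟨h1, h2⟩; exact ⟨_, h1, Prod.ext rfl h2.symm⟩
  have hQC : ∀ e j, (Q e j).card ≤ C := fun e j =>
    card_image_le.trans ((card_refs_le _ _).trans (label_spec A hk κ C (H e) (c e) j).1)
  obtain ⟨loc, hl1, hl2, hr₃⟩ := reach_lookup (S := S) (s := C) (u := k) (F := F) (D := D)
    (fun _ (j : Fin n) => (j : ℕ)) (fun e => gap (o e)) Q (fun e => Fin.val_injective)
    (fun e j => j.2.trans hnk) (fun e => sum_gap_lt (hom e).monotone (ho e) (Nat.pow_pos (by omega)))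
    (fun e j p hp => (mem_refs.1 ((hQ e j p).1 hp).1).2.trans hnk)
    (fun e j p hp => by rw [((hQ e j p).1 hp).2]; exact j.2.trans hnk)
    (fun e i j p hi hj => Fin.ext (((hQ e i p).1 hi).2.symm.trans ((hQ e j p).1 hj).2))
    (fun e j => by have := hQC e j; omega) (by omega)
    (fun e => card_biUnion_le.trans ((sum_le_sum fun j _ => hQC e j).trans (by simp)))
    hF hFS hD hFD
  have hfr : Stored ((2 * k + 3 * κ + 12) * S) fun e j => (X e j, lab e j) :=
    (hst.prod hstl).mono (by nlinarith)
  have hr₄ := hr₂.trans ((hr₃.keep hfr (X' := fun e j => (X e j, lab e j))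
    (fun j e e' h => by
      simp only [hX, simState, static, Prod.mk.injEq] at h
      simp only [Prod.mk.injEq, Q]
      exact ⟨trivial, h.1.1.1.2, by rw [h.2]⟩) (Det.refl _)).mono le_rfl le_rfl
      (show _ ≤ (12 * k + 3 * κ + 26) * S by nlinarith))
  let All : E → Finset (ℕ × ℕ) := fun e => univ.biUnion (Q e)
  have hAll : ∀ e p, p ∈ All e ↔ ∃ j : Fin n, p.1 ∈ refs n (lab e j) ∧ p.2 = j := by
    intro e p
    simp [All, hQ]
  let items : E → Finset (ℕ × ℕ × ℕ) := fun e => (All e).image fun p =>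
    (p.1, p.2, dictSum (fun j : Fin n => (j : ℕ)) (gap (o e)) p.1)
  have hitems : ∀ e y, y ∈ items e ↔ (y.1, y.2.1) ∈ All e ∧
      y.2.2 = dictSum (fun j : Fin n => (j : ℕ)) (gap (o e)) y.1 := by
    intro e y
    simp only [items, mem_image]
    constructor
    · rintro ⟨p, hp, rfl⟩; exact ⟨hp, rfl⟩
    · rintro ⟨h1, h2⟩; exact ⟨_, h1, Prod.ext rfl (Prod.ext rfl h2.symm)⟩
  have hdict : ∀ e x (hx : x < n), dictSum (fun j : Fin n => (j : ℕ)) (gap (o e)) x = o e ⟨x, hx⟩ :=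
    fun e x hx => dictSum_gap (hom e).monotone x hx
  have hinj : ∀ e, Set.InjOn (fun y : ℕ × ℕ × ℕ => (y.1, y.2.1)) (items e : Set (ℕ × ℕ × ℕ)) := by
    intro e y hy y' hy' h
    have h1 := ((hitems e y).1 hy).2
    have h2 := ((hitems e y').1 hy').2
    simp only [Prod.mk.injEq] at h
    exact Prod.ext h.1 (Prod.ext h.2 (by rw [h1, h2, h.1]))
  refine ((hr₄.move (Z := fun e j => (X e j, finalLabel A hk κ C (H e) (o e) (c e) j)) items
    (fun e y => loc e (y.1, y.2.1)) (fun _ y => y.2.1)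
    ?_ ?_ ?_ ?_ ?_ ?_ ?_)).pad (by omega)
  · have h1 : Small ({x | x < (n + 1) ^ k} ×ˢ ({x | x < (n + 1) ^ k} ×ˢ {x | x < (n + 1) ^ k}))
        ((n + 1) ^ k * ((n + 1) ^ k * (n + 1) ^ k)) :=
      (Small.range_lt _ fun _ h => h).prod ((Small.range_lt _ fun _ h => h).prod
        (Small.range_lt _ fun _ h => h))
    refine h1.mono ?_ ?_
    · rintro y ⟨e, hy⟩
      obtain ⟨h2, h3⟩ := (hitems e y).1 hy
      obtain ⟨j, h4, h5⟩ := (hAll e _).1 h2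
      have h6 := (mem_refs.1 h4).2
      simp only at h5 h6
      refine ⟨h6.trans hnk, ?_, ?_⟩
      · simp only [Set.mem_ofPred_eq, h5]; exact j.2.trans hnk
      · simp only [Set.mem_ofPred_eq, h3, hdict e _ h6]; exact ho e _
    · rw [← pow_add, ← pow_add]
      exact Nat.pow_le_pow_right (by omega) (by omega)
  · intro i e e' hY y hy hyi
    obtain ⟨h2, h3⟩ := (hitems e y).1 hy
    have h4 : y ∈ ((All e).filter fun p => loc e p = i).image
        fun p => (p.1, p.2, dictSum (fun j : Fin n => (j : ℕ)) (gap (o e)) p.1) :=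
      mem_image.2 ⟨_, mem_filter.2 ⟨h2, hyi⟩, Prod.ext rfl (Prod.ext rfl h3.symm)⟩
    rw [(Prod.mk.inj hY).1] at h4
    obtain ⟨p, hp, rfl⟩ := mem_image.1 h4
    obtain ⟨h5, h6⟩ := mem_filter.1 hp
    exact ⟨(hitems e' _).2 ⟨h5, rfl⟩, h6, rfl⟩
  · intro e y hy
    exact hl2 e _ ((hitems e y).1 hy).1
  · intro e i
    refine le_trans (card_le_card_of_injOn _ ?_ ((hinj e).mono fun y hy => (mem_filter.1 hy).1))
      ((hl1 e i).trans (by omega))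
    intro y hy
    obtain ⟨h1, h2⟩ := mem_filter.1 hy
    exact mem_filter.2 ⟨((hitems e y).1 h1).1, h2⟩
  · intro e i
    refine le_trans (card_le_card_of_injOn (t := Q e i) _ ?_
      ((hinj e).mono fun y hy => (mem_filter.1 hy).1)) ((hQC e i).trans (by omega))
    intro y hy
    obtain ⟨h1, h2⟩ := mem_filter.1 hy
    obtain ⟨j, h3, h4⟩ := (hAll e _).1 ((hitems e y).1 h1).1
    obtain rfl : j = i := Fin.ext (h4.symm.trans h2)
    exact (hQ e j _).2 ⟨h3, h4⟩
  · intro i e e' h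
    simp only [Prod.mk.injEq] at h ⊢
    obtain ⟨⟨-, h1, h2⟩, h3⟩ := h
    refine ⟨h1, ?_⟩
    simp only [finalLabel]
    change (lab e i).map _ = (lab e' i).map _
    rw [h2]
    refine List.map_congr_left fun x hx => ?_
    rcases x with x | x
    · simp only [Sum.map_inl, Sum.inl.injEq, rename]
      split_ifs with hxn
      · have h4 : x ∈ refs n (lab e i) := mem_refs.2 ⟨h2 ▸ hx, hxn⟩
        have h5 : (x, (i : ℕ), dictSum (fun j : Fin n => (j : ℕ)) (gap (o e)) x) ∈
            (items e).filter fun y : ℕ × ℕ × ℕ => y.2.1 = i :=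
          mem_filter.2 ⟨(hitems e _).2 ⟨(hAll e _).2 ⟨i, h4, rfl⟩, rfl⟩, rfl⟩
        rw [h3] at h5
        have h6 := ((hitems e' _).1 (mem_filter.1 h5).1).2
        simp only [hdict _ x hxn] at h6
        exact h6
      · rfl
    · rfl
  · have h1 : Stored ((κ + 2) * C) fun e => finalLabel A hk κ C (H e) (o e) (c e) := by
      refine stored_labels fun e j => ?_
      obtain ⟨h1, h2⟩ := label_spec A hk κ C (H e) (c e) j
      refine ⟨by simpa [finalLabel] using h1, fun x hx => ?_⟩
      obtain ⟨y, hy, rfl⟩ := List.mem_map.1 hx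
      rcases y with y | y
      · simp only [Sum.map_inl, IsWord, tokenValue, rename]
        have h3 : (n + 1) ^ k ≤ (n + 1) ^ κ := Nat.pow_le_pow_right (by omega) hkκ
        split_ifs
        · exact (ho e _).trans_le h3
        · exact Nat.pow_pos (by omega)
      · exact h2 _ hy
    exact (hst.prod h1).mono (by nlinarith)

end Output


/-! ## The simulation -/

open NCCStar

variable {n k κ C S F D T a : ℕ}

theorem run_succ {H : SimpleGraph (Fin n)} (A : NCCStarAlgorithm) (I : NCCStar.Input k H) (t : ℕ) :
    run A I (t + 1) = next A I (run A I t) := Function.iterate_succ_apply' _ _ _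

theorem inboxOK_run (hk : 1 ≤ k) {H : SimpleGraph (Fin n)} {A : NCCStarAlgorithm}
    (h : GoodRun hk A κ C T H) {t : ℕ} (ht : t ≤ T) (j : Fin n) :
    InboxOK κ C n ((run A (canon hk H) t).inbox j) := by
  cases t with
  | zero =>
    have : (run A (canon hk H) 0).inbox j = 0 := rfl
    rw [this]
    exact ⟨by simp [Inbox.words], by simp, by simp, by simp⟩
  | succ t =>
    rw [run_succ]
    exact inboxOK_next hk (h.round t ht) j

theorem label_run (hk : 1 ≤ k) {H : SimpleGraph (Fin n)} {A : NCCStarAlgorithm}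
    (h : GoodRun hk A κ C T H) (j : Fin n) :
    label A hk κ C H (run A (canon hk H) T) j = out A (canon hk H) T j := by
  have := h.out j
  unfold label
  simp only
  rw [if_pos]
  · rfl
  · exact this

/-- The starting time may depend on the index, so that one statement covers all iterations of the
main loop at once. -/
theorem reach_run {E : Type} {s q : ℕ} (hk : 1 ≤ k) (A : NCCStarAlgorithm)
    (H : E → SimpleGraph (Fin n)) (o : E → Fin n → ℕ) (t₀ : E → ℕ)
    (ho : ∀ e j, o e j < (n + 1) ^ k) (hs : 0 < s)
    (hC : 0 < C) (hsC : s * (3 * C) ≤ S) (hcard : ∀ e, (arr (H e)).card ≤ n * s)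
    (hF : 0 < F) (hFS : F ≤ S) (hFD : n ≤ F ^ D)
    (hgood : ∀ e, GoodRun hk A κ C T (H e)) (ht₀ : ∀ e, t₀ e + q ≤ T) :
    Reach (κ + 5) S ((2 * k + 2 * κ + 20) * S)
      (fun e => simState s (H e) (o e) (run A (canon hk (H e)) (t₀ e))) (q * (2 * D + 5))
      fun e => simState s (H e) (o e) (run A (canon hk (H e)) (t₀ e + q)) := by
  have hsS : s ≤ S := (Nat.le_mul_of_pos_right s (by omega)).trans hsC
  have hCS : 3 * C ≤ S := (Nat.le_mul_of_pos_left _ hs).trans hsC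
  refine Reach.iterate (Y := fun c e => simState s (H e) (o e) (run A (canon hk (H e)) (t₀ e + c)))
    q ?_ ?_
  · exact (stored_simState H o _ ho hs hsS (C := C) (by omega)
      (fun e => (hgood e).memory _ (by have := ht₀ e; omega))
      fun e => inboxOK_run hk (hgood e) (by have := ht₀ e; omega)).mono
      (Nat.mul_le_mul_right _ (by omega))
  · intro c hc
    have h := reach_next hk A H o (fun e => run A (canon hk (H e)) (t₀ e + c)) ho hs hC hsC hcard
      hF hFS hFD (fun e => (hgood e).memory _ (by have := ht₀ e; omega))
      (fun e => inboxOK_run hk (hgood e) (by have := ht₀ e; omega))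
      (fun e => (hgood e).round _ (by have := ht₀ e; omega))
      (fun e => by rw [← run_succ]; exact (hgood e).memory _ (by have := ht₀ e; omega))
    simp only [← run_succ] at h
    exact h

/-- At time `T` the labels are those of a legal solution, with vertices written as ranks. The order
of the identifiers undoes the renaming, and machine `j` outputs the label of the vertex of rank `j`.
-/
theorem outputOK_finalLabel {κ' : ℕ} {P : UnlabeledGraphProblem} (hk : 1 ≤ k) (hkκ : k ≤ κ)
    (hκ : κ ≤ κ') (hCS : C + 1 ≤ S) (A : NCCStarAlgorithm) {e : Instance k n S P}
    (hA : ∀ I : NCCStar.Input k e.1.1, NCCStar.Correct A κ C T P I) :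
    OutputOK κ' e fun j => [(orig e j, finalLabel A hk κ C (relabel e) (orig e)
      (run A (canon hk (relabel e)) T) j)] := by
  obtain ⟨hgood, s, hs1, hs2⟩ := NCCStar.Correct.goodRun hk hA (vert e)
  have hlab := label_run hk hgood
  have hword : ∀ x, x < (n + 1) ^ κ → IsWord κ' n x := fun x hx =>
    hx.trans_le (Nat.pow_le_pow_right (by omega) hκ)
  have hkw : (n + 1) ^ k ≤ (n + 1) ^ κ := Nat.pow_le_pow_right (by omega) hkκ
  have hfl : ∀ j, finalLabel A hk κ C (relabel e) (orig e) (run A (canon hk (relabel e)) T) j =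
      encode e.1.2.ident (s (vert e j)) := by
    intro j
    change (label A hk κ C (e.1.1.comap (vert e))
      (run A (canon hk (e.1.1.comap (vert e))) T) j).map _ = _
    rw [hlab j, hs2 j, List.map_map, encode]
    refine List.map_congr_left fun x _ => ?_
    rcases x with v | x
    · simp only [Function.comp_apply, Sum.map_inl, Sum.inl.injEq, rename, Fin.is_lt, dif_pos]
      exact orig_symm e v
    · rfl
  refine ⟨?_, ?_, s, hs1, ?_⟩
  · intro j
    have h1 : (finalLabel A hk κ C (relabel e) (orig e)
        (run A (canon hk (relabel e)) T) j).length ≤ C := by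
      simpa [finalLabel] using (label_spec A hk κ C (relabel e) _ j).1
    simp only [List.map_cons, List.map_nil, List.sum_cons, List.sum_nil]
    omega
  · intro j q hq
    rw [List.mem_singleton] at hq
    subst hq
    refine ⟨hword _ ((orig_lt e j).trans_le hkw), fun x hx => ?_⟩
    obtain ⟨y, hy, rfl⟩ := List.mem_map.1 hx
    have h1 := (label_spec A hk κ C (relabel e) _ j).2 y hy
    rcases y with y | y
    · refine hword _ ?_
      simp only [Sum.map_inl, tokenValue, rename]
      split_ifs
      · exact (orig_lt e _).trans_le hkw
      · exact Nat.pow_pos (by omega)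
    · exact hword _ h1
  · ext p
    simp only [Set.mem_ofPred_eq, List.mem_singleton, hfl]
    have hne : ∀ v, encode e.1.2.ident (s v) ≠ [] ↔ s v ≠ [] := fun v => by simp [encode]
    constructor
    · rintro ⟨⟨j, rfl⟩, h⟩
      exact ⟨vert e j, rfl, (hne _).1 h⟩
    · rintro ⟨v, rfl, h⟩
      refine ⟨⟨(vert e).symm v, ?_⟩, (hne _).2 h⟩
      rw [orig_symm, Equiv.apply_symm_apply]

/-- The word constant of the simulation. -/
def simWord (k κ : ℕ) : ℕ := 27 * k + 3 * κ + 80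

/-- Simulating `D` rounds costs `O(D²)`, and so does one translation of the labels. This balance is
the reason for blocks of exactly `D` rounds. -/
theorem loop_rounds_le (hD : 0 < D) : D * (2 * D + 5) +
    ((2 * k + 1) * D * (D + 1) + 3 * D + 3) ≤ (2 * k + 12) * (D * (D + 1)) := by
  obtain ⟨d, rfl⟩ := Nat.exists_eq_add_of_lt hD
  have h : (2 * k + 12) * ((0 + d + 1) * (0 + d + 1 + 1)) = (0 + d + 1) * (2 * (0 + d + 1) + 5) +
    ((2 * k + 1) * (0 + d + 1) * (0 + d + 1 + 1) + 3 * (0 + d + 1) + 3) +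
      (9 * d * d + 21 * d + 9) := by
    ring
  omega

-- The preamble builds the array, simulates the first `T % D` rounds and computes labels. Each
-- iteration of the loop simulates `D` more rounds and computes the labels anew, so the output is
-- ready at the end of whichever iteration is the last.
set_option maxHeartbeats 1000000 in
theorem exists_mpc_of_ncc {P : UnlabeledGraphProblem} (hk : 1 ≤ k) (hkκ : k ≤ κ) (hn : 0 < n)
    (ha : 1 ≤ a) (hC : 1 ≤ C) (hS : 12 * a * C ≤ S)
    (harb : ∀ G : SimpleGraph (Fin n), P.IsInstance G → arboricity G ≤ a)
    (hF : 0 < F) (hFS : 2 * F * F ≤ S) (hD : 0 < D) (hFD : n + 1 ≤ F ^ D) (hDn : D ≤ n + 1)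
    (A : NCCStarAlgorithm) (hA : ∀ G : SimpleGraph (Fin n), P.IsInstance G →
      ∀ I : NCCStar.Input k G, NCCStar.Correct A κ C T P I) :
    ∃ R ≤ (7 * k + 20) * (D + 1) * (D + T), ∃ B : MPCAlgorithm, ∀ G : SimpleGraph (Fin n),
      P.IsInstance G → ∀ I : MPC.Input k n G, I.Fits S →
        MPC.Correct B (simWord k κ) S R P I := by
  have hs : 0 < 4 * a := by omega
  have hsC : 4 * a * (3 * C) ≤ S := by nlinarith
  have haS : 8 * a ≤ S := by nlinarith
  have hFS' : F ≤ S := by nlinarith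
  have hFD' : n ≤ F ^ D := (Nat.le_succ n).trans hFD
  have hCS : 3 * C ≤ S := (Nat.le_mul_of_pos_left _ hs).trans hsC
  have hgood : ∀ e : Instance k n S P, GoodRun hk A κ C T (relabel e) := fun e =>
    (NCCStar.Correct.goodRun hk (hA e.1.1 e.2.1) (vert e)).1
  have hcard : ∀ e : Instance k n S P, (arr (relabel e)).card ≤ n * (4 * a) := fun e =>
    card_arr_le ha ((sum_card_nbrs_le e.1.1 (vert e)).trans
      (Nat.mul_le_mul_right _ (Nat.mul_le_mul_left _ (harb _ e.2.1))))
  let c : ℕ → Instance k n S P → NCCStar.Config n := fun t e => run A (canon hk (relabel e)) t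
  -- The remainder is simulated before the loop, so that full blocks end exactly at time `T`.
  let q := T / D
  let m := T % D
  have hqm : m + q * D = T := Nat.mod_add_div' T D
  have hm : m < D := Nat.mod_lt _ hD
  let sim : ℕ → Instance k n S P → Fin n → _ := fun t e =>
    simState (4 * a) (relabel e) (orig e) (c t e)
  let fin : ℕ → Instance k n S P → Fin n → List (ℕ ⊕ ℕ) := fun t e =>
    finalLabel A hk κ C (relabel e) (orig e) (c t e)
  let Y : ℕ → Instance k n S P → Fin n → _ := fun i e j =>
    (sim (m + i * D) e j, fin (m + i * D) e j)
  set b := (18 * k + 3 * κ + 40) * S with hb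
  set w := 4 * k + κ + 5 with hw
  set post := (2 * k + 1) * D * (D + 1) + 3 * D + 3 with hpost
  have hrun : ∀ {E : Type} (f : E → Instance k n S P) (t₀ : E → ℕ) (q : ℕ),
      (∀ e, t₀ e + q ≤ T) → Reach w S b (fun e => sim (t₀ e) (f e)) (q * (2 * D + 5))
        fun e => sim (t₀ e + q) (f e) := fun f t₀ q h =>
    (reach_run hk A (fun e => relabel (f e)) (fun e => orig (f e)) t₀ (fun e => orig_lt (f e)) hs hC
      hsC (fun e => hcard (f e)) hF hFS' hFD' (fun e => hgood (f e)) h).mono (by omega) le_rfl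
      (Nat.mul_le_mul_right _ (by omega))
  have hfin : ∀ {E : Type} (f : E → Instance k n S P) (t : E → ℕ), (∀ e, t e ≤ T) →
      Reach w S b (fun e => sim (t e) (f e)) post fun e j =>
        (sim (t e) (f e) j, fin (t e) (f e) j) :=
    fun f t h => (reach_finalLabel hk hkκ A (fun e => relabel (f e)) (fun e => orig (f e))
      (fun e => c (t e) (f e)) (fun e => orig_strictMono (f e)) (fun e => orig_lt (f e)) hs hC hsC
      (fun e => hcard (f e)) hF hFS hD hFD (fun e => (hgood (f e)).memory _ (h e))
      (fun e => inboxOK_run hk (hgood (f e)) (h e))).mono (by omega) le_rfl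
      (Nat.mul_le_mul_right _ (by omega))
  have hsetup : Reach w S b (placed (k := k) (n := n) (S := S) (P := P))
      ((5 * k + 7) * D * (D + 1)) (sim 0) := by
    refine ((reach_static harb hk ha haS hF hFS hD hFD).mono (by omega) le_rfl
      (Nat.mul_le_mul_right _ (by omega))).det_right ?_
    intro j e e' h
    refine Prod.ext h (Prod.ext ?_ rfl)
    change A.init j (deg (relabel e) j) = A.init j (deg (relabel e') j)
    simp only [static, Prod.mk.injEq] at h
    rw [h.2.2.1]
  have hpre := (hsetup.trans (hrun id (fun _ => 0) m (fun _ => by omega))).trans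
    (hfin id (fun _ => 0 + m) (fun _ => by omega))
  have hloop : Reach w S b (fun (p : Instance k n S P × Fin q) => Y p.2 p.1)
      (D * (2 * D + 5) + post) fun p => Y (p.2 + 1) p.1 := by
    have hle : ∀ p : Instance k n S P × Fin q, m + p.2 * D + D ≤ T := by
      intro p
      have := Nat.mul_le_mul_right D (Nat.succ_le_of_lt p.2.2)
      rw [Nat.succ_mul] at this
      omega
    have hY : ∀ i : ℕ, m + (i + 1) * D = m + i * D + D := fun i => by ring
    have h := (hrun Prod.fst (fun p : Instance k n S P × Fin q => m + p.2 * D) D hle).trans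
      (hfin Prod.fst (fun p : Instance k n S P × Fin q => m + p.2 * D + D) hle)
    have hd : Det (fun (p : Instance k n S P × Fin q) => Y p.2 p.1)
        fun p => sim (m + p.2 * D) p.1 := by
      intro j e e' h
      exact congrArg Prod.fst h
    simp only [Y, hY]
    exact h.det_left hd
  refine ⟨(5 * k + 7) * D * (D + 1) + m * (2 * D + 5) + post + q * (D * (2 * D + 5) + post), ?_,
    exists_mpc_of_reach (κ := simWord k κ) Y ?_ hloop (by omega) ?_ ?_
    (fun e j => [(orig e j, fin T e j)]) ?_ ?_⟩
  · have h1 : D * (2 * D + 5) + post ≤ (2 * k + 12) * (D * (D + 1)) :=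
      loop_rounds_le hD
    have h2 : m * (2 * D + 5) + post ≤ (2 * k + 12) * (D * (D + 1)) := by
      refine le_trans ?_ h1
      have := Nat.mul_le_mul_right (2 * D + 5) hm.le
      omega
    have h3 : q * (D * (2 * D + 5) + post) ≤ (2 * k + 12) * (D + 1) * T := by
      refine (Nat.mul_le_mul_left q h1).trans ?_
      calc q * ((2 * k + 12) * (D * (D + 1))) = (2 * k + 12) * (D + 1) * (q * D) := by ring
        _ ≤ _ := Nat.mul_le_mul_left _ (by omega)
    calc _ ≤ (5 * k + 7) * D * (D + 1) + (2 * k + 12) * (D * (D + 1)) +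
        (2 * k + 12) * (D + 1) * T := by omega
      _ ≤ (7 * k + 20) * (D + 1) * D + (7 * k + 20) * (D + 1) * T := by
          refine add_le_add ?_ ?_
          · have : (7 * k + 20) * (D + 1) * D = (5 * k + 7) * D * (D + 1) +
                (2 * k + 12) * (D * (D + 1)) + D * (D + 1) := by ring
            omega
          · exact Nat.mul_le_mul_right _ (Nat.mul_le_mul_right _ (by omega))
      _ = _ := by ring
  · simpa only [Y, zero_mul, add_zero, zero_add, id] using hpre
  · simp only [simWord]; omega
  · have h1 : m * (2 * D + 5) + post ≤ (2 * k + 12) * (D * (D + 1)) := by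
      have := Nat.mul_le_mul_right (2 * D + 5) hm.le
      have := loop_rounds_le (k := k) hD
      omega
    have h2 : D * (2 * D + 5) + post ≤ (2 * k + 12) * (D * (D + 1)) := loop_rounds_le hD
    have h3 : (5 * k + 7) * D * (D + 1) + m * (2 * D + 5) + post + (D * (2 * D + 5) + post) + 1 ≤
        (9 * k + 32) * (D + 1) ^ 2 := by
      calc _ ≤ (5 * k + 7) * D * (D + 1) + (2 * k + 12) * (D * (D + 1)) +
          (2 * k + 12) * (D * (D + 1)) + 1 := by omega
        _ = (9 * k + 31) * (D * (D + 1)) + 1 := by ring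
        _ ≤ (9 * k + 31) * (D + 1) ^ 2 + (D + 1) ^ 2 :=
            add_le_add (Nat.mul_le_mul_left _ (by rw [pow_two]; exact Nat.mul_le_mul_right _ (by omega)))
              (Nat.one_le_pow _ _ (by omega))
        _ = _ := by ring
    have h4 : (D + 1) ^ 2 ≤ (n + 1) ^ 4 := by
      rw [show 4 = 2 * 2 from rfl, pow_mul]
      exact Nat.pow_le_pow_left (by nlinarith) 2
    -- As `n + 1 ≥ 2`, the constant factor of the clock is absorbed by the word constant.
    have h5 : 9 * k + 32 ≤ (n + 1) ^ (9 * k + 32) :=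
      Nat.lt_two_pow_self.le.trans (Nat.pow_le_pow_left (by omega) _)
    calc _ ≤ (n + 1) ^ (9 * k + 32) * (n + 1) ^ 4 * (n + 1) ^ (b + 1) :=
          Nat.mul_le_mul_right _ (h3.trans (Nat.mul_le_mul h5 h4))
      _ = (n + 1) ^ (9 * k + 32 + 4 + (b + 1)) := by
          rw [← pow_add, ← pow_add]
      _ ≤ ((n + 1) ^ simWord k κ) ^ S := by
          rw [← pow_mul]
          refine Nat.pow_le_pow_right (by omega) ?_
          rw [hb, simWord]
          nlinarith
  · intro j e e' h
    simp only [Y, hqm, Prod.mk.injEq] at h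
    simp only [sim, simState, static, Prod.mk.injEq] at h
    simp only [h.1.1.1, h.2]
  · intro e
    exact outputOK_finalLabel hk hkκ (by simp only [simWord]; omega) (by omega) A
      (hA e.1.1 e.2.1)


/-! ## Networks of bounded size -/

open NCCStar

variable {n k κ C S T : ℕ} {P : UnlabeledGraphProblem}

theorem MPC.Correct.mono {κ' M R : ℕ} {G : SimpleGraph (Fin n)} {A : MPCAlgorithm}
    {I : MPC.Input k M G} (h : MPC.Correct A κ S R P I) (hκ : κ ≤ κ') :
    MPC.Correct A κ' S R P I := by
  have hw : ∀ x, IsWord κ n x → IsWord κ' n x := fun x hx =>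
    lt_of_lt_of_le hx (Nat.pow_le_pow_right (by omega) hκ)
  obtain ⟨h1, h2, h3, h4⟩ := h
  refine ⟨fun t ht i => ⟨(h1 t ht i).1, fun x hx => hw x ((h1 t ht i).2 x hx)⟩,
    fun t ht i => ⟨(h2 t ht i).1, fun m hm => ?_, (h2 t ht i).2.2⟩,
    fun i => ⟨(h3 i).1, fun q hq => ?_⟩, h4⟩
  · obtain ⟨h5, h6, h7⟩ := (h2 t ht i).2.1 m hm
    exact ⟨h5, fun x hx => hw x (h6 x hx), h7⟩
  · obtain ⟨h5, h6⟩ := (h3 i).2 q hq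
    exact ⟨hw _ h5, fun x hx => hw _ (h6 x hx)⟩

/-- The placement does not reveal how the vertices are numbered in the instance, but it determines
the sorted identifiers and the relabelled graph, and the simulated run depends on nothing else. -/
theorem eq_of_placed_eq {e e' : Instance k n S P} (h : placed e = placed e') :
    orig e = orig e' ∧ relabel e = relabel e' := by
  have h1 : univ.image (orig e) = univ.image (orig e') := by
    rw [← biUnion_vertices, ← biUnion_vertices]
    exact biUnion_congr rfl fun i _ => (Prod.mk.inj (congrFun h i)).1
  have h2 : orig e = orig e' := by
    funext i
    have hmem : orig e i ∈ univ.image (orig e') := h1 ▸ mem_image_of_mem _ (mem_univ i)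
    obtain ⟨j, -, hj⟩ := mem_image.1 hmem
    have h3 := rank_image (orig_strictMono e) i
    rw [h1, ← hj, rank_image (orig_strictMono e')] at h3
    rw [← hj, Fin.ext h3]
  refine ⟨h2, ?_⟩
  have key' : ∀ e e' : Instance k n S P, placed e = placed e' → orig e = orig e' → ∀ a b, a < b →
      (relabel e).Adj a b → (relabel e').Adj a b := by
    intro e e' h h2 a b hab hadj
    have h3 : (orig e a, orig e b) ∈ edgePairs e (e.1.2.edgeLoc s(vert e a, vert e b)) :=
      mem_edgePairs.2 ⟨a, b, hab, hadj, rfl, rfl⟩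
    unfold edgePairs at h3
    rw [(Prod.mk.inj (congrFun h _)).2] at h3
    obtain ⟨a', b', -, h4, h5, -⟩ := (mem_edgePairs (e := e')).1 h3
    rw [h2, Prod.mk.injEq] at h5
    have h6 := (orig_strictMono e').injective h5.1
    have h7 := (orig_strictMono e').injective h5.2
    subst h6 h7
    exact h4
  ext a b
  rcases lt_trichotomy a b with hab | rfl | hab
  · exact ⟨key' e e' h h2 a b hab, key' e' e h.symm h2.symm a b hab⟩
  · simp
  · rw [(relabel e).adj_comm, (relabel e').adj_comm]
    exact ⟨key' e e' h h2 b a hab, key' e' e h.symm h2.symm b a hab⟩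

/-- The possible partial knowledge of the input. -/
def knowledge (n k : ℕ) : Set (Fin n → Option (Finset ℕ × Finset (Sym2 ℕ))) :=
  {f | ∀ i, f i ∈ insert none (some '' ({V | V ⊆ range ((n + 1) ^ k)} ×ˢ
    {D | D ⊆ (range ((n + 1) ^ k)).sym2}))}

theorem finite_knowledge (n k : ℕ) : (knowledge n k).Finite := by
  refine Set.Finite.pi' fun i => Set.Finite.insert _ (Set.Finite.image _ ?_)
  refine Set.Finite.prod ?_ ?_
  · have : {V : Finset ℕ | V ⊆ range ((n + 1) ^ k)} =
      ((range ((n + 1) ^ k)).powerset : Set (Finset ℕ)) := by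
      ext V; rw [Finset.mem_coe, Finset.mem_powerset]; rfl
    rw [this]
    exact Finset.finite_toSet _
  · have : {V : Finset (Sym2 ℕ) | V ⊆ (range ((n + 1) ^ k)).sym2} =
      (((range ((n + 1) ^ k)).sym2).powerset : Set (Finset (Sym2 ℕ))) := by
      ext V; rw [Finset.mem_coe, Finset.mem_powerset]; rfl
    rw [this]
    exact Finset.finite_toSet _

/-- A word constant for which the whole input of `n` machines takes a single word. -/
def gossipWord (n k : ℕ) : ℕ := (finite_knowledge n k).toFinset.card

theorem small_knowledge (hn : 0 < n) : Small (knowledge n k) ((n + 1) ^ gossipWord n k) := by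
  unfold Small
  rw [(finite_knowledge n k).encard_eq_coe_toFinset_card]
  have : gossipWord n k ≤ (n + 1) ^ gossipWord n k :=
    Nat.lt_two_pow_self.le.trans (Nat.pow_le_pow_left (by omega) _)
  exact_mod_cast this

open Classical in
/-- The input of the machines at a distance smaller than `r`. -/
def nearby (r : ℕ) (e : Instance k n S P) (i m : Fin n) :
    Option (Finset ℕ × Finset (Sym2 ℕ)) :=
  if (m : ℕ) < i + r ∧ (i : ℕ) < m + r then some (placed e m) else none

theorem nearby_mem (r : ℕ) (e : Instance k n S P) (i : Fin n) : nearby r e i ∈ knowledge n k := by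
  classical
  intro m
  unfold nearby
  split_ifs
  · refine Or.inr ⟨_, ⟨?_, ?_⟩, rfl⟩
    · intro x hx
      obtain ⟨v, -, rfl⟩ := mem_image.1 hx
      exact mem_range.2 (e.1.2.ident v).2
    · intro z hz
      obtain ⟨z', -, rfl⟩ := mem_image.1 hz
      induction z' with
      | _ u v =>
        rw [Sym2.map_mk, mk_mem_sym2_iff]
        exact ⟨mem_range.2 (e.1.2.ident u).2, mem_range.2 (e.1.2.ident v).2⟩
  · exact Or.inl rfl

theorem stored_nearby (r : ℕ) :
    Stored (gossipWord n k) (nearby (k := k) (n := n) (S := S) (P := P) r) :=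
  fun i => (small_knowledge i.pos).mono (by rintro _ ⟨e, rfl⟩; exact nearby_mem r e i) le_rfl

/-- The known radius doubles in every round, by exchanging everything with the two machines at
distance `2 ^ L`. A message is a single word, because the word constant is allowed to depend on `n`
here. -/
theorem reach_gossip (L : ℕ) (hS : 2 ≤ S ∨ L = 0) :
    Reach (gossipWord n k) S (gossipWord n k) (placed (k := k) (n := n) (S := S) (P := P)) L
      (nearby (2 ^ L)) := by
  classical
  induction L with
  | zero =>
    refine .loc ?_ (stored_nearby _)
    intro i e e' h
    funext m
    unfold nearby
    by_cases hm : m = i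
    · subst hm; rw [h]
    · have : (m : ℕ) ≠ i := fun h' => hm (Fin.ext h')
      rw [if_neg (by omega), if_neg (by omega)]
  | succ L ih =>
    have hS2 : 2 ≤ S := by omega
    obtain ⟨near, hnear⟩ : ∃ near : Fin n → Fin n → Prop, ∀ j i, near j i ↔
      ((j : ℕ) = i + 2 ^ L ∨ (i : ℕ) = j + 2 ^ L) := ⟨_, fun _ _ => Iff.rfl⟩
    have hsymm : ∀ i j, near i j → near j i := fun i j h => (hnear _ _).2 ((hnear _ _).1 h).symm
    have hcard : ∀ i, (univ.filter fun j => near j i).card ≤ 2 := by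
      intro i
      have hsub : (univ.filter fun j => near j i).image (fun j : Fin n => (j : ℕ)) ⊆
          {(i : ℕ) + 2 ^ L, (i : ℕ) - 2 ^ L} := by
        intro x hx
        obtain ⟨j, hj, rfl⟩ := mem_image.1 hx
        rcases (hnear _ _).1 (mem_filter.1 hj).2 with h | h <;> simp <;> omega
      rw [← card_image_of_injective _ Fin.val_injective]
      exact (card_le_card hsub).trans card_le_two
    have hsum : ∀ (p : Fin n → Prop) (f : Fin n → Fin n → Option (Finset ℕ × Finset (Sym2 ℕ))),
        ∑ j, (if p j then [f j] else []).length = (univ.filter p).card := by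
      intro p f
      rw [card_filter]
      refine sum_congr rfl fun j _ => ?_
      by_cases hp : p j <;> simp [hp]
    refine .round (M := fun e j i => if near j i then [nearby (2 ^ L) e j] else []) (ih (.inl hS2))
      ⟨?_, ?_, ?_, ?_⟩ ?_ (stored_nearby _)
    · rcases Nat.eq_zero_or_pos n with rfl | hn
      · refine (Small.range_lt (m := 0) ∅ (by simp)).image (fun _ => default) |>.mono ?_ (by simp)
        rintro y ⟨e, u, -⟩
        exact u.elim0
      · refine (small_knowledge hn).mono ?_ le_rfl
        rintro y ⟨e, j, i, hy⟩
        split_ifs at hy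
        · rw [List.mem_singleton.1 hy]; exact nearby_mem _ _ _
        · simp at hy
    · intro j e e' h
      simp only [h]
    · intro e j
      rw [hsum (fun i => near j i) fun _ => nearby (2 ^ L) e j]
      refine le_trans (card_le_card ?_) ((hcard j).trans hS2)
      intro i hi
      exact mem_filter.2 ⟨mem_univ _, hsymm _ _ (mem_filter.1 hi).2⟩
    · intro e i
      rw [hsum (fun j => near j i) fun j => nearby (2 ^ L) e j]
      exact (hcard i).trans hS2
    · intro i e e' h
      simp only [Prod.mk.injEq] at h
      obtain ⟨h1, h2⟩ := h
      have hval : ∀ j, near j i → nearby (2 ^ L) e j = nearby (2 ^ L) e' j := by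
        intro j hj
        have := congrFun h2 j
        simpa only [hj, if_true, List.cons.injEq, and_true] using this
      have hplaced : ∀ j m : Fin n, nearby (2 ^ L) e j = nearby (2 ^ L) e' j →
          (m : ℕ) < j + 2 ^ L → (j : ℕ) < m + 2 ^ L → placed e m = placed e' m := by
        intro j m h h3 h4
        have := congrFun h m
        simpa only [nearby, h3, h4, and_self, if_true, Option.some.injEq] using this
      funext m
      unfold nearby
      by_cases hm : (m : ℕ) < i + 2 ^ (L + 1) ∧ (i : ℕ) < m + 2 ^ (L + 1)
      · rw [if_pos hm, if_pos hm]
        congr 1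
        rw [pow_succ] at hm
        -- Machine `m` is either within the old radius of `i`, or within the old radius of the
        -- partner on its side. That partner exists because it does not lie beyond `m`.
        by_cases h3 : (m : ℕ) < i + 2 ^ L
        · by_cases h4 : (i : ℕ) < m + 2 ^ L
          · exact hplaced i m h1 h3 h4
          · have hj : (i : ℕ) - 2 ^ L < n := by have := i.2; omega
            exact hplaced ⟨_, hj⟩ m (hval _ ((hnear _ _).2 (.inr (by simp only; omega))))
              (by simp only; omega) (by simp only; omega)
        · have hj : (i : ℕ) + 2 ^ L < n := by have := m.2; omega
          exact hplaced ⟨_, hj⟩ m (hval _ ((hnear _ _).2 (.inl rfl)))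
            (by simp only; omega) (by simp only; omega)
      · rw [if_neg hm, if_neg hm]

/-- Once all machines know the whole input, each one runs the simulated algorithm on its own; no
rounds are spent on the simulation, whatever `T` is. -/
theorem exists_mpc_of_gossip {L κ' : ℕ} (hk : 1 ≤ k) (hkκ : k ≤ κ) (hκ : κ ≤ κ')
    (hg : gossipWord n k + 3 ≤ κ') (hCS : C + 1 ≤ S) (hS : 2 ≤ S ∨ L = 0) (hL : n ≤ 2 ^ L)
    (hLn : L ≤ n) (A : NCCStarAlgorithm) (hA : ∀ G : SimpleGraph (Fin n), P.IsInstance G →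
      ∀ I : NCCStar.Input k G, NCCStar.Correct A κ C T P I) :
    ∃ B : MPCAlgorithm, ∀ G : SimpleGraph (Fin n), P.IsInstance G →
      ∀ I : MPC.Input k n G, I.Fits S → MPC.Correct B κ' S L P I := by
  rcases Nat.eq_zero_or_pos n with rfl | hn
  · refine ⟨⟨fun _ _ _ => [], fun _ _ _ => ([], []), fun _ _ _ => []⟩, fun G hG I _ =>
      ⟨fun _ _ i => i.elim0, fun _ _ i => i.elim0, fun i => i.elim0, ?_⟩⟩
    obtain ⟨-, s, hs, -⟩ := NCCStar.Correct.goodRun hk (hA G hG) (Equiv.refl _)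
    refine ⟨s, hs, ?_⟩
    ext q
    constructor
    · rintro ⟨⟨i, -⟩, -⟩; exact i.elim0
    · rintro ⟨v, -⟩; exact v.elim0
  -- The loop is iterated zero times. Its body is a dummy of length 1, since blocks must have
  -- positive length.
  · have h := exists_mpc_of_reach (κ := κ') (L₁ := 1) (q := 0) (P := P)
      (fun _ => nearby (k := k) (n := n) (S := S) (P := P) (2 ^ L)) (reach_gossip L hS)
      ((Reach.loc (fun i p => p.2.elim0) (fun i => by
        rw [Small, Set.range_eq_empty_iff.2 ⟨fun p => p.2.elim0⟩]; simp)).pad (by omega))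
      one_pos (by omega) ?_ (fun e j => [(orig e j, finalLabel A hk κ C (relabel e) (orig e)
        (run A (canon hk (relabel e)) T) j)]) ?_
      (fun e => outputOK_finalLabel hk hkκ hκ hCS A (hA e.1.1 e.2.1))
    · simpa using h
    · have h1 : L + 1 + 1 ≤ (n + 1) ^ 2 := by nlinarith
      calc (L + 1 + 1) * (n + 1) ^ (gossipWord n k + 1)
          ≤ (n + 1) ^ 2 * (n + 1) ^ (gossipWord n k + 1) := Nat.mul_le_mul_right _ h1
        _ = (n + 1) ^ (2 + (gossipWord n k + 1)) := by rw [← pow_add]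
        _ ≤ ((n + 1) ^ κ') ^ S := by
          rw [← pow_mul]
          refine Nat.pow_le_pow_right (by omega) ?_
          nlinarith
    · intro i e e' h
      have : placed e = placed e' := by
        funext m
        have h1 := congrFun h m
        have h2 : (m : ℕ) < i + 2 ^ L := by have := m.2; omega
        have h3 : (i : ℕ) < m + 2 ^ L := by have := i.2; omega
        simpa only [nearby, h2, h3, and_self, if_true, Option.some.injEq] using h1
      obtain ⟨h1, h2⟩ := eq_of_placed_eq this
      have key : ∀ H H' : SimpleGraph (Fin n), H = H' → ∀ o : Fin n → ℕ,
          finalLabel A hk κ C H o (run A (canon hk H) T) i =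
            finalLabel A hk κ C H' o (run A (canon hk H') T) i := by
        rintro H _ rfl o; rfl
      simp only [h1, key _ _ h2]


/-! ### The branching factor and the bounds on the number of rounds -/

variable {n k κ C S T : ℕ} {P : UnlabeledGraphProblem}

/-- The estimate `n + 1 ≤ n ^ 2` costs the factor 2, and rounding up costs the summand 1. -/
theorem clog_succ_le {F : ℕ} {x : ℝ} (hF : 1 < F) (hn : 2 ≤ n) (h : (n : ℝ) ≤ (F : ℝ) ^ x) :
    (Nat.clog F (n + 1) : ℝ) ≤ 2 * x + 1 := by
  have hF' : (1 : ℝ) < F := by exact_mod_cast hF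
  have h1 : F ^ (Nat.clog F (n + 1)).pred < n + 1 := Nat.pow_pred_clog_lt_self hF (by omega)
  have h2 : n + 1 ≤ n * n := by nlinarith
  have h3 : (F : ℝ) ^ (((Nat.clog F (n + 1)).pred : ℕ) : ℝ) < (F : ℝ) ^ (2 * x) := by
    rw [Real.rpow_natCast]
    calc ((F : ℝ) ^ (Nat.clog F (n + 1)).pred) < n * n := by exact_mod_cast h1.trans_le h2
      _ ≤ (F : ℝ) ^ x * (F : ℝ) ^ x := by gcongr
      _ = (F : ℝ) ^ (2 * x) := by rw [← Real.rpow_add (by linarith), two_mul]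
  have h4 := (Real.rpow_lt_rpow_left_iff hF').1 h3
  have h5 : Nat.clog F (n + 1) ≤ (Nat.clog F (n + 1)).pred + 1 := by
    rw [Nat.pred_eq_sub_one]; omega
  have h6 : (Nat.clog F (n + 1) : ℝ) ≤ ((Nat.clog F (n + 1)).pred : ℕ) + 1 := by exact_mod_cast h5
  linarith

theorem three_le_sqrt_half (hS : 18 ≤ S) : 3 ≤ Nat.sqrt (S / 2) :=
  Nat.le_sqrt.2 (by omega)

/-- The largest `F` with `2 * F * F ≤ S` satisfies `S < 2 * (F + 1) ^ 2`, which is at most `9 * F ^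
2` and hence at most `F ^ 4`, as `F ≥ 3`. -/
theorem le_sqrt_half_pow_four (hS : 18 ≤ S) : S ≤ Nat.sqrt (S / 2) ^ 4 := by
  have h3 := three_le_sqrt_half hS
  have h := Nat.lt_succ_sqrt (S / 2)
  set F := Nat.sqrt (S / 2)
  have h1 : S < 2 * ((F + 1) * (F + 1)) := by
    have : S / 2 < (F + 1) * (F + 1) := h
    omega
  have h2 : 2 * ((F + 1) * (F + 1)) ≤ 9 * (F * F) := by nlinarith
  have h4 : 9 * (F * F) ≤ F ^ 4 := by
    have : 9 ≤ F * F := by nlinarith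
    calc 9 * (F * F) ≤ (F * F) * (F * F) := Nat.mul_le_mul_right _ this
      _ = F ^ 4 := by ring
  omega

/-- From `n ^ δ ≤ S ≤ F ^ 4` follows `n ≤ F ^ (4 / δ)`, and `2 * (4 / δ) + 1 ≤ 9 / δ`. -/
theorem clog_sqrt_half_le {δ : ℝ} (hδ : 0 < δ) (hδ1 : δ < 1) (hn : 2 ≤ n) (hS : 18 ≤ S)
    (h : (n : ℝ) ^ δ ≤ S) : (Nat.clog (Nat.sqrt (S / 2)) (n + 1) : ℝ) ≤ 9 / δ := by
  have h3 := three_le_sqrt_half hS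
  have h4 : (S : ℝ) ≤ (Nat.sqrt (S / 2) : ℝ) ^ (4 : ℝ) := by
    have := le_sqrt_half_pow_four hS
    exact_mod_cast this
  have h5 : (n : ℝ) ≤ (Nat.sqrt (S / 2) : ℝ) ^ (4 / δ) := by
    rw [div_eq_mul_inv, Real.rpow_mul (by positivity)]
    calc (n : ℝ) = ((n : ℝ) ^ δ) ^ δ⁻¹ := (Real.rpow_rpow_inv (by positivity) hδ.ne').symm
      _ ≤ _ := by
        refine Real.rpow_le_rpow (by positivity) (h.trans h4) (by positivity)
  have h6 := clog_succ_le (by omega) hn h5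
  have h7 : 1 ≤ 1 / δ := by rw [le_div_iff₀ hδ]; linarith
  calc _ ≤ _ := h6
    _ ≤ 2 * (4 / δ) + 1 / δ := by linarith
    _ = 9 / δ := by ring

theorem exists_mpc_of_ncc_sqrt {a : ℕ} (hk : 1 ≤ k) (hkκ : k ≤ κ) (hn : 2 ≤ n) (ha : 1 ≤ a)
    (hC : 1 ≤ C) (hS : 12 * a * C ≤ S) (hS18 : 18 ≤ S)
    (harb : ∀ G : SimpleGraph (Fin n), P.IsInstance G → arboricity G ≤ a)
    (A : NCCStarAlgorithm) (hA : ∀ G : SimpleGraph (Fin n), P.IsInstance G →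
      ∀ I : NCCStar.Input k G, NCCStar.Correct A κ C T P I) :
    ∃ R ≤ (7 * k + 20) * (Nat.clog (Nat.sqrt (S / 2)) (n + 1) + 1) *
        (Nat.clog (Nat.sqrt (S / 2)) (n + 1) + T),
      ∃ B : MPCAlgorithm, ∀ G : SimpleGraph (Fin n), P.IsInstance G →
        ∀ I : MPC.Input k n G, I.Fits S → MPC.Correct B (simWord k κ) S R P I := by
  have h3 := three_le_sqrt_half hS18
  have hsq := Nat.sqrt_le (S / 2)
  refine exists_mpc_of_ncc (F := Nat.sqrt (S / 2)) hk hkκ (by omega) ha hC hS harb (by omega) ?_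
    (Nat.clog_pos (by omega) (by omega)) (Nat.le_pow_clog (by omega) _) ?_ A hA
  · rw [mul_assoc]; omega
  · refine Nat.clog_le_of_le_pow ?_
    exact Nat.lt_two_pow_self.le.trans (Nat.pow_le_pow_left (by omega) _)

/-- The number of levels enters twice. One factor is always bounded by `10 / δ`, the other by `3x`,
where `x` is the logarithm to base `β` in the first claim and `3 / δ` in the second; this gives the
constant 30. -/
theorem rounds_le {δ x : ℝ} {D R : ℕ} (hδ : 0 < δ) (hδ1 : δ < 1)
    (hR : R ≤ (7 * k + 20) * (D + 1) * (D + T))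
    (hD : (D : ℝ) ≤ 9 / δ) (hx : (D : ℝ) ≤ 3 * x) :
    (R : ℝ) ≤ (30 * (7 * k + 20) : ℕ) * (x / δ) + (30 * (7 * k + 20) : ℕ) / δ * T := by
  have h7 : 1 ≤ 1 / δ := by rw [le_div_iff₀ hδ]; linarith
  have h1 : (D : ℝ) + 1 ≤ 10 / δ := by
    calc (D : ℝ) + 1 ≤ 9 / δ + 1 / δ := by linarith
      _ = _ := by ring
  have hT : (0 : ℝ) ≤ T := by positivity
  have hx0 : 0 ≤ x := by
    have : (0 : ℝ) ≤ D := by positivity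
    linarith
  calc (R : ℝ) ≤ ((7 * k + 20) * (D + 1) * (D + T) : ℕ) := by exact_mod_cast hR
    _ = (7 * k + 20) * (D + 1) * (D + T) := by push_cast; ring
    _ ≤ (7 * k + 20) * (10 / δ) * (3 * x + 3 * T) := by gcongr; linarith
    _ = _ := by push_cast; field_simp; ring

/-- For `n ≤ 1` the logarithm vanishes, and if also `T = 0` then no rounds at all are available. But
then there is at most one machine, which holds the whole input. -/
theorem exists_mpc_of_le_one {κ' : ℕ} (hk : 1 ≤ k) (hkκ : k ≤ κ)
    (hκ : κ + gossipWord 0 k + gossipWord 1 k + 3 ≤ κ') (hn : n ≤ 1) (hCS : C + 1 ≤ S)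
    (A : NCCStarAlgorithm) (hA : ∀ G : SimpleGraph (Fin n), P.IsInstance G →
      ∀ I : NCCStar.Input k G, NCCStar.Correct A κ C T P I) :
    ∃ B : MPCAlgorithm, ∀ G : SimpleGraph (Fin n), P.IsInstance G →
      ∀ I : MPC.Input k n G, I.Fits S → MPC.Correct B κ' S 0 P I := by
  refine exists_mpc_of_gossip hk hkκ (by omega) ?_ hCS (.inr rfl) (by simpa using hn)
    (Nat.zero_le _) A hA
  obtain rfl | rfl : n = 0 ∨ n = 1 := by omega
  all_goals omega

theorem exists_mpc_of_logb {κ' a : ℕ} {δ β : ℝ} (hk : 1 ≤ k) (hkκ : k ≤ κ)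
    (hκ : simWord k κ + κ + gossipWord 0 k + gossipWord 1 k + 3 ≤ κ') (hδ : 0 < δ) (hδ1 : δ < 1)
    (hC : 1 ≤ C) (ha : 1 ≤ a) (hβ : 2 ≤ β)
    (hS : ((30 * (7 * k + 20) : ℕ) : ℝ) * (β * a * (β * a + Real.logb β n) + C * β * a) ≤ S)
    (hnS : (n : ℝ) ^ δ ≤ S)
    (harb : ∀ G : SimpleGraph (Fin n), P.IsInstance G → arboricity G ≤ a)
    (A : NCCStarAlgorithm) (hA : ∀ G : SimpleGraph (Fin n), P.IsInstance G →
      ∀ I : NCCStar.Input k G, NCCStar.Correct A κ C T P I) :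
    ∃ R : ℕ, (R : ℝ) ≤ (30 * (7 * k + 20) : ℕ) * (⌈Real.logb β n⌉₊ / δ) +
        (30 * (7 * k + 20) : ℕ) / δ * T ∧
      ∃ B : MPCAlgorithm, ∀ G : SimpleGraph (Fin n), P.IsInstance G →
        ∀ I : MPC.Input k n G, I.Fits S → MPC.Correct B κ' S R P I := by
  have hC' : (1 : ℝ) ≤ C := by exact_mod_cast hC
  have ha' : (1 : ℝ) ≤ a := by exact_mod_cast ha
  have hlog : 0 ≤ Real.logb β n := by
    rcases Nat.eq_zero_or_pos n with rfl | hn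
    · simp
    · exact Real.logb_nonneg (by linarith) (by exact_mod_cast hn)
  have hβa : β ≤ β * a := le_mul_of_one_le_right (by linarith) ha'
  have haC : (1 : ℝ) ≤ a * C := by nlinarith
  -- Only two parts of the memory bound matter: `β²`, which makes the branching factor at least `β`,
  -- and `aC`, which pays for the searches.
  have hbase : (600 : ℝ) * (β * β + 2 * (a * C)) ≤ S := by
    refine le_trans ?_ hS
    have h1 : (600 : ℝ) ≤ ((30 * (7 * k + 20) : ℕ) : ℝ) := by
      exact_mod_cast (by omega : 600 ≤ 30 * (7 * k + 20))
    have h2 : β * β ≤ β * a * (β * a + Real.logb β n) :=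
      mul_le_mul hβa (by linarith) (by linarith) (by linarith)
    have h3 : 2 * ((a : ℝ) * C) ≤ C * β * a := by nlinarith
    exact mul_le_mul h1 (by linarith) (by positivity) (by positivity)
  have hββ : 4 ≤ β * β := by nlinarith
  have hS12 : 12 * a * C ≤ S := by
    have : (12 : ℝ) * a * C ≤ S := by nlinarith
    exact_mod_cast this
  rcases Nat.lt_or_ge 1 n with hn | hn
  · have hS18 : 18 ≤ S := by
      have : (18 : ℝ) ≤ S := by nlinarith
      exact_mod_cast this
    obtain ⟨R, hR, B, hB⟩ := exists_mpc_of_ncc_sqrt hk hkκ hn ha hC hS12 hS18 harb A hA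
    refine ⟨R, rounds_le hδ hδ1 hR (clog_sqrt_half_le hδ hδ1 hn hS18 hnS) ?_, B,
      fun G hG I hI => (hB G hG I hI).mono (by omega)⟩
    have h3 := three_le_sqrt_half hS18
    -- Otherwise `S < 2 * (F + 1) ^ 2` with `3 ≤ F < β` would contradict `S ≥ 600 * β²`.
    have hF : β ≤ (Nat.sqrt (S / 2) : ℕ) := by
      have h : S / 2 < (Nat.sqrt (S / 2) + 1) * (Nat.sqrt (S / 2) + 1) := Nat.lt_succ_sqrt _
      have h1 : S < 2 * ((Nat.sqrt (S / 2) + 1) * (Nat.sqrt (S / 2) + 1)) := by omega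
      have h2 : (S : ℝ) < 2 * (((Nat.sqrt (S / 2) : ℕ) + 1) * ((Nat.sqrt (S / 2) : ℕ) + 1)) := by
        exact_mod_cast h1
      have h4 : (3 : ℝ) ≤ (Nat.sqrt (S / 2) : ℕ) := by exact_mod_cast h3
      by_contra! hlt
      nlinarith
    have hn0 : (0 : ℝ) < n := by exact_mod_cast (by omega : 0 < n)
    have h5 : (n : ℝ) ≤ ((Nat.sqrt (S / 2) : ℕ) : ℝ) ^ ((⌈Real.logb β n⌉₊ : ℕ) : ℝ) := by
      calc (n : ℝ) = β ^ Real.logb β n :=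
            (Real.rpow_logb (by linarith) (by linarith) hn0).symm
        _ ≤ β ^ ((⌈Real.logb β n⌉₊ : ℕ) : ℝ) :=
            Real.rpow_le_rpow_of_exponent_le (by linarith) (Nat.le_ceil _)
        _ ≤ _ := Real.rpow_le_rpow (by linarith) hF (by positivity)
    have h6 := clog_succ_le (by omega) hn h5
    have h7 : 1 ≤ ⌈Real.logb β n⌉₊ := Nat.one_le_ceil_iff.2
      (Real.logb_pos (by linarith) (by exact_mod_cast hn))
    have h8 : (1 : ℝ) ≤ (⌈Real.logb β n⌉₊ : ℕ) := by exact_mod_cast h7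
    linarith
  · refine ⟨0, by rw [Nat.cast_zero]; positivity,
      exists_mpc_of_le_one hk hkκ (by omega) hn ?_ A hA⟩
    have : (C : ℝ) + 1 ≤ S := by nlinarith
    exact_mod_cast this

/-- With `x = n ^ δ` the simulation needs about `12 * x ^ 2` words out of `x ^ 4`, which is safe for
`x ≥ 4`. For `2 ≤ x < 4` the memory may be too small, but then `n` is bounded in terms of `δ` and
spreading the whole input takes `O(1 / δ)` rounds. For `x < 2` there are no instances. -/
theorem exists_mpc_of_rpow {κ' : ℕ} {δ : ℝ} (hk : 1 ≤ k) (hkκ : k ≤ κ) (hδ : 0 < δ)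
    (hδ1 : δ < 1) (hκ : simWord k κ + κ ≤ κ')
    (hg : (n : ℝ) ^ δ < 4 → gossipWord n k + 3 ≤ κ')
    (harb : ∀ G : SimpleGraph (Fin n), P.IsInstance G →
      2 ≤ (n : ℝ) ^ δ ∧ (arboricity G : ℝ) ≤ (n : ℝ) ^ δ)
    (A : NCCStarAlgorithm) (hA : ∀ G : SimpleGraph (Fin n), P.IsInstance G →
      ∀ I : NCCStar.Input k G, NCCStar.Correct A κ ⌊(n : ℝ) ^ δ⌋₊ T P I) :
    ∃ R : ℕ, (R : ℝ) ≤ (90 * (7 * k + 20) : ℕ) * (1 / δ ^ 2) +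
        (90 * (7 * k + 20) : ℕ) / δ * T ∧
      ∃ B : MPCAlgorithm, ∀ G : SimpleGraph (Fin n), P.IsInstance G →
        ∀ I : MPC.Input k n G, I.Fits ⌊(n : ℝ) ^ (4 * δ)⌋₊ →
          MPC.Correct B κ' ⌊(n : ℝ) ^ (4 * δ)⌋₊ R P I := by
  have h7 : 1 ≤ 1 / δ := by rw [le_div_iff₀ hδ]; linarith
  have hx4 : (n : ℝ) ^ (4 * δ) = ((n : ℝ) ^ δ) ^ 4 := by
    rw [mul_comm, Real.rpow_mul (by positivity)]
    exact Real.rpow_natCast _ 4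
  rw [hx4]
  set x := (n : ℝ) ^ δ with hx
  rcases lt_or_ge x 2 with hx2 | hx2
  · exact ⟨0, by rw [Nat.cast_zero]; positivity,
      ⟨fun _ _ _ => [], fun _ _ _ => ([], []), fun _ _ _ => []⟩,
      fun G hG => absurd (harb G hG).1 (not_le.2 hx2)⟩
  have hn : 2 ≤ n := by
    by_contra! hlt
    obtain rfl | rfl : n = 0 ∨ n = 1 := by omega
    · rw [Nat.cast_zero, Real.zero_rpow hδ.ne'] at hx; linarith
    · rw [Nat.cast_one, Real.one_rpow] at hx; linarith
  have hxx : 4 ≤ x ^ 2 := by nlinarith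
  have hx8 : 4 * x ^ 2 ≤ x ^ 4 := by
    calc 4 * x ^ 2 ≤ x ^ 2 * x ^ 2 := by gcongr
      _ = x ^ 4 := by ring
  have hfl : (⌊x⌋₊ : ℝ) ≤ x := Nat.floor_le (by linarith)
  rcases lt_or_ge x 4 with hx4' | hx4'
  · have hlt : (n : ℝ) ≤ 2 ^ ⌈2 / δ⌉₊ := by
      calc (n : ℝ) = x ^ δ⁻¹ := (Real.rpow_rpow_inv (by positivity) hδ.ne').symm
        _ ≤ (2 ^ (2 : ℝ)) ^ δ⁻¹ := by
          refine Real.rpow_le_rpow (by linarith) ?_ (by positivity)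
          norm_num; exact hx4'.le
        _ = 2 ^ (2 / δ) := by rw [← Real.rpow_mul (by norm_num), div_eq_mul_inv]
        _ ≤ 2 ^ ((⌈2 / δ⌉₊ : ℕ) : ℝ) :=
          Real.rpow_le_rpow_of_exponent_le (by norm_num) (Nat.le_ceil _)
        _ = _ := Real.rpow_natCast _ _
    refine ⟨Nat.clog 2 n, ?_, exists_mpc_of_gossip hk hkκ (by omega) (hg hx4') ?_ (.inl ?_)
      (Nat.le_pow_clog (by norm_num) _)
      (Nat.clog_le_of_le_pow Nat.lt_two_pow_self.le) A hA⟩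
    · have h1 : Nat.clog 2 n ≤ ⌈2 / δ⌉₊ := Nat.clog_le_of_le_pow (by exact_mod_cast hlt)
      have h2 : ((⌈2 / δ⌉₊ : ℕ) : ℝ) < 2 / δ + 1 := Nat.ceil_lt_add_one (by positivity)
      have h3 : (Nat.clog 2 n : ℝ) ≤ (⌈2 / δ⌉₊ : ℕ) := by exact_mod_cast h1
      have h4 : 1 / δ ≤ 1 / δ ^ 2 := by
        rw [show 1 / δ ^ 2 = 1 / δ * (1 / δ) by ring]
        exact le_mul_of_one_le_left (by positivity) h7
      have h5 : (3 : ℝ) ≤ (90 * (7 * k + 20) : ℕ) := by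
        exact_mod_cast (by omega : 3 ≤ 90 * (7 * k + 20))
      have h6 : (0 : ℝ) ≤ (90 * (7 * k + 20) : ℕ) / δ * T := by positivity
      have h8 : 3 * (1 / δ ^ 2) ≤ ((90 * (7 * k + 20) : ℕ) : ℝ) * (1 / δ ^ 2) := by gcongr
      have h9 : 2 / δ = 2 * (1 / δ) := by ring
      linarith
    · refine Nat.le_floor ?_
      push_cast
      nlinarith
    · refine Nat.le_floor ?_
      push_cast
      nlinarith
  · have h16 : 16 ≤ x ^ 2 := by nlinarith
    have h16' : 16 * x ^ 2 ≤ x ^ 4 := by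
      calc 16 * x ^ 2 ≤ x ^ 2 * x ^ 2 := by gcongr
        _ = x ^ 4 := by ring
    have hc : 1 ≤ ⌊x⌋₊ := Nat.le_floor (by push_cast; linarith)
    have hS18 : 18 ≤ ⌊x ^ 4⌋₊ := Nat.le_floor (by push_cast; linarith)
    have hxS : x ≤ (⌊x ^ 4⌋₊ : ℕ) := by
      have := Nat.lt_floor_add_one (x ^ 4)
      nlinarith
    obtain ⟨R, hR, B, hB⟩ := exists_mpc_of_ncc_sqrt (S := ⌊x ^ 4⌋₊) hk hkκ hn hc hc
      (Nat.le_floor (by push_cast; nlinarith [Nat.cast_nonneg (α := ℝ) ⌊x⌋₊])) hS18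
      (fun G hG => Nat.le_floor (harb G hG).2) A hA
    have hD := clog_sqrt_half_le hδ hδ1 hn hS18 hxS
    refine ⟨R, ?_, B, fun G hG I hI => (hB G hG I hI).mono (by omega)⟩
    -- There is no `β` here, so both factors are bounded through `δ`. The extra 3 in `x` turns the
    -- constant 30 into 90.
    have h := rounds_le (x := 3 / δ) hδ hδ1 hR hD
      (by rw [show 3 * (3 / δ) = 9 / δ by ring]; exact hD)
    have h0 : (0 : ℝ) ≤ (30 * (7 * k + 20) : ℕ) / δ * T := by positivity
    calc (R : ℝ) ≤ _ := h
      _ ≤ (90 * (7 * k + 20) : ℕ) * (1 / δ ^ 2) + 3 * ((30 * (7 * k + 20) : ℕ) / δ * T) := by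
        have : ((30 * (7 * k + 20) : ℕ) : ℝ) * (3 / δ / δ) =
          (90 * (7 * k + 20) : ℕ) * (1 / δ ^ 2) := by push_cast; field_simp; ring
        linarith
      _ = _ := by push_cast; ring

end CliqueSim

end

/-! ### The theorem -/

theorem mainTheorem10 (k κ : ℕ) (hk : 1 ≤ k) (hκ : k ≤ κ) :
    (∃ K κ' : ℕ, κ ≤ κ' ∧
      ∀ δ : ℝ, 0 < δ → δ < 1 →
      ∀ (C a S T : ℕ → ℕ) (β : ℕ → ℝ),
        (∀ n, 1 ≤ C n) → (∀ n, 1 ≤ a n) → (∀ n, 2 ≤ β n) →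
        (∀ n : ℕ, (K : ℝ) * (β n * a n * (β n * a n + Real.logb (β n) n) + C n * β n * a n)
          ≤ S n) →
        (∀ n : ℕ, (n : ℝ) ^ δ ≤ S n) →
      ∀ P : CliqueSim.UnlabeledGraphProblem,
        (∀ (n : ℕ) (G : SimpleGraph (Fin n)), P.IsInstance G → CliqueSim.arboricity G ≤ a n) →
        CliqueSim.NCCStarSolvable k κ C P T →
        ∃ R : ℕ → ℕ,
          (∀ n : ℕ, (R n : ℝ) ≤ K * (⌈Real.logb (β n) n⌉₊ / δ) + K / δ * T n) ∧
          CliqueSim.MPCSolvable k κ' (fun n => n) S P R) ∧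
    (∃ K : ℕ, ∀ δ : ℝ, 0 < δ → δ < 1 / 4 → ∃ κ' : ℕ, κ ≤ κ' ∧
      ∀ (T : ℕ → ℕ) (P : CliqueSim.UnlabeledGraphProblem),
        (∀ (n : ℕ) (G : SimpleGraph (Fin n)), P.IsInstance G →
          2 ≤ (n : ℝ) ^ δ ∧ (CliqueSim.arboricity G : ℝ) ≤ (n : ℝ) ^ δ) →
        CliqueSim.NCCStarSolvable k κ (fun n => ⌊(n : ℝ) ^ δ⌋₊) P T →
        ∃ R : ℕ → ℕ,
          (∀ n : ℕ, (R n : ℝ) ≤ K * (1 / δ ^ 2) + K / δ * T n) ∧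
          CliqueSim.MPCSolvable k κ' (fun n => n) (fun n => ⌊(n : ℝ) ^ (4 * δ)⌋₊) P R) := by
  -- In the first claim only `n ≤ 1` is treated by spreading the input, so the word constant does
  -- not depend on `δ`.
  refine ⟨⟨30 * (7 * k + 20), CliqueSim.simWord k κ + κ + CliqueSim.gossipWord 0 k +
    CliqueSim.gossipWord 1 k + 3, by omega, ?_⟩, 90 * (7 * k + 20), ?_⟩
  · intro δ hδ hδ1 C a S T β hC ha hβ hS hnS P harb hP
    choose A hA using hP
    choose R hR hB using fun n => CliqueSim.exists_mpc_of_logb hk hκ le_rfl hδ hδ1 (hC n) (ha n)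
      (hβ n) (hS n) (hnS n) (harb n) (A n) (hA n)
    exact ⟨R, hR, hB⟩
  · intro δ hδ hδ4
    -- In the second claim the word constant must cover every `n` with `n ^ δ < 4`. These are
    -- finitely many, all below `4 ^ δ⁻¹`, and the sum dominates each of their constants.
    refine ⟨CliqueSim.simWord k κ + κ +
      ∑ n ∈ Finset.range (⌈(4 : ℝ) ^ δ⁻¹⌉₊), (CliqueSim.gossipWord n k + 3), by omega, ?_⟩
    intro T P harb hP
    choose A hA using hP
    have hg : ∀ n : ℕ, (n : ℝ) ^ δ < 4 → CliqueSim.gossipWord n k + 3 ≤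
        CliqueSim.simWord k κ + κ +
          ∑ n ∈ Finset.range (⌈(4 : ℝ) ^ δ⁻¹⌉₊), (CliqueSim.gossipWord n k + 3) := by
      intro n hn
      refine le_trans ?_ (Nat.le_add_left _ _)
      refine Finset.single_le_sum (f := fun n => CliqueSim.gossipWord n k + 3)
        (fun _ _ => Nat.zero_le _) (Finset.mem_range.2 (Nat.lt_ceil.2 ?_))
      calc (n : ℝ) = ((n : ℝ) ^ δ) ^ δ⁻¹ := (Real.rpow_rpow_inv (by positivity) hδ.ne').symm
        _ < 4 ^ δ⁻¹ := Real.rpow_lt_rpow (by positivity) hn (by positivity)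
    choose R hR hB using fun n => CliqueSim.exists_mpc_of_rpow hk hκ hδ (by linarith)
      (Nat.le_add_right _ _) (hg n) (harb n) (A n) (hA n)
    exact ⟨R, hR, hB⟩
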